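/- Write $x=(x',x_n)$, $\xi=(\xi',\xi_n)\in\mathbb{R}^{n}=\mathbb{R}^{n-1}\times\mathbb{R}$, $n\ge 1$, and $\langle\xi'\rangle=(1+|\xi'|^2)^{1/2}$. Let $\Omega'\subset\mathbb{R}^{n-1}$ be open and connected, and $\Omega=\Omega'\times\,]-1,1[$. Let $\chi$ be a symplectomorphism of an open conic subset $U$ of $T^*\mathbb{R}^n\setminus 0$ (coordinates $(y,\eta)$) onto its image in $T^*\mathbb{R}^n\setminus 0$ (coordinates $(x,\xi)$), positively homogeneous of degree one in the fibres, which preserves the boundary: $x_n(y,\eta)=0$ if and only if $y_n=0$, and $x(y',0,\eta)=(b(y'),0)$ for a local diffeomorphism $b$ of $\mathbb{R}^{n-1}$ (a diffeomorphism between open sets). Assume that $\chi$ is admissible: every component $p$ of $\chi$, homogeneous of degree $\mu\in\{0,1\}$, satisfies $\partial_{y}^{\beta}\partial_{\eta'}^{\alpha}p(y',0,0,1)=(-1)^{\mu-|\alpha|}\partial_{y}^{\beta}\partial_{\eta'}^{\alpha}p(y',0,0,-1)$ for all $\alpha,\beta$, at all $y'$ for which both points lie in $U$. Let $\psi$ be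 a phase function representing $\chi$ over $\Omega$: a real function, smooth on $\Omega\times(\mathbb{R}^n\setminus\{0\})$, positively homogeneous of degree one in $\xi$, with $(\nabla_\xi\psi(x,\xi),\xi)\in U$ and $\chi(\nabla_\xi\psi(x,\xi),\xi)=(x,\nabla_x\psi(x,\xi))$. Then $\psi(x',0,\xi',\xi_n)$ does not depend on $\xi_n$; put $\psi_\partial(x',\xi')=\psi(x',0,\xi',\xi_n)$. $S^m(\mathbb{R}^n\times\mathbb{R}^n)$, $m\in\mathbb{R}$, is the class of smooth $a$ with $|\partial_x^\beta\partial_\xi^\alpha a(x,\xi)|\le C_{\alpha\beta L}\langle\xi\rangle^{m-|\alpha|}$ for all $\xi$ and all $x$ in a compact set $L$. Such an $a$ satisfies the transmission condition if, for all $l$, $\partial_{x_n}^l a(x',0,\xi',\langle\xi'\rangle\xi_n)\in S^m(\mathbb{R}^{n-1}\times\mathbb{R}^{n-1})\hat\otimes_\pi H_{\xi_n}$, where $H=H^+\oplus H_0^-\oplus H'$, $H^+=\mathscr{F}(e^+\mathscr{S}(\mathbb{R}_+))$, $H^-_0=\mathscr{F}(e^-\mathscr{S}(\mathbb{R}_-))$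 ($e^\pm$ denoting extension by zero) and $H'$ is the space of polynomials. Let $E,F$ be locally convex spaces with group actions $\kappa_\lambda$, $\lambda>0$. Then $S^m(\mathbb{R}^{n-1},\mathbb{R}^{n-1};E,F)$ denotes the smooth functions $A$ of $(x',\xi')$ with values in $\mathcal{L}(E,F)$ such that for all $\alpha,\beta$, all compact $L\subset\mathbb{R}^{n-1}$ and every continuous seminorm $q$ on $F$ there is a continuous seminorm $p$ on $E$ with $q(\kappa_{\langle\xi'\rangle^{-1}}\partial_{\xi'}^\alpha\partial_{x'}^\beta A(x',\xi')\kappa_{\langle\xi'\rangle}u)\le\langle\xi'\rangle^{m-|\alpha|}p(u)$ for all $x'\in L$, $\xi'\in\mathbb{R}^{n-1}$, $u\in E$. On $\mathscr{S}(\mathbb{R})$ take $(\kappa_\lambda u)(t)=\lambda^{1/2}u(\lambda t)$, and on $\mathscr{S}'(\mathbb{R})$ (strong dual topology) its extension by duality. Theorem 2. There is an open neighbourhood $N\subset\Omega$ of $\Omega'\times\{0\}$, depending only on $\Omega'$, $\chi$ and $\psi$, such that the following holds for every $m\in\mathbb{R}$ and every $a\in S^m(\mathbb{R}^n\times\mathbb{R}^n)$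 which satisfies the transmission condition, vanishes in a neighbourhood of $\{\xi=0\}$, and whose $x$-support (the closure of $\{x:\ a(x,\cdot)\not\equiv0\}$ in $\mathbb{R}^n$) is contained in $N$. The formula $$(A_n^\chi(x',\xi') u)(x_n)=\frac1{2\pi}\int e^{i(\psi(x',x_n,\xi',\xi_n)-\psi_\partial(x',\xi'))}a(x',x_n,\xi',\xi_n)\,\hat u(\xi_n)\,d\xi_n$$ (with the integrand read as $0$ where $a=0$) defines an operator-valued symbol $A_n^\chi\in S^m(\mathbb{R}^{n-1},\mathbb{R}^{n-1};\mathscr{S}(\mathbb{R}),\mathscr{S}(\mathbb{R}))$, and $A_n^\chi$ extends to an operator-valued symbol in $S^m(\mathbb{R}^{n-1},\mathbb{R}^{n-1};\mathscr{S}'(\mathbb{R}),\mathscr{S}'(\mathbb{R}))$. -/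

import Mathlib

open Filter Topology MeasureTheory Set
open scoped SchwartzMap ContDiff

noncomputable section

/-! ### Coordinates

`Bdry d` is the space of tangential (co)variables, of dimension `d = n - 1`, and
`Amb d = Bdry d × ℝ` is `ℝ^n`, with points `x = (x', x_n)` and covectors `ξ = (ξ', ξ_n)`. -/

abbrev Bdry (d : ℕ) : Type := EuclideanSpace ℝ (Fin d)

abbrev Amb (d : ℕ) : Type := Bdry d × ℝ

/-- The Euclidean pairing of `ℝ^n = ℝ^{n-1} × ℝ`. -/
def pair {d : ℕ} (v w : Amb d) : ℝ := inner ℝ v.1 w.1 + v.2 * w.2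

/-- The Japanese bracket `⟨ξ'⟩ = (1 + |ξ'|²)^{1/2}`. -/
def jb {d : ℕ} (ξ : Bdry d) : ℝ := Real.sqrt (1 + ‖ξ‖ ^ 2)

theorem jb_pos {d : ℕ} (ξ : Bdry d) : 0 < jb ξ := Real.sqrt_pos.2 (by positivity)

/-! ### Derivatives and scalar symbols -/

section Symbols

variable {V W Z : Type*} [NormedAddCommGroup V] [NormedSpace ℝ V]
  [NormedAddCommGroup W] [NormedSpace ℝ W] [NormedAddCommGroup Z] [NormedSpace ℝ Z]

/-- The mixed derivative `∂_{v_1} ⋯ ∂_{v_j} ∂_{w_1} ⋯ ∂_{w_k} p` at `z`, with `j` directions in the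
first and `k` directions in the second group of variables. -/
def mixedDeriv {j k : ℕ} (p : V × W → Z) (z : V × W) (v : Fin j → V) (w : Fin k → W) : Z :=
  iteratedFDeriv ℝ (j + k) p z
    (Fin.append (fun i => ((v i, 0) : V × W)) (fun i => ((0, w i) : V × W)))

/-- The Hörmander class `S^m(V × W) = S^m_{1,0}`: all derivatives satisfy
`|∂_x^β ∂_ξ^α a(x, ξ)| ≤ C ⟨ξ⟩^{m-|α|}`, locally uniformly in `x` and for all `ξ`.
The weight `1 + ‖ξ‖` is equivalent to `⟨ξ⟩`. -/
def IsSymbol (m : ℝ) (a : V × W → ℂ) : Prop :=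
  ContDiff ℝ ∞ a ∧
  ∀ (j k : ℕ) (K : Set V), IsCompact K → ∃ C : ℝ, ∀ x ∈ K, ∀ (ξ : W) (v : Fin j → V)
    (w : Fin k → W),
    ‖mixedDeriv a (x, ξ) v w‖ ≤ C * (1 + ‖ξ‖) ^ (m - (k : ℝ)) * (∏ i, ‖v i‖) * ∏ i, ‖w i‖

/-- Convergence to zero of a sequence in the Fréchet space `S^m(V × W)`. -/
def IsNullSymbolSeq (m : ℝ) (f : ℕ → V × W → ℂ) : Prop :=
  (∀ i, IsSymbol m (f i)) ∧
  ∀ (j k : ℕ) (K : Set V), IsCompact K → ∀ ε : ℝ, 0 < ε → ∀ᶠ i in atTop,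
    ∀ x ∈ K, ∀ (ξ : W) (v : Fin j → V) (w : Fin k → W),
      ‖mixedDeriv (f i) (x, ξ) v w‖
        ≤ ε * (1 + ‖ξ‖) ^ (m - (k : ℝ)) * (∏ i, ‖v i‖) * ∏ i, ‖w i‖

end Symbols

/-! ### The transmission condition -/

/-- The Fourier transform `∫ e^{-i y s} u(y) dy`. -/
def hat (u : ℝ → ℂ) (s : ℝ) : ℂ := ∫ y : ℝ, Complex.exp (-(Complex.I * y * s)) * u y

/-- The general element `F(e^+ r^+ u) + F(e^- r^- v) + p` of `H = H^+ ⊕ H^-_0 ⊕ H'`. -/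
def transElt (u v : 𝓢(ℝ, ℂ)) (p : Polynomial ℂ) (s : ℝ) : ℂ :=
  hat ((Ioi (0 : ℝ)).indicator u) s + hat ((Iio (0 : ℝ)).indicator v) s + p.eval (s : ℂ)

/-- A function `g(x', ξ', ξ_n)` belongs to the completed projective tensor product
`S^m(ℝ^{n-1} × ℝ^{n-1}) ⊗_π H`: it is a series `∑ λ_i f_i ⊗ h_i` with `∑ |λ_i| < ∞` and null
sequences `f_i` in `S^m` and `h_i` in `H`. A null sequence of `H` has polynomial parts of bounded
degree whose coefficients tend to zero; the parts in `H^±` carry the quotient topology of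
`𝓢(ℝ)`, so that null sequences lift to null sequences of `𝓢(ℝ)`. -/
def InSymbolTensorH {d : ℕ} (m : ℝ) (g : Bdry d → Bdry d → ℝ → ℂ) : Prop :=
  ∃ (N : ℕ) (c : ℕ → ℂ) (f : ℕ → Bdry d × Bdry d → ℂ) (u v : ℕ → 𝓢(ℝ, ℂ))
    (p : ℕ → Polynomial ℂ),
    Summable (fun i => ‖c i‖) ∧ IsNullSymbolSeq m f ∧
    Tendsto u atTop (𝓝 0) ∧ Tendsto v atTop (𝓝 0) ∧
    (∀ i, (p i).natDegree ≤ N) ∧ (∀ r : ℕ, Tendsto (fun i => (p i).coeff r) atTop (𝓝 0)) ∧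
    ∀ (x ξ : Bdry d) (s : ℝ),
      HasSum (fun i => c i * f i (x, ξ) * transElt (u i) (v i) (p i) s) (g x ξ s)

/-- The transmission condition at `x_n = 0` for a symbol of order `m`: for all `l`,
`∂_{x_n}^l a(x', 0, ξ', ⟨ξ'⟩ ξ_n) ∈ S^m(ℝ^{n-1} × ℝ^{n-1}) ⊗_π H_{ξ_n}`. -/
def HasTransmission {d : ℕ} (m : ℝ) (a : Amb d × Amb d → ℂ) : Prop :=
  ∀ l : ℕ, InSymbolTensorH m fun (x ξ : Bdry d) (s : ℝ) =>
    iteratedDeriv l (fun r : ℝ => a ((x, r), (ξ, jb ξ * s))) 0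

/-- The transmission (symmetry) condition at `y_n = 0` for a function `p(y, η)`, smooth on the open
conic set `U` and positively homogeneous of integer degree `μ` in `η`:
`∂_y^β ∂_{η'}^α p(y', 0, 0, 1) = (-1)^{μ-|α|} ∂_y^β ∂_{η'}^α p(y', 0, 0, -1)`. -/
def HomTransmission {d : ℕ} {Z : Type*} [NormedAddCommGroup Z] [NormedSpace ℝ Z]
    (U : Set (Amb d × Amb d)) (μ : ℕ) (p : Amb d × Amb d → Z) : Prop :=
  ∀ y : Bdry d, ((y, 0), (0, 1)) ∈ U → ((y, 0), (0, -1)) ∈ U →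
    ∀ (j k : ℕ) (v : Fin j → Amb d) (w : Fin k → Bdry d),
      mixedDeriv p ((y, 0), (0, 1)) v (fun i => ((w i, 0) : Amb d))
        = (-1 : ℝ) ^ (μ + k) •
          mixedDeriv p ((y, 0), (0, -1)) v (fun i => ((w i, 0) : Amb d))

/-! ### Boundary preserving symplectomorphisms and their phase functions -/

/-- The canonical symplectic form of `T^*ℝ^n = ℝ^n × ℝ^n`. -/
def sympForm {d : ℕ} (z w : Amb d × Amb d) : ℝ := pair z.1 w.2 - pair z.2 w.1

/-- `χ` is, in local coordinates `(y', y_n)` and `(x', x_n)` whose last components are boundary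
defining functions, a symplectomorphism from the open conic set `U ⊆ T^*ℝ^n ∖ 0` to its image in
`T^*ℝ^n ∖ 0`, positively homogeneous of degree one in the fibres, which preserves the boundary,
inducing there a diffeomorphism `b` of the base. -/
structure IsBoundarySymplecto {d : ℕ} (U : Set (Amb d × Amb d))
    (χ : Amb d × Amb d → Amb d × Amb d) : Prop where
  isOpen : IsOpen U
  conic : ∀ y η, (y, η) ∈ U → ∀ t : ℝ, 0 < t → (y, t • η) ∈ U
  source_ne : ∀ z ∈ U, z.2 ≠ 0
  target_ne : ∀ z ∈ U, (χ z).2 ≠ 0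
  smooth : ContDiffOn ℝ ∞ χ U
  injOn : InjOn χ U
  homogeneous : ∀ y η, (y, η) ∈ U → ∀ t : ℝ, 0 < t →
    χ (y, t • η) = ((χ (y, η)).1, t • (χ (y, η)).2)
  symplectic : ∀ z ∈ U, ∀ v w, sympForm (fderiv ℝ χ z v) (fderiv ℝ χ z w) = sympForm v w
  boundary_iff : ∀ z ∈ U, (χ z).1.2 = 0 ↔ z.1.2 = 0
  boundary_map : ∃ b : OpenPartialHomeomorph (Bdry d) (Bdry d),
    ContDiffOn ℝ ∞ b b.source ∧ ContDiffOn ℝ ∞ b.symm b.target ∧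
    ∀ y η, ((y, 0), η) ∈ U → y ∈ b.source ∧ (χ ((y, 0), η)).1 = (b y, 0)

/-- Admissibility: the components `x(y, η)`, homogeneous of degree `0`, and `ξ(y, η)`, homogeneous
of degree `1`, satisfy the transmission condition at the boundary. -/
def IsAdmissible {d : ℕ} (U : Set (Amb d × Amb d)) (χ : Amb d × Amb d → Amb d × Amb d) : Prop :=
  HomTransmission U 0 (fun z => (χ z).1) ∧ HomTransmission U 1 (fun z => (χ z).2)

/-- The set `Ω = Ω' × ]-1, 1[`. -/
def collar {d : ℕ} (Ωb : Set (Bdry d)) : Set (Amb d) := Ωb ×ˢ Ioo (-1 : ℝ) 1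

/-- `ψ` is a generating function of `χ` over `Ω = Ω' × ]-1, 1[`: it is smooth on `Ω × (ℝ^n ∖ 0)`,
positively homogeneous of degree one in `ξ`, and `ψ(x, ξ) - ⟨y, ξ⟩` parametrizes the graph of `χ`,
that is, `χ(∇_ξ ψ(x, ξ), ξ) = (x, ∇_x ψ(x, ξ))`. -/
structure IsPhaseOf {d : ℕ} (U : Set (Amb d × Amb d)) (χ : Amb d × Amb d → Amb d × Amb d)
    (Ωb : Set (Bdry d)) (ψ : Amb d × Amb d → ℝ) : Prop where
  smooth : ContDiffOn ℝ ∞ ψ (collar Ωb ×ˢ {ξ : Amb d | ξ ≠ 0})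
  homogeneous : ∀ x ∈ collar Ωb, ∀ ξ : Amb d, ξ ≠ 0 → ∀ t : ℝ, 0 < t →
    ψ (x, t • ξ) = t * ψ (x, ξ)
  generates : ∀ x ∈ collar Ωb, ∀ ξ : Amb d, ξ ≠ 0 → ∃ y ζ : Amb d,
    (∀ v, fderiv ℝ (fun θ => ψ (x, θ)) ξ v = pair y v) ∧
    (∀ v, fderiv ℝ (fun z => ψ (z, ξ)) x v = pair ζ v) ∧
    (y, ξ) ∈ U ∧ χ (y, ξ) = (x, ζ)

/-- The boundary phase `ψ_∂(x', ξ') = ψ(x', 0, ξ', ξ_n)`. The right hand side does not depend on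
`ξ_n`, see `psiBdry_eq`, and is evaluated at `ξ_n = 1`. -/
def psiBdry {d : ℕ} (ψ : Amb d × Amb d → ℝ) (x ξ : Bdry d) : ℝ := ψ ((x, 0), (ξ, 1))

section WellDefined

variable {d : ℕ} {U : Set (Amb d × Amb d)} {χ : Amb d × Amb d → Amb d × Amb d}
  {Ωb : Set (Bdry d)} {ψ : Amb d × Amb d → ℝ}

theorem IsPhaseOf.hasFDerivAt (hψ : IsPhaseOf U χ Ωb ψ) (hΩ : IsOpen Ωb) {x : Amb d}
    (hx : x ∈ collar Ωb) {ξ : Amb d} (hξ : ξ ≠ 0) :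
    HasFDerivAt (fun θ => ψ (x, θ)) (fderiv ℝ (fun θ => ψ (x, θ)) ξ) ξ := by
  have ho : IsOpen (collar Ωb ×ˢ {ξ : Amb d | ξ ≠ 0}) :=
    (hΩ.prod isOpen_Ioo).prod isOpen_ne
  have h1 : DifferentiableAt ℝ ψ (x, ξ) :=
    (hψ.smooth.contDiffAt (ho.mem_nhds (mk_mem_prod hx hξ))).differentiableAt (by simp)
  exact (h1.comp ξ (by fun_prop : DifferentiableAt ℝ (fun θ : Amb d => (x, θ)) ξ)).hasFDerivAt

theorem IsPhaseOf.fderiv_normal (hχ : IsBoundarySymplecto U χ) (hψ : IsPhaseOf U χ Ωb ψ)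
    {x : Bdry d} (hx : x ∈ Ωb) {ξ : Amb d} (hξ : ξ ≠ 0) (r : ℝ) :
    fderiv ℝ (fun θ => ψ ((x, 0), θ)) ξ (0, r) = 0 := by
  obtain ⟨y, ζ, h1, -, hU, h2⟩ := hψ.generates (x, 0) ⟨hx, by simp⟩ ξ hξ
  have h3 : y.2 = 0 := (hχ.boundary_iff _ hU).1 (by rw [h2])
  rw [h1]
  simp [pair, h3]

/-- `ψ(x', 0, ξ', ξ_n)` does not depend on `ξ_n`. -/
theorem psiBdry_eq (hΩ : IsOpen Ωb) (hχ : IsBoundarySymplecto U χ) (hψ : IsPhaseOf U χ Ωb ψ)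
    {x : Bdry d} (hx : x ∈ Ωb) {ξ : Bdry d} {s : ℝ} (h : ((ξ, s) : Amb d) ≠ 0) :
    ψ ((x, 0), (ξ, s)) = psiBdry ψ x ξ := by
  have hc : ((x, 0) : Amb d) ∈ collar Ωb := ⟨hx, by simp⟩
  by_cases h0 : ξ = 0
  · subst h0
    have key : ∀ r : ℝ, r ≠ 0 → ψ ((x, 0), ((0 : Bdry d), r)) = 0 := by
      intro r hr
      have hne : (((0 : Bdry d), r) : Amb d) ≠ 0 := by simp [hr]
      have e1 : HasDerivAt (fun t : ℝ => t • (((0 : Bdry d), r) : Amb d)) ((0 : Bdry d), r) 1 := by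
        simpa using (hasDerivAt_id (1 : ℝ)).smul_const (((0 : Bdry d), r) : Amb d)
      have e2 := hψ.hasFDerivAt hΩ hc hne
      rw [show (((0 : Bdry d), r) : Amb d) = (1 : ℝ) • ((0 : Bdry d), r) by simp] at e2
      have e3 := e2.comp_hasDerivAt (1 : ℝ) e1
      rw [one_smul, hψ.fderiv_normal hχ hx hne] at e3
      have e4 : HasDerivAt (fun t : ℝ => t * ψ ((x, 0), ((0 : Bdry d), r)))
          (ψ ((x, 0), ((0 : Bdry d), r))) 1 := by
        simpa using (hasDerivAt_id (1 : ℝ)).mul_const (ψ ((x, 0), ((0 : Bdry d), r)))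
      refine e4.unique (e3.congr_of_eventuallyEq ?_)
      filter_upwards [lt_mem_nhds (zero_lt_one : (0 : ℝ) < 1)] with t ht
      exact (hψ.homogeneous _ hc _ hne t ht).symm
    rw [psiBdry, key s (by rintro rfl; exact h rfl), key 1 one_ne_zero]
  · have hne : ∀ r : ℝ, ((ξ, r) : Amb d) ≠ 0 := fun r hr => h0 (congrArg Prod.fst hr)
    have hd : ∀ r : ℝ, HasDerivAt (fun r : ℝ => ψ ((x, 0), (ξ, r))) 0 r := by
      intro r
      have e1 : HasDerivAt (fun r : ℝ => ((ξ, r) : Amb d)) (0, 1) r :=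
        (hasDerivAt_const r ξ).prodMk (hasDerivAt_id r)
      have e3 := (hψ.hasFDerivAt hΩ hc (hne r)).comp_hasDerivAt r e1
      rwa [hψ.fderiv_normal hχ hx (hne r)] at e3
    exact is_const_of_deriv_eq_zero (fun r => (hd r).differentiableAt) (fun r => (hd r).deriv) s 1

end WellDefined

/-- The value `(2π)^{-1} ∫ e^{i(ψ(x', x_n, ξ', ξ_n) - ψ_∂(x', ξ'))} a(x', x_n, ξ', ξ_n) û(ξ_n) dξ_n`
at `x_n = t` of the operator in the normal direction. -/
def normalOp {d : ℕ} (ψ : Amb d × Amb d → ℝ) (a : Amb d × Amb d → ℂ) (x ξ : Bdry d)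
    (u : 𝓢(ℝ, ℂ)) (t : ℝ) : ℂ :=
  (2 * Real.pi : ℂ)⁻¹ * ∫ s : ℝ,
    Complex.exp (Complex.I * ((ψ ((x, t), (ξ, s)) - psiBdry ψ x ξ : ℝ) : ℂ))
      * a ((x, t), (ξ, s)) * hat u s

/-! ### Operator-valued symbols -/

/-- The space `𝓢'(ℝ)` of temperate distributions with the strong dual topology. -/
abbrev TempDual : Type := 𝓢(ℝ, ℂ) →L[ℂ] ℂ

/-- The canonical embedding `𝓢(ℝ) → 𝓢'(ℝ)`, `f ↦ (u ↦ ∫ u f)`. -/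
def toTempDual (f : 𝓢(ℝ, ℂ)) : TempDual :=
  (SchwartzMap.integralCLM ℂ volume).comp
    (SchwartzMap.bilinLeftCLM (ContinuousLinearMap.mul ℂ ℂ) f.hasTemperateGrowth)

theorem toTempDual_apply (f u : 𝓢(ℝ, ℂ)) : toTempDual f u = ∫ t : ℝ, u t * f t := rfl

/-- The group action `(κ_r u)(t) = r^{1/2} u(r t)`, `r > 0`, on `𝓢(ℝ)`. -/
def kappa (r : ℝ) (hr : 0 < r) : 𝓢(ℝ, ℂ) →L[ℂ] 𝓢(ℝ, ℂ) :=
  ((Real.sqrt r : ℝ) : ℂ) • SchwartzMap.compCLMOfContinuousLinearEquiv ℂ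
    (ContinuousLinearEquiv.unitsEquivAut ℝ (Units.mk0 r hr.ne'))

theorem kappa_apply (r : ℝ) (hr : 0 < r) (u : 𝓢(ℝ, ℂ)) (t : ℝ) :
    kappa r hr u t = (Real.sqrt r : ℝ) * u (t * r) := rfl

/-- The group action on `𝓢'(ℝ)` that extends `kappa`: `(κ_r T)(u) = T(κ_{1/r} u)`. -/
def kappaDual (r : ℝ) (hr : 0 < r) : TempDual →L[ℂ] TempDual :=
  ContinuousLinearMap.precomp ℂ (kappa r⁻¹ (inv_pos.2 hr))

theorem kappaDual_apply (r : ℝ) (hr : 0 < r) (T : TempDual) (u : 𝓢(ℝ, ℂ)) :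
    kappaDual r hr T u = T (kappa r⁻¹ (inv_pos.2 hr) u) := rfl

section OperatorSymbols

variable {E F : Type*} [AddCommGroup E] [Module ℂ E] [TopologicalSpace E]
  [IsTopologicalAddGroup E] [ContinuousSMul ℂ E] [AddCommGroup F] [Module ℂ F] [TopologicalSpace F]
  [IsTopologicalAddGroup F] [ContinuousSMul ℂ F]

/-- The class `S^m(ℝ^{n-1}, ℝ^{n-1}; E, F)` of operator-valued symbols for locally convex spaces
`E`, `F` with group actions `κE`, `κF`. The function `A(x', ξ')` with values in `L(E, F)` (with the
topology of bounded convergence) is smooth, with derivatives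
`D β α = ∂_{x'}^β ∂_{ξ'}^α A`, and for all `α`, `β`, every compact set of `x'` and every continuous
seminorm `q` of `F` there is a continuous seminorm `p` of `E` with
`q(κ_{⟨ξ'⟩}⁻¹ ∂_{ξ'}^α ∂_{x'}^β A(x', ξ') κ_{⟨ξ'⟩} u) ≤ ⟨ξ'⟩^{m-|α|} p(u)`. -/
def IsOperatorSymbol {d : ℕ} (m : ℝ) (κE : ∀ r : ℝ, 0 < r → E →L[ℂ] E)
    (κF : ∀ r : ℝ, 0 < r → F →L[ℂ] F) (A : Bdry d → Bdry d → E →L[ℂ] F) : Prop :=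
  ∃ D : (Fin d → ℕ) → (Fin d → ℕ) → Bdry d → Bdry d → E →L[ℂ] F,
    D 0 0 = A ∧
    (∀ β α, Continuous fun z : Bdry d × Bdry d => D β α z.1 z.2) ∧
    (∀ β α i x ξ, Tendsto
      (fun h : ℝ => (h : ℂ)⁻¹ • (D β α (x + h • EuclideanSpace.single i (1 : ℝ)) ξ - D β α x ξ))
      (𝓝[≠] 0) (𝓝 (D (β + Pi.single i 1) α x ξ))) ∧
    (∀ β α i x ξ, Tendsto
      (fun h : ℝ => (h : ℂ)⁻¹ • (D β α x (ξ + h • EuclideanSpace.single i (1 : ℝ)) - D β α x ξ))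
      (𝓝[≠] 0) (𝓝 (D β (α + Pi.single i 1) x ξ))) ∧
    ∀ (β α : Fin d → ℕ) (K : Set (Bdry d)), IsCompact K →
      ∀ q : Seminorm ℂ F, Continuous q → ∃ p : Seminorm ℂ E, Continuous p ∧
        ∀ x ∈ K, ∀ (ξ : Bdry d) (u : E),
          q (κF (jb ξ)⁻¹ (inv_pos.2 (jb_pos ξ)) (D β α x ξ (κE (jb ξ) (jb_pos ξ) u)))
            ≤ jb ξ ^ (m - ((∑ i, α i : ℕ) : ℝ)) * p u

end OperatorSymbols

end

/-!
The phase of `A_n^χ` is `φ(x, ξ) = ψ(x, ξ) - ψ_∂(x', ξ')`, which vanishes for `x_n = 0`. At the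
boundary `∂_{x_n} ∂_{ξ_n} ψ ≠ 0`, since `y = ∇_ξ ψ(x, ξ)` is a local diffeomorphism in `x` that maps
the boundary to the boundary; and `∂_{x_n} ψ ≠ 0` at the conormal covectors `ξ' = 0`, since
the covector component of `χ` does not vanish. In a neighbourhood `N` of the boundary (`goodSet`)
this gives, locally uniformly in `x'`, two bounds in terms of the rescaled normal variables
`⟨ξ'⟩ x_n` and `ξ_n / ⟨ξ'⟩`: the derivative `∂_{ξ_n} φ` controls `x_n`, and `∂_{x_n} φ` controls `ξ_n`
up to a multiple of `⟨ξ'⟩` (`isNormalPhase_redPhase`).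

Amplitudes are measured by the weights `⟨ξ'⟩^μ (1 + ⟨ξ'⟩ |x_n|)^k (1 + |ξ_n| / ⟨ξ'⟩)^j`, each
derivative changing the order `μ` by the scaling weight of its variable only (`IsAmp`). Homogeneous
functions and symbols whose support stays away from `ξ = 0` are such amplitudes (`IsHom.isAmp`,
`IsSymbol.isAmp`). For kernels `e^{iφ} b` with an amplitude `b` (`IsOscKernel`), the two bounds on
the phase turn multiplication by `x_n` into a `ξ_n`-derivative, and multiplication by `ξ_n` into an
`x_n`-derivative, up to kernels of the same type (`IsOscKernel.decay`); nothing is lost in the powers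
`k` and `j`, while derivatives raise them. Integrating by parts against a Schwartz function one
gains arbitrary decay, and hence both the operator with kernel `e^{iφ} b` and its transpose act
continuously on `𝓢(ℝ)` (`KernelClass.exists_operator`). The same argument, applied to families of
kernels, gives uniform bounds: for the kernels rescaled by `κ_{⟨ξ'⟩}` it gives the symbol estimates
(`IsSidedKernel.equiBoundedOn_conj`), and for difference quotients it gives smoothness in `(x', ξ')`
(`IsSidedKernel.equiBoundedOn_sub`, `IsSidedKernel.equiBoundedOn_taylor`).

The operator `A_n^χ(x', ξ')` is the operator with kernel `(2π)⁻¹ e^{iφ} a` after the Fourier transform,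
which exchanges `κ_λ` and `κ_{1/λ}`. The extension to `𝓢'(ℝ)` is the transpose of the
composition of the transposed kernel operator with the Fourier transform; bounded sets of `𝓢(ℝ)` are
mapped to bounded sets, so the estimates pass to the strong dual (`EquiBoundedOn.precomp`).
-/

noncomputable section

/-! ### Equibounded families of operators -/

section EquiBounded

variable {ι E F G : Type*} [AddCommGroup E] [Module ℂ E] [TopologicalSpace E]
  [AddCommGroup F] [Module ℂ F] [TopologicalSpace F]
  [AddCommGroup G] [Module ℂ G] [TopologicalSpace G]

/-- The operators `(r i)⁻¹ M i`, `i ∈ S`, are equicontinuous, expressed by continuous seminorms. -/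
def EquiBoundedOn (S : Set ι) (M : ι → E →L[ℂ] F) (r : ι → ℝ) : Prop :=
  ∀ q : Seminorm ℂ F, Continuous q → ∃ p : Seminorm ℂ E, Continuous p ∧
    ∀ i ∈ S, ∀ u, q (M i u) ≤ r i * p u

theorem EquiBoundedOn.comp_left {S : Set ι} {M : ι → E →L[ℂ] F} {r : ι → ℝ}
    (h : EquiBoundedOn S M r) (T : F →L[ℂ] G) : EquiBoundedOn S (fun i => T.comp (M i)) r := by
  intro q hq
  exact h (q.comp T.toLinearMap) (hq.comp T.continuous)

theorem EquiBoundedOn.comp_right {S : Set ι} {M : ι → F →L[ℂ] G} {r : ι → ℝ}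
    (h : EquiBoundedOn S M r) (T : E →L[ℂ] F) : EquiBoundedOn S (fun i => (M i).comp T) r := by
  intro q hq
  obtain ⟨p, hp, hb⟩ := h q hq
  exact ⟨p.comp T.toLinearMap, hp.comp T.continuous, fun i hi u => hb i hi (T u)⟩

theorem EquiBoundedOn.congr {S : Set ι} {M M' : ι → E →L[ℂ] F} {r : ι → ℝ}
    (h : EquiBoundedOn S M r) (hM : ∀ i ∈ S, M' i = M i) : EquiBoundedOn S M' r := by
  intro q hq
  obtain ⟨p, hp, hb⟩ := h q hq
  exact ⟨p, hp, fun i hi u => by rw [hM i hi]; exact hb i hi u⟩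

/-- The topology of `F` is generated by its continuous seminorms. -/
def HasSeminormBasis (F : Type*) [AddCommGroup F] [Module ℂ F] [TopologicalSpace F] : Prop :=
  ∀ V ∈ 𝓝 (0 : F), ∃ q : Seminorm ℂ F, Continuous q ∧ ∀ y, q y < 1 → y ∈ V

theorem exists_seminorm_const_mul {p : Seminorm ℂ E} (hp : Continuous p) {C : ℝ} (hC : 0 ≤ C) :
    ∃ p' : Seminorm ℂ E, Continuous p' ∧ ∀ u, p' u = C * p u := by
  lift C to NNReal using hC
  exact ⟨C • p, hp.const_smul C, fun u => rfl⟩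

theorem exists_seminorm_le_of_isVonNBounded {B : Set E} (hB : Bornology.IsVonNBounded ℂ B)
    {p : Seminorm ℂ E} (hp : Continuous p) : ∃ R : ℝ, 0 < R ∧ ∀ u ∈ B, p u ≤ R := by
  have hV : {u : E | p u < 1} ∈ 𝓝 (0 : E) :=
    (isOpen_lt hp continuous_const).mem_nhds (by simp)
  obtain ⟨r, hr, h⟩ := (hB hV).exists_pos
  refine ⟨r, hr, fun u hu => ?_⟩
  obtain ⟨v, hv, rfl⟩ := h (r : ℂ) (by simp [abs_of_pos hr]) hu
  have hv' : p v < 1 := hv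
  simp only [map_smul_eq_mul, Complex.norm_real, Real.norm_eq_abs, abs_of_pos hr]
  nlinarith

theorem EquiBoundedOn.tendsto_zero [IsTopologicalAddGroup F] (hF : HasSeminormBasis F)
    {S : Set ι} {M : ι → E →L[ℂ] F} {r : ι → ℝ} (h : EquiBoundedOn S M r) {l : Filter ι} (hS : S ∈ l) (hr : Tendsto r l (𝓝 0)) :
    Tendsto M l (𝓝 0) := by
  rw [ContinuousLinearMap.hasBasis_nhds_zero.tendsto_right_iff]
  rintro ⟨B, V⟩ ⟨hB, hV⟩
  obtain ⟨q, hq, hqV⟩ := hF V hV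
  obtain ⟨p, hp, hb⟩ := h q hq
  obtain ⟨R, hR, hpR⟩ := exists_seminorm_le_of_isVonNBounded hB hp
  filter_upwards [hS, hr (Metric.ball_mem_nhds 0 (inv_pos.2 hR))] with i hi hri u hu
  have hri' : |r i| < R⁻¹ := by simpa using hri
  refine hqV _ ?_
  calc q (M i u) ≤ r i * p u := hb i hi u
    _ ≤ |r i| * R := mul_le_mul (le_abs_self _) (hpR u hu) (apply_nonneg _ _) (abs_nonneg _)
    _ < R⁻¹ * R := mul_lt_mul_of_pos_right hri' hR
    _ = 1 := inv_mul_cancel₀ hR.ne'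

theorem continuous_finset_sup_schwartzSeminorm (s : Finset (ℕ × ℕ)) :
    Continuous (s.sup (schwartzSeminormFamily ℂ ℝ ℂ) : Seminorm ℂ 𝓢(ℝ, ℂ)) :=
  Seminorm.continuous_finsetSup fun i _ => (schwartz_withSeminorms ℂ ℝ ℂ).continuous_seminorm i

theorem hasSeminormBasis_schwartz : HasSeminormBasis 𝓢(ℝ, ℂ) := by
  intro V hV
  obtain ⟨s, r, hr, hs⟩ := (schwartz_withSeminorms ℂ ℝ ℂ).mem_nhds_iff 0 V |>.1 hV
  obtain ⟨p, hp, hpe⟩ := exists_seminorm_const_mul (continuous_finset_sup_schwartzSeminorm s)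
    (inv_nonneg.2 hr.le)
  refine ⟨p, hp, fun y hy => hs ?_⟩
  rw [Seminorm.mem_ball, sub_zero]
  rwa [hpe, inv_mul_lt_one₀ hr] at hy

/-- The seminorm `T ↦ sup_{v ∈ B} |T v|` of the strong dual given by a bounded set `B`. -/
theorem exists_seminorm_sup_on {B : Set 𝓢(ℝ, ℂ)} (hB : Bornology.IsVonNBounded ℂ B) :
    ∃ p : Seminorm ℂ TempDual, Continuous p ∧ (∀ T, ∀ v ∈ B, ‖T v‖ ≤ p T) ∧
      ∀ (T : TempDual) (c : ℝ), 0 ≤ c → (∀ v ∈ B, ‖T v‖ ≤ c) → p T ≤ c := by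
  have hbdd : ∀ T : TempDual, BddAbove (range fun v : B => ‖T v‖) := by
    intro T
    obtain ⟨R, -, h⟩ := exists_seminorm_le_of_isVonNBounded hB
      (p := (normSeminorm ℂ ℂ).comp T.toLinearMap) (continuous_norm.comp T.continuous)
    exact ⟨R, by rintro _ ⟨v, rfl⟩; exact h v v.2⟩
  have hle : ∀ T : TempDual, ∀ v ∈ B, ‖T v‖ ≤ ⨆ v : B, ‖T v‖ := fun T v hv =>
    le_ciSup (hbdd T) ⟨v, hv⟩
  have hsup : ∀ (T : TempDual) (c : ℝ), 0 ≤ c → (∀ v ∈ B, ‖T v‖ ≤ c) → ⨆ v : B, ‖T v‖ ≤ c :=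
    fun T c hc h => Real.iSup_le (fun v => h v v.2) hc
  have hnn : ∀ T : TempDual, 0 ≤ ⨆ v : B, ‖T v‖ := fun T => Real.iSup_nonneg fun _ => norm_nonneg _
  let p : Seminorm ℂ TempDual := Seminorm.ofSMulLE (fun T => ⨆ v : B, ‖T v‖)
    (le_antisymm (hsup 0 0 le_rfl (by simp)) (hnn 0))
    (fun S T => hsup _ _ (add_nonneg (hnn S) (hnn T)) fun v hv =>
      (norm_add_le _ _).trans (add_le_add (hle S v hv) (hle T v hv)))
    (fun c T => hsup _ _ (mul_nonneg (norm_nonneg _) (hnn T)) fun v hv => by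
      simpa using mul_le_mul_of_nonneg_left (hle T v hv) (norm_nonneg c))
  refine ⟨p, ?_, hle, hsup⟩
  refine (Seminorm.continuous_iff (p := p) one_pos).2 ?_
  have h1 := ContinuousLinearMap.hasBasis_nhds_zero (𝕜₁ := ℂ) (σ := RingHom.id ℂ)
    (E := 𝓢(ℝ, ℂ)) (F := ℂ) |>.mem_of_mem (i := (B, Metric.closedBall (0 : ℂ) (1 / 2)))
    ⟨hB, Metric.closedBall_mem_nhds 0 (by norm_num)⟩
  refine mem_of_superset h1 fun T hT => ?_
  rw [Seminorm.mem_ball, sub_zero]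
  refine lt_of_le_of_lt (hsup T (1 / 2) (by norm_num) fun v hv => ?_) (by norm_num : (1 / 2 : ℝ) < 1)
  simpa using hT v hv

/-- Every continuous seminorm of the strong dual is dominated by a supremum over a bounded set. -/
theorem exists_isVonNBounded_of_seminorm {q : Seminorm ℂ TempDual} (hq : Continuous q) :
    ∃ (B : Set 𝓢(ℝ, ℂ)) (C : ℝ), Bornology.IsVonNBounded ℂ B ∧ 0 < C ∧
      ∀ (T : TempDual) (c : ℝ), 0 < c → (∀ v ∈ B, ‖T v‖ ≤ c) → q T ≤ C * c := by
  have hV : {T : TempDual | q T < 1} ∈ 𝓝 (0 : TempDual) :=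
    (isOpen_lt hq continuous_const).mem_nhds (by simp)
  obtain ⟨⟨B, V⟩, ⟨hB, hV⟩, h⟩ := ContinuousLinearMap.hasBasis_nhds_zero.mem_iff.1 hV
  obtain ⟨ε, hε, hεV⟩ := Metric.mem_nhds_iff.1 hV
  refine ⟨B, 2 / ε, hB, by positivity, fun T c hc hT => ?_⟩
  have h2 : q (((ε / (2 * c) : ℝ) : ℂ) • T) < 1 := by
    refine h (fun v hv => hεV ?_)
    have h3 := hT v hv
    simp only [smul_apply, smul_eq_mul, mem_ball_zero_iff, norm_mul,
      Complex.norm_real, Real.norm_eq_abs]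
    rw [abs_of_pos (by positivity)]
    calc ε / (2 * c) * ‖T v‖ ≤ ε / (2 * c) * c := by gcongr
      _ = ε / 2 := by field_simp
      _ < ε := by linarith
  rw [map_smul_eq_mul, Complex.norm_real, Real.norm_eq_abs, abs_of_pos (by positivity)] at h2
  rw [div_mul_eq_mul_div, div_lt_one (by positivity)] at h2
  rw [div_mul_eq_mul_div, le_div_iff₀ hε]
  linarith

theorem hasSeminormBasis_tempDual : HasSeminormBasis TempDual := by
  intro V hV
  obtain ⟨⟨B, W⟩, ⟨hB, hW⟩, h⟩ := ContinuousLinearMap.hasBasis_nhds_zero.mem_iff.1 hV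
  obtain ⟨ε, hε, hεW⟩ := Metric.mem_nhds_iff.1 hW
  obtain ⟨p, hp, hle, -⟩ := exists_seminorm_sup_on hB
  obtain ⟨p', hp', hpe⟩ := exists_seminorm_const_mul hp (inv_nonneg.2 hε.le)
  refine ⟨p', hp', fun T hT => h fun v hv => hεW ?_⟩
  rw [hpe, inv_mul_lt_one₀ hε] at hT
  simpa using (hle T v hv).trans_lt hT

/-- Equiboundedness passes to transposed operators on the strong dual: the operators `(r i)⁻¹ M i`
map a bounded set into a single bounded set. -/
theorem EquiBoundedOn.precomp {S : Set ι} {M : ι → 𝓢(ℝ, ℂ) →L[ℂ] 𝓢(ℝ, ℂ)} {r : ι → ℝ}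
    (hr : ∀ i ∈ S, 0 < r i) (h : EquiBoundedOn S M r) :
    EquiBoundedOn S (fun i => (ContinuousLinearMap.precomp ℂ (M i) : TempDual →L[ℂ] TempDual)) r := by
  intro q hq
  obtain ⟨B, C, hB, hC, hqB⟩ := exists_isVonNBounded_of_seminorm hq
  let B' : Set 𝓢(ℝ, ℂ) := {w | ∃ i ∈ S, ∃ v ∈ B, w = ((r i)⁻¹ : ℂ) • M i v}
  have hB' : Bornology.IsVonNBounded ℂ B' := by
    rw [(schwartz_withSeminorms ℂ ℝ ℂ).isVonNBounded_iff_seminorm_bounded]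
    intro n
    obtain ⟨p, hp, hb⟩ := h _ ((schwartz_withSeminorms ℂ ℝ ℂ).continuous_seminorm n)
    obtain ⟨R, hR, hpR⟩ := exists_seminorm_le_of_isVonNBounded hB hp
    refine ⟨R + 1, by positivity, ?_⟩
    rintro _ ⟨i, hi, v, hv, rfl⟩
    have h1 := hb i hi v
    have h2 := hpR v hv
    have h3 := hr i hi
    rw [map_smul_eq_mul, norm_inv, Complex.norm_real, Real.norm_eq_abs, abs_of_pos h3,
      inv_mul_lt_iff₀ h3]
    nlinarith
  obtain ⟨p, hp, hle, -⟩ := exists_seminorm_sup_on hB'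
  obtain ⟨p', hp', hpe⟩ := exists_seminorm_const_mul hp hC.le
  refine ⟨p', hp', fun i hi T => ?_⟩
  have h3 := hr i hi
  have hT : ∀ v ∈ B, ‖T (M i v)‖ ≤ r i * p T := by
    intro v hv
    have h1 := hle T _ ⟨i, hi, v, hv, rfl⟩
    rwa [map_smul, norm_smul, norm_inv, Complex.norm_real, Real.norm_eq_abs, abs_of_pos h3,
      inv_mul_le_iff₀ h3] at h1
  have key : ∀ δ : ℝ, 0 < δ → q (T.comp (M i)) ≤ C * (r i * p T) + C * δ := by
    intro δ hδ
    rw [← mul_add]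
    have h0 : 0 ≤ p T := apply_nonneg _ _
    exact hqB (T.comp (M i)) _ (by positivity) fun v hv => (hT v hv).trans (by linarith)
  have : q (T.comp (M i)) ≤ C * (r i * p T) := by
    refine le_of_forall_pos_le_add fun δ hδ => ?_
    have := key (δ / C) (by positivity)
    rwa [mul_div_cancel₀ _ hC.ne'] at this
  calc q (T.comp (M i)) ≤ C * (r i * p T) := this
    _ = r i * p' T := by rw [hpe]; ring

end EquiBounded

section OperatorSymbols

variable {E F : Type*} [AddCommGroup E] [Module ℂ E] [TopologicalSpace E]
  [AddCommGroup F] [Module ℂ F] [TopologicalSpace F]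
  [IsTopologicalAddGroup F] [ContinuousSMul ℂ F]

/-- Quantitative form of the definition of an operator-valued symbol: differences and Taylor
remainders of the derivatives are equibounded families. -/
theorem isOperatorSymbol_of_equiBounded {d : ℕ} {m : ℝ} {κE : ∀ r : ℝ, 0 < r → E →L[ℂ] E}
    {κF : ∀ r : ℝ, 0 < r → F →L[ℂ] F} (hF : HasSeminormBasis F)
    (D : (Fin d → ℕ) → (Fin d → ℕ) → Bdry d → Bdry d → E →L[ℂ] F)
    (h1 : ∀ β α (z₀ : Bdry d × Bdry d), EquiBoundedOn {z | z ≠ z₀ ∧ ‖z - z₀‖ ≤ 1}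
      (fun z => D β α z.1 z.2 - D β α z₀.1 z₀.2) (fun z => ‖z - z₀‖))
    (h2 : ∀ β α i x ξ, EquiBoundedOn {h : ℝ | h ≠ 0 ∧ |h| ≤ 1}
      (fun h => (h : ℂ)⁻¹ • (D β α (x + h • EuclideanSpace.single i (1 : ℝ)) ξ - D β α x ξ)
        - D (β + Pi.single i 1) α x ξ) (fun h => |h|))
    (h3 : ∀ β α i x ξ, EquiBoundedOn {h : ℝ | h ≠ 0 ∧ |h| ≤ 1}
      (fun h => (h : ℂ)⁻¹ • (D β α x (ξ + h • EuclideanSpace.single i (1 : ℝ)) - D β α x ξ)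
        - D β (α + Pi.single i 1) x ξ) (fun h => |h|))
    (h4 : ∀ β α (K : Set (Bdry d)), IsCompact K → EquiBoundedOn {z : Bdry d × Bdry d | z.1 ∈ K}
      (fun z => (κF (jb z.2)⁻¹ (inv_pos.2 (jb_pos z.2))).comp
        ((D β α z.1 z.2).comp (κE (jb z.2) (jb_pos z.2))))
      (fun z => jb z.2 ^ (m - ((∑ i, α i : ℕ) : ℝ)))) :
    IsOperatorSymbol m κE κF (D 0 0) := by
  have hpunct : {h : ℝ | h ≠ 0 ∧ |h| ≤ 1} ∈ 𝓝[≠] (0 : ℝ) := by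
    have : Metric.closedBall (0 : ℝ) 1 ∈ 𝓝 (0 : ℝ) := Metric.closedBall_mem_nhds 0 one_pos
    filter_upwards [self_mem_nhdsWithin, mem_nhdsWithin_of_mem_nhds this] with h h1 h2
    exact ⟨h1, by simpa using h2⟩
  have habs : Tendsto (fun h : ℝ => |h|) (𝓝[≠] 0) (𝓝 0) := by
    have := (continuous_abs : Continuous fun h : ℝ => |h|).tendsto 0
    rw [abs_zero] at this
    exact this.mono_left nhdsWithin_le_nhds
  refine ⟨D, rfl, fun β α => ?_, fun β α i x ξ => ?_, fun β α i x ξ => ?_, fun β α K hK q hq => ?_⟩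
  · refine continuous_iff_continuousAt.2 fun z₀ => ?_
    refine continuousAt_iff_punctured_nhds.2 ?_
    rw [← tendsto_sub_nhds_zero_iff]
    refine (h1 β α z₀).tendsto_zero hF ?_ ?_
    · have : Metric.closedBall z₀ 1 ∈ 𝓝 z₀ := Metric.closedBall_mem_nhds _ one_pos
      filter_upwards [self_mem_nhdsWithin, mem_nhdsWithin_of_mem_nhds this] with z h1 h2
      exact ⟨h1, by simpa [dist_eq_norm] using h2⟩
    · have : Continuous fun z : Bdry d × Bdry d => ‖z - z₀‖ := by fun_prop
      have := this.tendsto z₀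
      rw [sub_self, norm_zero] at this
      exact this.mono_left nhdsWithin_le_nhds
  · rw [← tendsto_sub_nhds_zero_iff]
    exact (h2 β α i x ξ).tendsto_zero hF hpunct habs
  · rw [← tendsto_sub_nhds_zero_iff]
    exact (h3 β α i x ξ).tendsto_zero hF hpunct habs
  · obtain ⟨p, hp, hb⟩ := h4 β α K hK q hq
    exact ⟨p, hp, fun x hx ξ u => hb (x, ξ) hx u⟩

end OperatorSymbols

/-! ### Integral operators with slowly growing kernels -/

section Kernels

theorem exists_seminorm_weight (J : ℕ) : ∃ p : Seminorm ℂ 𝓢(ℝ, ℂ), Continuous p ∧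
    ∀ (w : 𝓢(ℝ, ℂ)) (s : ℝ), (1 + |s|) ^ J * ‖w s‖ ≤ p w := by
  obtain ⟨p, hp, hpe⟩ := exists_seminorm_const_mul
    (continuous_finset_sup_schwartzSeminorm (Finset.Iic (J, 0))) (C := 2 ^ J) (by positivity)
  refine ⟨p, hp, fun w s => ?_⟩
  rw [hpe]
  have := SchwartzMap.one_add_le_sup_seminorm_apply (𝕜 := ℂ) (m := (J, 0)) (k := J) (n := 0)
    le_rfl le_rfl w s
  rw [norm_iteratedFDeriv_zero, Real.norm_eq_abs] at this
  exact this

theorem integrable_one_add_abs_inv_sq : Integrable fun s : ℝ => ((1 + |s|) ^ 2)⁻¹ := by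
  have := integrable_one_add_norm (E := ℝ) (μ := volume) (r := 2) (by simp)
  refine this.congr (Eventually.of_forall fun s => ?_)
  simp only [Real.norm_eq_abs]
  rw [Real.rpow_neg (by positivity)]
  norm_cast

theorem exists_seminorm_integral_weight (J : ℕ) : ∃ p : Seminorm ℂ 𝓢(ℝ, ℂ), Continuous p ∧
    ∀ w : 𝓢(ℝ, ℂ), Integrable (fun s : ℝ => (1 + |s|) ^ J * ‖w s‖) ∧
      ∫ s : ℝ, (1 + |s|) ^ J * ‖w s‖ ≤ p w := by
  obtain ⟨p, hp, hpw⟩ := exists_seminorm_weight (J + 2)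
  have hI := integrable_one_add_abs_inv_sq
  obtain ⟨p', hp', hpe⟩ := exists_seminorm_const_mul hp
    (C := ∫ s : ℝ, ((1 + |s|) ^ 2)⁻¹) (integral_nonneg fun s => by positivity)
  refine ⟨p', hp', fun w => ?_⟩
  have hle : ∀ s : ℝ, (1 + |s|) ^ J * ‖w s‖ ≤ ((1 + |s|) ^ 2)⁻¹ * p w := by
    intro s
    rw [le_inv_mul_iff₀ (by positivity)]
    calc _ = (1 + |s|) ^ (J + 2) * ‖w s‖ := by ring
      _ ≤ _ := hpw w s
  have hint : Integrable (fun s : ℝ => (1 + |s|) ^ J * ‖w s‖) := by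
    refine (hI.mul_const (p w)).mono' ?_ (Eventually.of_forall fun s => ?_)
    · exact ((by fun_prop : Continuous fun s : ℝ => (1 + |s|) ^ J).mul
        w.continuous.norm).aestronglyMeasurable
    · rw [Real.norm_of_nonneg (by positivity)]
      exact hle s
  refine ⟨hint, ?_⟩
  rw [hpe, ← integral_mul_const]
  exact integral_mono hint (hI.mul_const _) hle

variable {Z : Type*}

/-- Classes of families of kernels `g z t s` for which `w ↦ ∫ g z t s w(s) ds` acts on Schwartz
functions, uniformly in `z`: the kernels are of slow growth, with a power of `t` that is recorded by
the index; the class is stable under `∂_t`; and multiplication by `t`, which corresponds to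
integration by parts in `s`, does not increase the growth in `t`. -/
structure KernelClass (P : ℕ → (Z → ℝ → ℝ → ℂ) → Prop) : Prop where
  cont : ∀ {k g}, P k g → ∀ z t, Continuous (g z t)
  bound : ∀ {k g}, P k g → ∃ (C : ℝ) (J : ℕ), 0 ≤ C ∧
    ∀ z t s, ‖g z t s‖ ≤ C * (1 + |t|) ^ k * (1 + |s|) ^ J
  deriv : ∀ {k g}, P k g → ∃ g', P (k + 1) g' ∧
    ∀ z t s, HasDerivAt (fun t => g z t s) (g' z t s) t
  decay : ∀ {k g}, P k g → ∃ g₁ g₁' g₂, P k g₁ ∧ P (k + 1) g₁' ∧ P k g₂ ∧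
    (∀ z t s, HasDerivAt (g₁ z t) (g₁' z t s) s) ∧
    ∀ z (t s : ℝ), (t : ℂ) * g z t s = g₁' z t s + g₂ z t s

namespace KernelClass

variable {P : ℕ → (Z → ℝ → ℝ → ℂ) → Prop} (hP : KernelClass P)
include hP

theorem integrable {k : ℕ} {g : Z → ℝ → ℝ → ℂ} (hg : P k g) (z : Z) (t : ℝ) (w : 𝓢(ℝ, ℂ)) :
    Integrable fun s => g z t s * w s := by
  obtain ⟨C, J, hC, hb⟩ := hP.bound hg
  obtain ⟨p, hp, hw⟩ := exists_seminorm_integral_weight J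
  refine ((hw w).1.const_mul (C * (1 + |t|) ^ k)).mono'
    ((hP.cont hg z t).mul w.continuous).aestronglyMeasurable (Eventually.of_forall fun s => ?_)
  rw [norm_mul, ← mul_assoc]
  gcongr
  exact hb z t s

theorem norm_integral_le {k : ℕ} {g : Z → ℝ → ℝ → ℂ} (hg : P k g) :
    ∃ p : Seminorm ℂ 𝓢(ℝ, ℂ), Continuous p ∧
      ∀ z (w : 𝓢(ℝ, ℂ)) t, ‖∫ s, g z t s * w s‖ ≤ (1 + |t|) ^ k * p w := by
  obtain ⟨C, J, hC, hb⟩ := hP.bound hg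
  obtain ⟨p, hp, hw⟩ := exists_seminorm_integral_weight J
  obtain ⟨p', hp', hpe⟩ := exists_seminorm_const_mul hp hC
  refine ⟨p', hp', fun z w t => ?_⟩
  calc ‖∫ s, g z t s * w s‖ ≤ ∫ s : ℝ, C * (1 + |t|) ^ k * ((1 + |s|) ^ J * ‖w s‖) := by
        refine norm_integral_le_of_norm_le ((hw w).1.const_mul _) (Eventually.of_forall fun s => ?_)
        rw [norm_mul, ← mul_assoc]
        gcongr
        exact hb z t s
    _ = C * (1 + |t|) ^ k * ∫ s : ℝ, (1 + |s|) ^ J * ‖w s‖ := integral_const_mul _ _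
    _ ≤ C * (1 + |t|) ^ k * p w := by gcongr; exact (hw w).2
    _ = (1 + |t|) ^ k * p' w := by rw [hpe]; ring

theorem pow_mul_norm_integral_le (N : ℕ) {k : ℕ} {g : Z → ℝ → ℝ → ℂ} (hg : P k g) :
    ∃ p : Seminorm ℂ 𝓢(ℝ, ℂ), Continuous p ∧
      ∀ z (w : 𝓢(ℝ, ℂ)) t, |t| ^ N * ‖∫ s, g z t s * w s‖ ≤ (1 + |t|) ^ k * p w := by
  induction N generalizing g with
  | zero => simpa using hP.norm_integral_le hg
  | succ N ih =>
    obtain ⟨g₁, g₁', g₂, h1, h1', h2, hd, he⟩ := hP.decay hg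
    obtain ⟨p1, hp1, hb1⟩ := ih h1
    obtain ⟨p2, hp2, hb2⟩ := ih h2
    let D := SchwartzMap.derivCLM ℂ ℂ
    refine ⟨p1.comp D.toLinearMap + p2, (hp1.comp D.continuous).add hp2, fun z w t => ?_⟩
    have hpart : ∫ s, g₁' z t s * w s = -∫ s, g₁ z t s * D w s := by
      have := integral_mul_deriv_eq_deriv_mul_of_integrable (u := g₁ z t) (v := w)
        (u' := g₁' z t) (v' := D w) (fun s _ => hd z t s)
        (fun s _ => by simpa [D] using w.differentiableAt.hasDerivAt)
        (hP.integrable h1 z t (D w)) (hP.integrable h1' z t w) (hP.integrable h1 z t w)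
      rw [this, neg_neg]
    have hsplit : (t : ℂ) * ∫ s, g z t s * w s
        = -(∫ s, g₁ z t s * D w s) + ∫ s, g₂ z t s * w s := by
      rw [← hpart, ← integral_add (hP.integrable h1' z t w) (hP.integrable h2 z t w),
        ← integral_const_mul]
      refine integral_congr_ae (Eventually.of_forall fun s => ?_)
      simp only
      rw [← mul_assoc, he]
      ring
    calc |t| ^ (N + 1) * ‖∫ s, g z t s * w s‖ = |t| ^ N * ‖(t : ℂ) * ∫ s, g z t s * w s‖ := by
          rw [norm_mul, Complex.norm_real, Real.norm_eq_abs]; ring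
      _ ≤ |t| ^ N * (‖∫ s, g₁ z t s * D w s‖ + ‖∫ s, g₂ z t s * w s‖) := by
          rw [hsplit]
          gcongr
          exact (norm_add_le _ _).trans (by rw [norm_neg])
      _ ≤ (1 + |t|) ^ k * p1 (D w) + (1 + |t|) ^ k * p2 w := by
          rw [mul_add]; exact add_le_add (hb1 z (D w) t) (hb2 z w t)
      _ = (1 + |t|) ^ k * (p1.comp D.toLinearMap + p2) w := by
          rw [← mul_add]; rfl

theorem pow_mul_norm_integral_le' (N : ℕ) {k : ℕ} {g : Z → ℝ → ℝ → ℂ} (hg : P k g) :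
    ∃ p : Seminorm ℂ 𝓢(ℝ, ℂ), Continuous p ∧
      ∀ z (w : 𝓢(ℝ, ℂ)) t, |t| ^ N * ‖∫ s, g z t s * w s‖ ≤ p w := by
  obtain ⟨p0, hp0, h0⟩ := hP.norm_integral_le hg
  obtain ⟨p1, hp1, h1⟩ := hP.pow_mul_norm_integral_le (N + k) hg
  obtain ⟨p, hp, hpe⟩ := exists_seminorm_const_mul (p := p0 + p1) (hp0.add hp1) (C := 2 ^ k)
    (by positivity)
  refine ⟨p, hp, fun z w t => ?_⟩
  have hp0w : 0 ≤ p0 w := apply_nonneg _ _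
  have hp1w : 0 ≤ p1 w := apply_nonneg _ _
  rw [hpe, add_apply]
  rcases le_total |t| 1 with ht | ht
  · calc |t| ^ N * ‖∫ s, g z t s * w s‖ ≤ 1 * ((1 + |t|) ^ k * p0 w) := by
          gcongr
          · exact pow_le_one₀ (abs_nonneg _) ht
          · exact h0 z w t
      _ ≤ 1 * (2 ^ k * p0 w) := by gcongr; linarith
      _ ≤ 2 ^ k * (p0 w + p1 w) := by rw [one_mul]; gcongr; linarith
  · have ht0 : 0 < |t| ^ k := by positivity
    refine le_of_mul_le_mul_left ?_ ht0
    calc |t| ^ k * (|t| ^ N * ‖∫ s, g z t s * w s‖) = |t| ^ (N + k) * ‖∫ s, g z t s * w s‖ := by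
          ring
      _ ≤ (1 + |t|) ^ k * p1 w := h1 z w t
      _ ≤ (2 * |t|) ^ k * p1 w := by gcongr; linarith
      _ = |t| ^ k * (2 ^ k * p1 w) := by ring
      _ ≤ |t| ^ k * (2 ^ k * (p0 w + p1 w)) := by gcongr; linarith

theorem hasDerivAt_integral {k : ℕ} {g g' : Z → ℝ → ℝ → ℂ} (hg : P k g) (hg' : P (k + 1) g')
    (hd : ∀ z t s, HasDerivAt (fun t => g z t s) (g' z t s) t) (z : Z) (w : 𝓢(ℝ, ℂ)) (t : ℝ) :
    HasDerivAt (fun t => ∫ s, g z t s * w s) (∫ s, g' z t s * w s) t := by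
  obtain ⟨C, J, hC, hb⟩ := hP.bound hg'
  obtain ⟨p, hp, hw⟩ := exists_seminorm_integral_weight J
  refine (hasDerivAt_integral_of_dominated_loc_of_deriv_le (μ := volume)
    (F := fun t s => g z t s * w s)
    (F' := fun t s => g' z t s * w s)
    (bound := fun s => C * (1 + (|t| + 1)) ^ (k + 1) * ((1 + |s|) ^ J * ‖w s‖))
    (Metric.ball_mem_nhds t one_pos)
    (Eventually.of_forall fun t => (hP.integrable hg z t w).aestronglyMeasurable)
    (hP.integrable hg z t w) (hP.integrable hg' z t w).aestronglyMeasurable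
    (Eventually.of_forall fun s t' ht' => ?_) ((hw w).1.const_mul _)
    (Eventually.of_forall fun s t' _ => (hd z t' s).mul_const (w s))).2
  have h1 : |t'| ≤ |t| + 1 := by
    have h2 : |t' - t| < 1 := by simpa [Real.dist_eq] using ht'
    have := abs_sub_abs_le_abs_sub t' t
    linarith
  rw [norm_mul, ← mul_assoc]
  gcongr
  exact (hb z t' s).trans (by gcongr)

theorem iteratedDeriv_integral (l : ℕ) {k : ℕ} {g : Z → ℝ → ℝ → ℂ} (hg : P k g) :
    ∃ g', P (k + l) g' ∧ ∀ z (w : 𝓢(ℝ, ℂ)),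
      iteratedDeriv l (fun t => ∫ s, g z t s * w s) = fun t => ∫ s, g' z t s * w s := by
  induction l generalizing k g with
  | zero => exact ⟨g, hg, fun z w => by simp⟩
  | succ l ih =>
    obtain ⟨g', hg', hd⟩ := hP.deriv hg
    obtain ⟨g'', hg'', he⟩ := ih hg'
    refine ⟨g'', by rwa [add_right_comm] at hg'', fun z w => ?_⟩
    rw [iteratedDeriv_succ', ← he]
    congr 1
    exact funext fun t => (hP.hasDerivAt_integral hg hg' hd z w t).deriv

theorem contDiff_integral {k : ℕ} {g : Z → ℝ → ℝ → ℂ} (hg : P k g) (z : Z) (w : 𝓢(ℝ, ℂ)) :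
    ContDiff ℝ ∞ fun t => ∫ s, g z t s * w s := by
  refine contDiff_infty.2 fun n => ?_
  induction n generalizing k g with
  | zero =>
    obtain ⟨g', hg', hd⟩ := hP.deriv hg
    exact contDiff_zero.2 (continuous_iff_continuousAt.2 fun t =>
      (hP.hasDerivAt_integral hg hg' hd z w t).continuousAt)
  | succ n ih =>
    obtain ⟨g', hg', hd⟩ := hP.deriv hg
    have hd' := hP.hasDerivAt_integral hg hg' hd z w
    rw [show ((n + 1 : ℕ) : WithTop ℕ∞) = (n : WithTop ℕ∞) + 1 by norm_cast,
      contDiff_succ_iff_deriv]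
    refine ⟨fun t => (hd' t).differentiableAt, by simp, ?_⟩
    rw [show _root_.deriv (fun t => ∫ s, g z t s * w s) = fun t => ∫ s, g' z t s * w s from
      funext fun t => (hd' t).deriv]
    exact ih hg'

theorem exists_seminorm_bound {k : ℕ} {g : Z → ℝ → ℝ → ℂ} (hg : P k g) (n : ℕ × ℕ) :
    ∃ p : Seminorm ℂ 𝓢(ℝ, ℂ), Continuous p ∧ ∀ z (w : 𝓢(ℝ, ℂ)) t,
      ‖t‖ ^ n.1 * ‖iteratedFDeriv ℝ n.2 (fun t => ∫ s, g z t s * w s) t‖ ≤ p w := by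
  obtain ⟨g', hg', he⟩ := hP.iteratedDeriv_integral n.2 hg
  obtain ⟨p, hp, hb⟩ := hP.pow_mul_norm_integral_le' n.1 hg'
  refine ⟨p, hp, fun z w t => ?_⟩
  rw [norm_iteratedFDeriv_eq_norm_iteratedDeriv, he]
  exact hb z w t

/-- The integral operators of a kernel class are continuous on `𝓢(ℝ)`, uniformly in the
parameter. -/
theorem exists_operator {k : ℕ} {g : Z → ℝ → ℝ → ℂ} (hg : P k g) :
    ∃ T : Z → 𝓢(ℝ, ℂ) →L[ℂ] 𝓢(ℝ, ℂ), (∀ z w t, T z w t = ∫ s, g z t s * w s) ∧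
      EquiBoundedOn univ T (fun _ => 1) := by
  have hex : ∀ z, ∃ T : 𝓢(ℝ, ℂ) →L[ℂ] 𝓢(ℝ, ℂ), ∀ w t, T w t = ∫ s, g z t s * w s := by
    intro z
    refine ⟨SchwartzMap.mkCLM (fun w t => ∫ s, g z t s * w s) ?_ ?_ ?_ ?_, fun w t => rfl⟩
    · intro v w t
      rw [← integral_add (hP.integrable hg z t v) (hP.integrable hg z t w)]
      simp [mul_add]
    · intro c w t
      rw [RingHom.id_apply, smul_eq_mul, ← integral_const_mul]
      simp [mul_left_comm]
    · exact hP.contDiff_integral hg z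
    · intro n
      obtain ⟨p, hp, hb⟩ := hP.exists_seminorm_bound hg n
      obtain ⟨s, C, -, hle⟩ := Seminorm.bound_of_continuous (schwartz_withSeminorms ℂ ℝ ℂ) p hp
      exact ⟨s, C, C.2, fun w t => (hb z w t).trans (hle w)⟩
  choose T hT using hex
  refine ⟨T, hT, fun q hq => ?_⟩
  obtain ⟨s, C, -, hle⟩ := Seminorm.bound_of_continuous (schwartz_withSeminorms ℂ ℝ ℂ) q hq
  choose p hp hb using fun n => hP.exists_seminorm_bound hg n
  obtain ⟨p', hp', hpe⟩ := exists_seminorm_const_mul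
    (Seminorm.continuous_finsetSup (s := s) (p := p) fun n _ => hp n) C.2
  refine ⟨p', hp', fun z _ w => ?_⟩
  rw [one_mul, hpe]
  refine (hle (T z w)).trans ?_
  refine mul_le_mul_of_nonneg_left ?_ C.2
  refine Seminorm.finset_sup_apply_le (apply_nonneg _ _) fun n hn => ?_
  refine le_trans ?_ (Seminorm.le_finset_sup_apply hn)
  refine SchwartzMap.seminorm_le_bound ℂ n.1 n.2 _ (apply_nonneg _ _) fun t => ?_
  have : (T z w : ℝ → ℂ) = fun t => ∫ s, g z t s * w s := funext fun t => hT z w t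
  rw [this]
  exact hb n z w t

end KernelClass

end Kernels

/-! ### Coordinate derivatives -/

section CoordinateDerivatives

variable {d : ℕ}

/-- The coordinate directions of `ℝ^n × ℝ^n`: the tangential variables `x_i` and covariables `ξ_i`,
the normal variable `t = x_n` and the normal covariable `s = ξ_n`. -/
inductive Dir (d : ℕ) : Type
  | tan (i : Fin d) : Dir d
  | cotan (i : Fin d) : Dir d
  | nor : Dir d
  | conor : Dir d

/-- The unit vector of a coordinate direction. -/
def Dir.vec : Dir d → Amb d × Amb d
  | tan i => ((EuclideanSpace.single i 1, 0), 0)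
  | cotan i => (0, (EuclideanSpace.single i 1, 0))
  | nor => ((0, 1), 0)
  | conor => (0, (0, 1))

/-- The change of the order in `⟨ξ'⟩` that a derivative in the given direction causes. The normal
variable scales like `⟨ξ'⟩⁻¹`, so that a normal derivative costs one order. -/
def Dir.wt : Dir d → ℝ
  | tan _ => 0
  | cotan _ => -1
  | nor => 1
  | conor => -1

/-- The partial derivative in a coordinate direction. -/
def pd (e : Dir d) (f : Amb d × Amb d → ℂ) (z : Amb d × Amb d) : ℂ := fderiv ℝ f z e.vec

variable {e e' : Dir d} {f g : Amb d × Amb d → ℂ} {O : Set (Amb d × Amb d)} {z : Amb d × Amb d}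

theorem contDiffOn_pd (hO : IsOpen O) (hf : ContDiffOn ℝ ∞ f O) (e : Dir d) :
    ContDiffOn ℝ ∞ (pd e f) O :=
  (hf.fderiv_of_isOpen hO le_rfl).clm_apply contDiffOn_const

theorem contDiff_pd (hf : ContDiff ℝ ∞ f) (e : Dir d) : ContDiff ℝ ∞ (pd e f) :=
  (hf.fderiv_right le_rfl).clm_apply contDiff_const

theorem differentiableAt_of_contDiffOn {E F : Type*} [NormedAddCommGroup E] [NormedSpace ℝ E]
    [NormedAddCommGroup F] [NormedSpace ℝ F] {f : E → F} {O : Set E} {z : E} (hO : IsOpen O)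
    (hf : ContDiffOn ℝ ∞ f O) (hz : z ∈ O) : DifferentiableAt ℝ f z :=
  (hf.contDiffAt (hO.mem_nhds hz)).differentiableAt (by simp)

theorem pd_congr (h : f =ᶠ[𝓝 z] g) : pd e f z = pd e g z := by
  rw [pd, pd, h.fderiv_eq]

theorem pd_add (hf : DifferentiableAt ℝ f z) (hg : DifferentiableAt ℝ g z) :
    pd e (fun z => f z + g z) z = pd e f z + pd e g z := by
  simp [pd, fderiv_fun_add hf hg]

theorem pd_mul (hf : DifferentiableAt ℝ f z) (hg : DifferentiableAt ℝ g z) :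
    pd e (fun z => f z * g z) z = f z * pd e g z + pd e f z * g z := by
  simp [pd, fderiv_fun_mul hf hg, mul_comm]

theorem pd_const (c : ℂ) : pd e (fun _ => c) z = 0 := by simp [pd]

theorem pd_inv (hf : DifferentiableAt ℝ f z) (h0 : f z ≠ 0) :
    pd e (fun z => (f z)⁻¹) z = -((f z)⁻¹ * (f z)⁻¹ * pd e f z) := by
  have h1 : HasDerivAt (fun w : ℂ => w⁻¹) (-(f z ^ 2)⁻¹) (f z) := hasDerivAt_inv h0
  have h2 := (h1.hasFDerivAt.restrictScalars ℝ).comp z hf.hasFDerivAt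
  have h3 : fderiv ℝ (fun z => (f z)⁻¹) z = _ := h2.fderiv
  rw [pd, h3]
  simp [pd]
  ring

theorem pd_comm (hf : ContDiffAt ℝ ∞ f z) : pd e (pd e' f) z = pd e' (pd e f) z := by
  have hs : IsSymmSndFDerivAt ℝ f z := hf.isSymmSndFDerivAt (by simp; norm_cast)
  have hd : DifferentiableAt ℝ (fderiv ℝ f) z :=
    (hf.fderiv_right (m := 1) (by norm_cast)).differentiableAt (by simp)
  have h : ∀ a b : Dir d, pd a (pd b f) z = fderiv ℝ (fderiv ℝ f) z a.vec b.vec := by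
    intro a b
    have : pd b f = fun z => fderiv ℝ f z b.vec := rfl
    rw [pd, this, fderiv_clm_apply hd (by fun_prop)]
    simp
  rw [h, h, hs.eq]

theorem hasDerivAt_comp_pd {c : ℝ → Amb d × Amb d} {θ : ℝ} (hf : DifferentiableAt ℝ f (c θ))
    (hc : HasDerivAt c e.vec θ) : HasDerivAt (fun θ => f (c θ)) (pd e f (c θ)) θ :=
  hf.hasFDerivAt.comp_hasDerivAt θ hc

end CoordinateDerivatives

/-! ### Amplitudes -/

section Amplitudes

variable {d : ℕ}

theorem one_le_jb (ξ : Bdry d) : 1 ≤ jb ξ :=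
  Real.one_le_sqrt.2 (by nlinarith [sq_nonneg ‖ξ‖])

theorem norm_le_jb (ξ : Bdry d) : ‖ξ‖ ≤ jb ξ := Real.le_sqrt_of_sq_le (by linarith)

theorem jb_le_one_add (ξ : Bdry d) : jb ξ ≤ 1 + ‖ξ‖ :=
  Real.sqrt_le_iff.2 ⟨by positivity, by nlinarith [norm_nonneg ξ]⟩

theorem contDiff_jb : ContDiff ℝ ∞ (jb : Bdry d → ℝ) := by
  refine ContDiff.sqrt ?_ fun ξ => by positivity
  exact contDiff_const.add (contDiff_norm_sq ℝ)

/-- The weight `⟨ξ'⟩^μ (1 + ⟨ξ'⟩|x_n|)^k (1 + |ξ_n|/⟨ξ'⟩)^j`. -/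
def weight (μ k j : ℝ) (z : Amb d × Amb d) : ℝ :=
  jb z.2.1 ^ μ * (1 + jb z.2.1 * |z.1.2|) ^ k * (1 + |z.2.2| / jb z.2.1) ^ j

theorem one_le_tau (z : Amb d × Amb d) : 1 ≤ 1 + jb z.2.1 * |z.1.2| := by
  have := jb_pos z.2.1
  have : 0 ≤ jb z.2.1 * |z.1.2| := by positivity
  linarith

theorem one_le_sigma (z : Amb d × Amb d) : 1 ≤ 1 + |z.2.2| / jb z.2.1 := by
  have := jb_pos z.2.1
  have : 0 ≤ |z.2.2| / jb z.2.1 := by positivity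
  linarith

theorem weight_pos (μ k j : ℝ) (z : Amb d × Amb d) : 0 < weight μ k j z := by
  have h1 := jb_pos z.2.1
  have h2 := one_le_tau z
  have h3 := one_le_sigma z
  unfold weight
  positivity

theorem weight_mul (μ k j μ' k' j' : ℝ) (z : Amb d × Amb d) :
    weight μ k j z * weight μ' k' j' z = weight (μ + μ') (k + k') (j + j') z := by
  have h1 := jb_pos z.2.1
  have h2 := one_le_tau z
  have h3 := one_le_sigma z
  unfold weight
  rw [Real.rpow_add h1, Real.rpow_add (by linarith), Real.rpow_add (by linarith)]
  ring

theorem weight_mono {μ k j μ' k' j' : ℝ} (hμ : μ ≤ μ') (hk : k ≤ k') (hj : j ≤ j')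
    (z : Amb d × Amb d) : weight μ k j z ≤ weight μ' k' j' z := by
  have h1 := one_le_jb z.2.1
  have h2 := one_le_tau z
  have h3 := one_le_sigma z
  unfold weight
  gcongr

theorem weight_zero (z : Amb d × Amb d) : weight 0 0 0 z = 1 := by simp [weight]

/-- The bound of `IsAmp` for the function itself. -/
def AmpBound (S : Set (Amb d × Amb d)) (μ k j : ℝ) (f : Amb d × Amb d → ℂ) : Prop :=
  ∀ K : Set (Bdry d), IsCompact K → ∃ C : ℝ, ∀ z ∈ S, z.1.1 ∈ K → ‖f z‖ ≤ C * weight μ k j z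

/-- The bounds of `IsAmp` for derivatives up to order `n`. -/
abbrev AmpN (S : Set (Amb d × Amb d)) : ℕ → ℝ → ℝ → ℝ → (Amb d × Amb d → ℂ) → Prop
  | 0, μ, k, j, f => AmpBound S μ k j f
  | n + 1, μ, k, j, f => AmpBound S μ k j f ∧ ∀ e : Dir d, AmpN S n (μ + e.wt) k j (pd e f)

/-- Amplitudes of order `μ` on `S ⊆ O`: functions which are smooth on the open set `O` and satisfy
`|∂^γ f| ≤ C ⟨ξ'⟩^{μ + wt γ} (1 + ⟨ξ'⟩|x_n|)^k (1 + |ξ_n|/⟨ξ'⟩)^j` on `S`, locally uniformly in `x'`.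
The growth exponents `k` and `j` may be negative and are the same for all derivatives. -/
def IsAmp (S O : Set (Amb d × Amb d)) (μ k j : ℝ) (f : Amb d × Amb d → ℂ) : Prop :=
  ContDiffOn ℝ ∞ f O ∧ ∀ n, AmpN S n μ k j f

variable {S O : Set (Amb d × Amb d)} {μ k j μ' k' j' : ℝ} {f g : Amb d × Amb d → ℂ} {n : ℕ}

theorem AmpN.of_succ (h : AmpN S (n + 1) μ k j f) : AmpN S n μ k j f := by
  induction n generalizing μ f with
  | zero => exact h.1
  | succ n ih => exact ⟨h.1, fun e => ih (h.2 e)⟩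

theorem AmpBound.mono (h : AmpBound S μ k j f) (hμ : μ ≤ μ') (hk : k ≤ k') (hj : j ≤ j') :
    AmpBound S μ' k' j' f := by
  intro K hK
  obtain ⟨C, hC⟩ := h K hK
  refine ⟨|C|, fun z hz hzK => (hC z hz hzK).trans ?_⟩
  have := weight_pos μ k j z
  exact mul_le_mul (le_abs_self C) (weight_mono hμ hk hj z) this.le (abs_nonneg _)

theorem AmpN.mono (h : AmpN S n μ k j f) (hμ : μ ≤ μ') (hk : k ≤ k') (hj : j ≤ j') :
    AmpN S n μ' k' j' f := by
  induction n generalizing μ μ' f with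
  | zero => exact h.mono hμ hk hj
  | succ n ih => exact ⟨h.1.mono hμ hk hj, fun e => ih (h.2 e) (by linarith)⟩

theorem AmpN.congr (hO : IsOpen O) (hSO : S ⊆ O) (h : AmpN S n μ k j f) (hfg : EqOn f g O) :
    AmpN S n μ k j g := by
  induction n generalizing μ f g with
  | zero =>
    intro K hK
    obtain ⟨C, hC⟩ := h K hK
    exact ⟨C, fun z hz hzK => by rw [← hfg (hSO hz)]; exact hC z hz hzK⟩
  | succ n ih =>
    refine ⟨?_, fun e => ih (h.2 e) fun z hz => pd_congr (hfg.eventuallyEq_of_mem (hO.mem_nhds hz))⟩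
    intro K hK
    obtain ⟨C, hC⟩ := h.1 K hK
    exact ⟨C, fun z hz hzK => by rw [← hfg (hSO hz)]; exact hC z hz hzK⟩

theorem AmpBound.add (hf : AmpBound S μ k j f) (hg : AmpBound S μ k j g) :
    AmpBound S μ k j (fun z => f z + g z) := by
  intro K hK
  obtain ⟨C, hC⟩ := hf K hK
  obtain ⟨C', hC'⟩ := hg K hK
  exact ⟨C + C', fun z hz hzK => (norm_add_le _ _).trans
    ((add_le_add (hC z hz hzK) (hC' z hz hzK)).trans_eq (by ring))⟩

theorem AmpBound.mul (hf : AmpBound S μ k j f) (hg : AmpBound S μ' k' j' g) :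
    AmpBound S (μ + μ') (k + k') (j + j') (fun z => f z * g z) := by
  intro K hK
  obtain ⟨C, hC⟩ := hf K hK
  obtain ⟨C', hC'⟩ := hg K hK
  refine ⟨C * C', fun z hz hzK => ?_⟩
  rw [norm_mul, ← weight_mul]
  calc ‖f z‖ * ‖g z‖ ≤ (C * weight μ k j z) * (C' * weight μ' k' j' z) :=
        mul_le_mul (hC z hz hzK) (hC' z hz hzK) (norm_nonneg _)
          ((norm_nonneg _).trans (hC z hz hzK))
    _ = _ := by ring

theorem AmpN.add (hO : IsOpen O) (hSO : S ⊆ O) (hfs : ContDiffOn ℝ ∞ f O)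
    (hgs : ContDiffOn ℝ ∞ g O) (hf : AmpN S n μ k j f) (hg : AmpN S n μ k j g) :
    AmpN S n μ k j (fun z => f z + g z) := by
  induction n generalizing μ f g with
  | zero => exact hf.add hg
  | succ n ih =>
    refine ⟨hf.1.add hg.1, fun e => ?_⟩
    refine (ih (contDiffOn_pd hO hfs e) (contDiffOn_pd hO hgs e) (hf.2 e) (hg.2 e)).congr hO hSO ?_
    intro z hz
    exact (pd_add (differentiableAt_of_contDiffOn hO hfs hz)
      (differentiableAt_of_contDiffOn hO hgs hz)).symm

theorem AmpN.mul (hO : IsOpen O) (hSO : S ⊆ O) (hfs : ContDiffOn ℝ ∞ f O)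
    (hgs : ContDiffOn ℝ ∞ g O) (hf : AmpN S n μ k j f) (hg : AmpN S n μ' k' j' g) :
    AmpN S n (μ + μ') (k + k') (j + j') (fun z => f z * g z) := by
  induction n generalizing μ μ' f g with
  | zero => exact hf.mul hg
  | succ n ih =>
    refine ⟨hf.1.mul hg.1, fun e => ?_⟩
    have h1 := ih hfs (contDiffOn_pd hO hgs e) hf.of_succ (hg.2 e)
    have h2 := ih (contDiffOn_pd hO hfs e) hgs (hf.2 e) hg.of_succ
    rw [← add_assoc] at h1
    rw [add_right_comm] at h2
    refine (h1.add hO hSO (hfs.mul (contDiffOn_pd hO hgs e)) ((contDiffOn_pd hO hfs e).mul hgs)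
      h2).congr hO hSO ?_
    intro z hz
    exact (pd_mul (differentiableAt_of_contDiffOn hO hfs hz)
      (differentiableAt_of_contDiffOn hO hgs hz)).symm

theorem AmpN.const (c : ℂ) : AmpN S n 0 0 0 (fun _ => c) := by
  have h0 : ∀ (n : ℕ) (μ : ℝ), AmpN S n μ 0 0 (fun _ => 0) := by
    intro n
    induction n with
    | zero => exact fun μ K _ => ⟨0, fun z _ _ => by simp⟩
    | succ n ih =>
      refine fun μ => ⟨fun K _ => ⟨0, fun z _ _ => by simp⟩, fun e => ?_⟩
      have : pd e (fun _ => (0 : ℂ)) = fun _ => 0 := funext fun z => pd_const 0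
      rw [this]
      exact ih _
  have hb : AmpBound S 0 0 0 (fun _ => c) := fun K _ => ⟨‖c‖, fun z _ _ => by simp [weight_zero]⟩
  cases n with
  | zero => exact hb
  | succ n =>
    refine ⟨hb, fun e => ?_⟩
    have : pd e (fun _ => c) = fun _ => 0 := funext fun z => pd_const c
    rw [this]
    exact h0 _ _

theorem IsAmp.mono (h : IsAmp S O μ k j f) (hμ : μ ≤ μ') (hk : k ≤ k') (hj : j ≤ j') :
    IsAmp S O μ' k' j' f := ⟨h.1, fun n => (h.2 n).mono hμ hk hj⟩

theorem IsAmp.of_eq (h : IsAmp S O μ k j f) (hμ : μ' = μ) (hk : k' = k) (hj : j' = j) :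
    IsAmp S O μ' k' j' f := by subst hμ hk hj; exact h

theorem IsAmp.add (hO : IsOpen O) (hSO : S ⊆ O) (hf : IsAmp S O μ k j f)
    (hg : IsAmp S O μ k j g) : IsAmp S O μ k j (fun z => f z + g z) :=
  ⟨hf.1.add hg.1, fun n => (hf.2 n).add hO hSO hf.1 hg.1 (hg.2 n)⟩

theorem IsAmp.mul (hO : IsOpen O) (hSO : S ⊆ O) (hf : IsAmp S O μ k j f)
    (hg : IsAmp S O μ' k' j' g) : IsAmp S O (μ + μ') (k + k') (j + j') (fun z => f z * g z) :=
  ⟨hf.1.mul hg.1, fun n => (hf.2 n).mul hO hSO hf.1 hg.1 (hg.2 n)⟩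

theorem IsAmp.const (c : ℂ) : IsAmp S O 0 0 0 (fun _ => c) :=
  ⟨contDiffOn_const, fun _ => AmpN.const c⟩

theorem IsAmp.const_mul (hO : IsOpen O) (hSO : S ⊆ O) (c : ℂ) (hf : IsAmp S O μ k j f) :
    IsAmp S O μ k j (fun z => c * f z) :=
  ((IsAmp.const c).mul hO hSO hf).of_eq (by simp) (by simp) (by simp)

theorem IsAmp.pd (hO : IsOpen O) (hf : IsAmp S O μ k j f) (e : Dir d) :
    IsAmp S O (μ + e.wt) k j (pd e f) :=
  ⟨contDiffOn_pd hO hf.1 e, fun n => (hf.2 (n + 1)).2 e⟩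

/-- It suffices to bound a function and to recognize its first derivatives as amplitudes. -/
theorem IsAmp.of_pd (hs : ContDiffOn ℝ ∞ f O) (h0 : AmpBound S μ k j f)
    (h : ∀ e, IsAmp S O (μ + e.wt) k j (_root_.pd e f)) : IsAmp S O μ k j f :=
  ⟨hs, fun n => by
    cases n with
    | zero => exact h0
    | succ n => exact ⟨h0, fun e => (h e).2 n⟩⟩

/-- The inverse of an elliptic amplitude is an amplitude. -/
theorem IsAmp.inv (hO : IsOpen O) (hSO : S ⊆ O) (hf : IsAmp S O μ k j f) (h0 : ∀ z ∈ O, f z ≠ 0)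
    (hb : AmpBound S (-μ) (-k) (-j) (fun z => (f z)⁻¹)) :
    IsAmp S O (-μ) (-k) (-j) (fun z => (f z)⁻¹) := by
  have hs : ContDiffOn ℝ ∞ (fun z => (f z)⁻¹) O := hf.1.inv h0
  refine ⟨hs, fun n => ?_⟩
  induction n with
  | zero => exact hb
  | succ n ih =>
    refine ⟨hb, fun e => ?_⟩
    have hfe := hf.pd hO e
    have h1 := (ih.mul hO hSO hs hs ih).mul hO hSO (hs.mul hs) hfe.1 (hfe.2 n)
    have h2 := (AmpN.const (S := S) (n := n) (-1)).mul hO hSO contDiffOn_const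
      ((hs.mul hs).mul hfe.1) h1
    have e1 : 0 + (-μ + -μ + (μ + e.wt)) = -μ + e.wt := by ring
    have e2 : 0 + (-k + -k + k) = -k := by ring
    have e3 : 0 + (-j + -j + j) = -j := by ring
    rw [e1, e2, e3] at h2
    refine h2.congr hO hSO fun z hz => ?_
    rw [pd_inv (differentiableAt_of_contDiffOn hO hf.1 hz) (h0 z hz)]
    ring

theorem fderiv_ofReal_clm (l : Amb d × Amb d →L[ℝ] ℝ) (z v : Amb d × Amb d) :
    fderiv ℝ (fun z => ((l z : ℝ) : ℂ)) z v = ((l v : ℝ) : ℂ) := by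
  have : (fun z => ((l z : ℝ) : ℂ)) = fun z => (Complex.ofRealCLM.comp l) z := rfl
  rw [this, ContinuousLinearMap.fderiv]
  rfl

/-- Linear functions with the right behaviour in each coordinate direction are amplitudes. -/
theorem isAmp_clm (l : Amb d × Amb d →L[ℝ] ℝ)
    (h0 : ∀ z, |l z| ≤ weight μ k j z)
    (h : ∀ e : Dir d, l e.vec = 0 ∨ (0 ≤ μ + e.wt ∧ 0 ≤ k ∧ 0 ≤ j)) :
    IsAmp S O μ k j (fun z => ((l z : ℝ) : ℂ)) := by
  refine IsAmp.of_pd ?_ ?_ fun e => ?_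
  · exact (Complex.ofRealCLM.contDiff.comp l.contDiff).contDiffOn
  · exact fun K _ => ⟨1, fun z _ _ => by simpa using h0 z⟩
  · have : pd e (fun z => ((l z : ℝ) : ℂ)) = fun _ => ((l e.vec : ℝ) : ℂ) :=
      funext fun z => fderiv_ofReal_clm l z e.vec
    rw [this]
    rcases h e with h | ⟨h1, h2, h3⟩
    · rw [h]
      refine ⟨contDiffOn_const, fun n => ?_⟩
      have h0 : ∀ (n : ℕ) (μ : ℝ), AmpN S n μ k j (fun _ => ((0 : ℝ) : ℂ)) := by
        intro n
        induction n with
        | zero => exact fun μ K _ => ⟨0, fun z _ _ => by simp⟩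
        | succ n ih =>
          refine fun μ => ⟨fun K _ => ⟨0, fun z _ _ => by simp⟩, fun e => ?_⟩
          have : pd e (fun _ => ((0 : ℝ) : ℂ)) = fun _ => ((0 : ℝ) : ℂ) :=
            funext fun z => by rw [pd_const]; simp
          rw [this]
          exact ih _
      exact h0 n _
    · exact (IsAmp.const _).mono h1 h2 h3

theorem isAmp_cotan (i : Fin d) : IsAmp S O 1 0 0 (fun z => ((z.2.1 i : ℝ) : ℂ)) := by
  let l : Amb d × Amb d →L[ℝ] ℝ := (EuclideanSpace.proj i).comp
    ((ContinuousLinearMap.fst ℝ _ _).comp (ContinuousLinearMap.snd ℝ _ _))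
  refine isAmp_clm l (fun z => ?_) fun e => ?_
  · simp only [weight, Real.rpow_one, Real.rpow_zero, mul_one]
    exact (PiLp.norm_apply_le z.2.1 i).trans (norm_le_jb _)
  · cases e <;> simp [l, Dir.vec, Dir.wt]

theorem isAmp_nor : IsAmp S O (-1) 1 0 (fun z => ((z.1.2 : ℝ) : ℂ)) := by
  let l : Amb d × Amb d →L[ℝ] ℝ :=
    (ContinuousLinearMap.snd ℝ _ _).comp (ContinuousLinearMap.fst ℝ _ _)
  refine isAmp_clm l (fun z => ?_) fun e => ?_
  · have h1 := jb_pos z.2.1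
    simp only [weight, Real.rpow_one, Real.rpow_zero, mul_one, Real.rpow_neg_one]
    rw [le_inv_mul_iff₀ h1]
    change jb z.2.1 * |z.1.2| ≤ _
    linarith
  · cases e <;> simp [l, Dir.vec, Dir.wt]

theorem isAmp_conor : IsAmp S O 1 0 1 (fun z => ((z.2.2 : ℝ) : ℂ)) := by
  let l : Amb d × Amb d →L[ℝ] ℝ :=
    (ContinuousLinearMap.snd ℝ _ _).comp (ContinuousLinearMap.snd ℝ _ _)
  refine isAmp_clm l (fun z => ?_) fun e => ?_
  · have h1 := jb_pos z.2.1
    simp only [weight, Real.rpow_one, Real.rpow_zero, mul_one]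
    rw [mul_add, mul_div_cancel₀ _ h1.ne']
    change |z.2.2| ≤ _
    linarith
  · cases e <;> simp [l, Dir.vec, Dir.wt]

theorem contDiff_jb_rpow (r : ℝ) :
    ContDiff ℝ ∞ (fun z : Amb d × Amb d => ((jb z.2.1 ^ r : ℝ) : ℂ)) := by
  refine Complex.ofRealCLM.contDiff.comp ?_
  exact (contDiff_jb.comp (contDiff_fst.comp contDiff_snd)).rpow_const_of_ne fun z =>
    (jb_pos _).ne'

theorem fderiv_jb_rpow (r : ℝ) (z v : Amb d × Amb d) :
    fderiv ℝ (fun z : Amb d × Amb d => ((jb z.2.1 ^ r : ℝ) : ℂ)) z v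
      = ((r * inner ℝ z.2.1 v.2.1 * jb z.2.1 ^ (r - 2) : ℝ) : ℂ) := by
  have h0 := jb_pos z.2.1
  let l : Amb d × Amb d →L[ℝ] Bdry d :=
    (ContinuousLinearMap.fst ℝ _ _).comp (ContinuousLinearMap.snd ℝ _ _)
  have hrw : ∀ z : Amb d × Amb d, jb z.2.1 ^ r = (1 + ‖l z‖ ^ 2) ^ (r / 2) := by
    intro z
    rw [jb, Real.sqrt_eq_rpow, ← Real.rpow_mul (by positivity)]
    congr 1
    ring
  have h1 : HasFDerivAt (fun z : Amb d × Amb d => 1 + ‖l z‖ ^ 2)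
      ((2 • innerSL ℝ (l z)).comp l) z := by
    simpa using (((hasStrictFDerivAt_norm_sq (l z)).hasFDerivAt.comp z l.hasFDerivAt).const_add 1)
  have h2 := h1.rpow_const (p := r / 2) (Or.inl (by positivity))
  have h3 := Complex.ofRealCLM.hasFDerivAt.comp z h2
  have h4 : (fun z : Amb d × Amb d => ((jb z.2.1 ^ r : ℝ) : ℂ))
      = Complex.ofRealCLM ∘ fun z => (1 + ‖l z‖ ^ 2) ^ (r / 2) := by
    funext z
    simp [hrw]
  rw [h4, h3.fderiv]
  have h5 : (1 + ‖l z‖ ^ 2) ^ (r / 2 - 1) = jb z.2.1 ^ (r - 2) := by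
    rw [jb, Real.sqrt_eq_rpow, ← Real.rpow_mul (by positivity)]
    congr 1
    ring
  rw [h5]
  simp [l]
  ring

theorem isAmp_jb_rpow (hO : IsOpen O) (hSO : S ⊆ O) (r : ℝ) :
    IsAmp S O r 0 0 (fun z => ((jb z.2.1 ^ r : ℝ) : ℂ)) := by
  refine ⟨(contDiff_jb_rpow r).contDiffOn, fun n => ?_⟩
  have hb : ∀ r, AmpBound S r 0 0 (fun z => ((jb z.2.1 ^ r : ℝ) : ℂ)) := by
    refine fun r K _ => ⟨1, fun z _ _ => ?_⟩
    have := jb_pos z.2.1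
    rw [Complex.norm_real, Real.norm_of_nonneg (by positivity)]
    simp [weight]
  induction n generalizing r with
  | zero => exact hb r
  | succ n ih =>
    refine ⟨hb r, fun e => ?_⟩
    have h0 : ∀ e : Dir d, e.vec.2.1 = 0 → AmpN S n (r + e.wt) 0 0
        (pd e (fun z => ((jb z.2.1 ^ r : ℝ) : ℂ))) := by
      intro e he
      have h1 : pd e (fun z : Amb d × Amb d => ((jb z.2.1 ^ r : ℝ) : ℂ)) = fun _ => 0 := by
        funext z
        rw [pd, fderiv_jb_rpow, he]
        simp
      rw [h1]
      have h2 := (isAmp_clm (S := S) (O := O) (μ := r + e.wt) (k := 0) (j := 0)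
        (0 : Amb d × Amb d →L[ℝ] ℝ) (fun z => by simpa using (weight_pos _ _ _ z).le)
        fun e => Or.inl rfl).2 n
      simpa using h2
    cases e with
    | tan i => exact h0 _ rfl
    | nor => exact h0 _ rfl
    | conor => exact h0 _ rfl
    | cotan i =>
      have h1 : pd (.cotan i) (fun z : Amb d × Amb d => ((jb z.2.1 ^ r : ℝ) : ℂ))
          = fun z => ((r : ℝ) : ℂ) * (((z.2.1 i : ℝ) : ℂ) * ((jb z.2.1 ^ (r - 2) : ℝ) : ℂ)) := by
        funext z
        rw [pd, fderiv_jb_rpow]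
        simp [Dir.vec, EuclideanSpace.inner_single_right]
        ring
      rw [h1]
      have hc := isAmp_cotan (S := S) (O := O) i
      have h2 := (AmpN.const (S := S) (n := n) (r : ℂ)).mul hO hSO contDiffOn_const
        (hc.1.mul (contDiff_jb_rpow (r - 2)).contDiffOn)
        ((hc.2 n).mul hO hSO hc.1 (contDiff_jb_rpow (r - 2)).contDiffOn (ih (r - 2)))
      have e1 : 0 + (1 + (r - 2)) = r + (Dir.cotan i).wt := by simp [Dir.wt]; ring
      rw [e1] at h2
      simpa using h2

end Amplitudes

/-! ### Homogeneous functions and symbols as amplitudes -/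

section Homogeneous

variable {d : ℕ}

/-- The set `X × (ℝ^n ∖ 0)`. -/
def punctured (X : Set (Amb d)) : Set (Amb d × Amb d) := X ×ˢ {ξ : Amb d | ξ ≠ 0}

theorem isOpen_punctured {X : Set (Amb d)} (hX : IsOpen X) : IsOpen (punctured X) :=
  hX.prod isOpen_ne

/-- Over compact sets of `x'`, the points of `S` have `x` in a compact subset of `X` and `ξ` bounded
away from `0`. -/
def ConicSupport (X : Set (Amb d)) (S : Set (Amb d × Amb d)) : Prop :=
  ∀ K : Set (Bdry d), IsCompact K → ∃ L : Set (Amb d), IsCompact L ∧ L ⊆ X ∧ ∃ c : ℝ, 0 < c ∧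
    ∀ z ∈ S, z.1.1 ∈ K → z.1 ∈ L ∧ c ≤ ‖z.2‖

theorem ConicSupport.subset {X : Set (Amb d)} {S : Set (Amb d × Amb d)} (h : ConicSupport X S) :
    S ⊆ punctured X := by
  intro z hz
  obtain ⟨L, -, hLX, c, hc, hL⟩ := h {z.1.1} isCompact_singleton
  obtain ⟨h1, h2⟩ := hL z hz rfl
  exact ⟨hLX h1, fun h0 => by rw [h0, norm_zero] at h2; linarith⟩

theorem ConicSupport.mono {X Y : Set (Amb d)} {S : Set (Amb d × Amb d)} (h : ConicSupport X S)
    (hXY : X ⊆ Y) : ConicSupport Y S := by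
  intro K hK
  obtain ⟨L, hL, hLX, c, hc, hS⟩ := h K hK
  exact ⟨L, hL, hLX.trans hXY, c, hc, hS⟩

theorem rpow_le_of_comparable {A B M : ℝ} (hA : 0 < A) (hB : 0 < B) (hM : 0 < M) (h1 : A ≤ M * B)
    (h2 : B ≤ M * A) (r : ℝ) : A ^ r ≤ M ^ |r| * B ^ r := by
  rcases le_total 0 r with hr | hr
  · rw [abs_of_nonneg hr, ← Real.mul_rpow hM.le hB.le]
    exact Real.rpow_le_rpow hA.le h1 hr
  · rw [abs_of_nonpos hr, Real.rpow_neg hM.le, ← Real.inv_rpow hM.le,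
      ← Real.mul_rpow (inv_nonneg.2 hM.le) hB.le]
    refine Real.rpow_le_rpow_of_nonpos (by positivity) ?_ hr
    rwa [inv_mul_le_iff₀ hM]

theorem weight_diag (r : ℝ) (z : Amb d × Amb d) :
    weight r 0 r z = (jb z.2.1 + |z.2.2|) ^ r := by
  have h := jb_pos z.2.1
  rw [weight, Real.rpow_zero, mul_one, ← Real.mul_rpow h.le (by positivity), mul_add, mul_one,
    mul_div_cancel₀ _ h.ne']

theorem norm_le_jb_add (ξ : Amb d) : ‖ξ‖ ≤ jb ξ.1 + |ξ.2| := by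
  have h := jb_pos ξ.1
  refine max_le ((norm_le_jb _).trans (by linarith [abs_nonneg ξ.2])) ?_
  rw [Real.norm_eq_abs]
  linarith

theorem jb_add_le (ξ : Amb d) : jb ξ.1 + |ξ.2| ≤ 1 + 2 * ‖ξ‖ := by
  have h1 := jb_le_one_add ξ.1
  have h2 : ‖ξ.1‖ ≤ ‖ξ‖ := norm_fst_le ξ
  have h3 : |ξ.2| ≤ ‖ξ‖ := norm_snd_le ξ
  linarith

theorem norm_rpow_le_weight {c : ℝ} (hc : 0 < c) (r : ℝ) : ∃ C : ℝ, 0 ≤ C ∧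
    ∀ z : Amb d × Amb d, c ≤ ‖z.2‖ → ‖z.2‖ ^ r ≤ C * weight r 0 r z := by
  refine ⟨(c⁻¹ + 2) ^ |r|, by positivity, fun z hz => ?_⟩
  rw [weight_diag]
  have h1 := one_le_jb z.2.1
  have h2 := norm_le_jb_add z.2
  have h3 : 0 < c⁻¹ := inv_pos.2 hc
  have h4 : 0 < ‖z.2‖ := hc.trans_le hz
  have h5 : 0 ≤ |z.2.2| := abs_nonneg _
  refine rpow_le_of_comparable h4 (by linarith) (by linarith) ?_ ?_ r
  · nlinarith
  · have h6 : 1 ≤ c⁻¹ * ‖z.2‖ := by rwa [le_inv_mul_iff₀ hc, mul_one]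
    linarith [jb_add_le z.2]

theorem one_add_norm_rpow_le_weight (r : ℝ) (z : Amb d × Amb d) :
    (1 + ‖z.2‖) ^ r ≤ 2 ^ |r| * weight r 0 r z := by
  rw [weight_diag]
  have h1 := one_le_jb z.2.1
  have h2 := norm_le_jb_add z.2
  have h3 := jb_add_le z.2
  have h5 : 0 ≤ |z.2.2| := abs_nonneg _
  exact rpow_le_of_comparable (by positivity) (by linarith) two_pos (by linarith) (by linarith) r

/-- Smooth functions on `X × (ℝ^n ∖ 0)` that are positively homogeneous of degree `r` in `ξ`. -/
def IsHom (X : Set (Amb d)) (r : ℝ) (f : Amb d × Amb d → ℂ) : Prop :=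
  ContDiffOn ℝ ∞ f (punctured X) ∧ ∀ x ∈ X, ∀ ξ : Amb d, ξ ≠ 0 → ∀ c : ℝ, 0 < c →
    f (x, c • ξ) = ((c ^ r : ℝ) : ℂ) * f (x, ξ)

/-- The degree of homogeneity lost by a derivative. -/
def Dir.deg : Dir d → ℝ
  | tan _ => 0
  | cotan _ => -1
  | nor => 0
  | conor => -1

theorem Dir.deg_le_wt (e : Dir d) : e.deg ≤ e.wt := by cases e <;> simp [deg, wt]

theorem Dir.deg_nonpos (e : Dir d) : e.deg ≤ 0 := by cases e <;> simp [deg]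

variable {X : Set (Amb d)} {S : Set (Amb d × Amb d)} {r : ℝ} {f : Amb d × Amb d → ℂ}

theorem IsHom.pd (hX : IsOpen X) (hf : IsHom X r f) (e : Dir d) : IsHom X (r + e.deg) (pd e f) := by
  have hO := isOpen_punctured hX
  refine ⟨contDiffOn_pd hO hf.1 e, fun x hx ξ hξ c hc => ?_⟩
  let A : Amb d × Amb d →L[ℝ] Amb d × Amb d :=
    (ContinuousLinearMap.id ℝ (Amb d)).prodMap (c • ContinuousLinearMap.id ℝ (Amb d))
  have hA : ∀ z : Amb d × Amb d, A z = (z.1, c • z.2) := fun z => rfl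
  have hcξ : (x, c • ξ) ∈ punctured X := ⟨hx, smul_ne_zero hc.ne' hξ⟩
  have hz : (x, ξ) ∈ punctured X := ⟨hx, hξ⟩
  have h1 : HasFDerivAt (fun z => f (A z)) ((fderiv ℝ f (x, c • ξ)).comp A) (x, ξ) :=
    (differentiableAt_of_contDiffOn hO hf.1 hcξ).hasFDerivAt.comp (x, ξ) A.hasFDerivAt
  have h2 : HasFDerivAt (fun z => ((c ^ r : ℝ) : ℂ) * f z)
      (((c ^ r : ℝ) : ℂ) • fderiv ℝ f (x, ξ)) (x, ξ) :=
    (differentiableAt_of_contDiffOn hO hf.1 hz).hasFDerivAt.const_mul _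
  have h3 : (fun z => f (A z)) =ᶠ[𝓝 (x, ξ)] fun z => ((c ^ r : ℝ) : ℂ) * f z := by
    filter_upwards [hO.mem_nhds hz] with z hz
    exact hf.2 z.1 hz.1 z.2 hz.2 c hc
  have h4 := DFunLike.congr_fun ((h1.congr_of_eventuallyEq h3.symm).unique h2) e.vec
  simp only [ContinuousLinearMap.comp_apply, smul_apply, hA, smul_eq_mul] at h4
  have hbase : e.vec.2 = 0 → e.deg = 0 →
      _root_.pd e f (x, c • ξ) = ((c ^ (r + e.deg) : ℝ) : ℂ) * _root_.pd e f (x, ξ) := by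
    intro he hd
    have : (e.vec.1, c • e.vec.2) = e.vec := by ext1 <;> simp [he]
    rw [this] at h4
    rw [hd, add_zero]
    exact h4
  have hfib : e.vec.1 = 0 → e.deg = -1 →
      _root_.pd e f (x, c • ξ) = ((c ^ (r + e.deg) : ℝ) : ℂ) * _root_.pd e f (x, ξ) := by
    intro he hd
    have : (e.vec.1, c • e.vec.2) = c • e.vec := by ext1 <;> simp [he]
    rw [this, map_smul] at h4
    rw [hd, Real.rpow_add hc, Real.rpow_neg_one]
    have hc' : (c : ℂ) ≠ 0 := by exact_mod_cast hc.ne'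
    rw [_root_.pd, _root_.pd]
    push_cast
    rw [Complex.real_smul] at h4
    rw [mul_right_comm, ← h4]
    field_simp
  cases e with
  | tan i => exact hbase rfl rfl
  | nor => exact hbase rfl rfl
  | cotan i => exact hfib rfl rfl
  | conor => exact hfib rfl rfl

theorem isCompact_unit_sphere : IsCompact (Metric.sphere (0 : Amb d) 1) := isCompact_sphere 0 1

theorem ne_zero_of_mem_sphere_one {ξ : Amb d} (h : ξ ∈ Metric.sphere (0 : Amb d) 1) : ξ ≠ 0 := by
  rintro rfl
  simp at h

theorem inv_norm_smul_mem_sphere {ξ : Amb d} (h : ξ ≠ 0) :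
    ‖ξ‖⁻¹ • ξ ∈ Metric.sphere (0 : Amb d) 1 := by
  rw [mem_sphere_zero_iff_norm, norm_smul, norm_inv, norm_norm, inv_mul_cancel₀ (norm_ne_zero_iff.2 h)]

theorem IsHom.eq_norm_rpow_mul (hf : IsHom X r f) {x : Amb d} (hx : x ∈ X) {ξ : Amb d}
    (hξ : ξ ≠ 0) : f (x, ξ) = ((‖ξ‖ ^ r : ℝ) : ℂ) * f (x, ‖ξ‖⁻¹ • ξ) := by
  have hn := norm_pos_iff.2 hξ
  rw [← hf.2 x hx _ (ne_zero_of_mem_sphere_one (inv_norm_smul_mem_sphere hξ)) _ hn, smul_smul,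
    mul_inv_cancel₀ hn.ne', one_smul]

theorem IsHom.norm_le (hf : IsHom X r f) {L : Set (Amb d)} (hL : IsCompact L) (hLX : L ⊆ X) :
    ∃ C : ℝ, 0 ≤ C ∧ ∀ x ∈ L, ∀ ξ : Amb d, ξ ≠ 0 → ‖f (x, ξ)‖ ≤ C * ‖ξ‖ ^ r := by
  have hsub : L ×ˢ Metric.sphere (0 : Amb d) 1 ⊆ punctured X := by
    rintro ⟨x, ξ⟩ ⟨hx, hξ⟩
    exact ⟨hLX hx, ne_zero_of_mem_sphere_one hξ⟩
  obtain ⟨C, hC⟩ := (hL.prod isCompact_unit_sphere).exists_bound_of_continuousOn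
    (hf.1.continuousOn.mono hsub)
  refine ⟨|C|, abs_nonneg _, fun x hx ξ hξ => ?_⟩
  have hmem : ((x, ‖ξ‖⁻¹ • ξ) : Amb d × Amb d) ∈ L ×ˢ Metric.sphere (0 : Amb d) 1 :=
    Set.mk_mem_prod hx (inv_norm_smul_mem_sphere hξ)
  have h1 : ‖f (x, ‖ξ‖⁻¹ • ξ)‖ ≤ |C| := (hC _ hmem).trans (le_abs_self C)
  have h2 : 0 ≤ ‖ξ‖ ^ r := Real.rpow_nonneg (norm_nonneg ξ) r
  rw [hf.eq_norm_rpow_mul (hLX hx) hξ, norm_mul, Complex.norm_real, Real.norm_of_nonneg h2, mul_comm]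
  exact mul_le_mul_of_nonneg_right h1 h2

theorem IsHom.isAmp (hX : IsOpen X) (hS : ConicSupport X S) (hf : IsHom X r f) :
    IsAmp S (punctured X) r 0 r f := by
  refine ⟨hf.1, fun n => ?_⟩
  have hb : ∀ {r f}, IsHom X r f → AmpBound S r 0 r f := by
    intro r f hf K hK
    obtain ⟨L, hL, hLX, c, hc, hSL⟩ := hS K hK
    obtain ⟨C, hC, hfC⟩ := hf.norm_le hL hLX
    obtain ⟨C', hC', hw⟩ := norm_rpow_le_weight (d := d) hc r
    refine ⟨C * C', fun z hz hzK => ?_⟩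
    obtain ⟨h1, h2⟩ := hSL z hz hzK
    calc ‖f z‖ ≤ C * ‖z.2‖ ^ r := hfC z.1 h1 z.2 (hS.subset hz).2
      _ ≤ C * (C' * weight r 0 r z) := by gcongr; exact hw z h2
      _ = _ := by ring
  induction n generalizing r f with
  | zero => exact hb hf
  | succ n ih =>
    refine ⟨hb hf, fun e => (ih (hf.pd hX e)).mono ?_ le_rfl ?_⟩
    · linarith [e.deg_le_wt]
    · linarith [e.deg_nonpos]

/-- A homogeneous function which vanishes at the boundary `x_n = 0` gains one order, at the price of
one power of `⟨ξ'⟩ x_n`. -/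
theorem IsHom.isAmp_of_vanish (hX : IsOpen X)
    (hstar : ∀ x ∈ X, ∀ θ ∈ Icc (0 : ℝ) 1, ((x.1, θ * x.2) : Amb d) ∈ X)
    (hS : ConicSupport X S) (hf : IsHom X r f)
    (h0 : ∀ z ∈ punctured X, z.1.2 = 0 → f z = 0) :
    IsAmp S (punctured X) (r - 1) 1 r f := by
  have hO := isOpen_punctured hX
  refine ⟨hf.1, fun n => ?_⟩
  have hb : ∀ {r f}, IsHom X r f → (∀ z ∈ punctured X, z.1.2 = 0 → f z = 0) →
      AmpBound S (r - 1) 1 r f := by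
    intro r f hf h0 K hK
    obtain ⟨L, hL, hLX, c, hc, hSL⟩ := hS K hK
    let Φ : Amb d × ℝ → Amb d := fun p => (p.1.1, p.2 * p.1.2)
    have hΦ : Continuous Φ := by fun_prop
    have hL' : IsCompact (Φ '' (L ×ˢ Icc (0 : ℝ) 1)) := (hL.prod isCompact_Icc).image hΦ
    have hLX' : Φ '' (L ×ˢ Icc (0 : ℝ) 1) ⊆ X := by
      rintro _ ⟨p, hp, rfl⟩
      exact hstar _ (hLX hp.1) _ hp.2
    obtain ⟨C, hC, hfC⟩ := (hf.pd hX .nor).norm_le hL' hLX'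
    obtain ⟨C', hC', hw⟩ := norm_rpow_le_weight (d := d) hc r
    refine ⟨C * C', fun z hz hzK => ?_⟩
    obtain ⟨h1, h2⟩ := hSL z hz hzK
    have hξ : z.2 ≠ 0 := (hS.subset hz).2
    have hder : ∀ θ ∈ Icc (0 : ℝ) 1, HasDerivWithinAt (fun θ : ℝ => f ((z.1.1, θ * z.1.2), z.2))
        ((z.1.2 : ℂ) * _root_.pd .nor f ((z.1.1, θ * z.1.2), z.2)) (Icc 0 1) θ := by
      intro θ hθ
      have hmem : (((z.1.1, θ * z.1.2), z.2) : Amb d × Amb d) ∈ punctured X :=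
        ⟨hstar _ (hLX h1) θ hθ, hξ⟩
      have hc1 : HasDerivAt (fun θ : ℝ => (((z.1.1, θ * z.1.2), z.2) : Amb d × Amb d))
          (z.1.2 • Dir.nor.vec) θ := by
        have e1 : HasDerivAt (fun θ : ℝ => θ * z.1.2) z.1.2 θ := by
          simpa using (hasDerivAt_id θ).mul_const z.1.2
        have e2 := ((hasDerivAt_const θ z.1.1).prodMk e1).prodMk (hasDerivAt_const θ z.2)
        convert e2 using 1
        simp [Dir.vec]
      have hd := (differentiableAt_of_contDiffOn hO hf.1 hmem).hasFDerivAt.comp_hasDerivAt θ hc1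
      rw [map_smul, Complex.real_smul] at hd
      exact hd.hasDerivWithinAt
    have hmvt := norm_image_sub_le_of_norm_deriv_le_segment_01'
      (C := |z.1.2| * (C * ‖z.2‖ ^ r)) hder fun θ hθ => by
        rw [norm_mul, Complex.norm_real, Real.norm_eq_abs]
        have := hfC (z.1.1, θ * z.1.2) ⟨(z.1, θ), ⟨h1, Ico_subset_Icc_self hθ⟩, rfl⟩ z.2 hξ
        rw [show r + Dir.nor.deg = r by simp [Dir.deg]] at this
        gcongr
    have hz0 : f ((z.1.1, 0 * z.1.2), z.2) = 0 :=
      h0 _ ⟨hstar _ (hLX h1) 0 (by simp), hξ⟩ (by simp)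
    rw [hz0, sub_zero, one_mul] at hmvt
    have hjb := jb_pos z.2.1
    have hwt : weight (r - 1) 1 r z = weight r 0 r z * (jb z.2.1)⁻¹ * (1 + jb z.2.1 * |z.1.2|) := by
      rw [weight, weight, Real.rpow_sub hjb, Real.rpow_one, Real.rpow_one, Real.rpow_zero]
      field_simp
    have hw0 := weight_pos r 0 r z
    calc ‖f z‖ ≤ |z.1.2| * (C * ‖z.2‖ ^ r) := hmvt
      _ ≤ |z.1.2| * (C * (C' * weight r 0 r z)) := by gcongr; exact hw z h2
      _ = C * C' * (weight r 0 r z * (jb z.2.1)⁻¹ * (jb z.2.1 * |z.1.2|)) := by field_simp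
      _ ≤ C * C' * (weight r 0 r z * (jb z.2.1)⁻¹ * (1 + jb z.2.1 * |z.1.2|)) := by
          gcongr; linarith
      _ = C * C' * weight (r - 1) 1 r z := by rw [hwt]
  induction n generalizing r f with
  | zero => exact hb hf h0
  | succ n ih =>
    refine ⟨hb hf h0, fun e => ?_⟩
    by_cases he : e = .nor
    · subst he
      refine (((hf.pd hX .nor).isAmp hX hS).2 n).mono ?_ zero_le_one ?_
      · simp [Dir.deg, Dir.wt]
      · simp [Dir.deg]
    · have hwt : e.wt = e.deg := by cases e <;> first | rfl | exact absurd rfl he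
      have hn : e.vec.1.2 = 0 := by cases e <;> first | rfl | exact absurd rfl he
      refine (ih (hf.pd hX e) ?_).mono ?_ le_rfl ?_
      · intro z hz hz0
        have hmem : ∀ᶠ θ : ℝ in 𝓝 0, z + θ • e.vec ∈ punctured X := by
          have : ContinuousAt (fun θ : ℝ => z + θ • e.vec) 0 := by fun_prop
          refine this.eventually_mem ?_
          simpa using hO.mem_nhds hz
        have h2 : HasDerivAt (fun θ : ℝ => f (z + θ • e.vec)) (_root_.pd e f z) 0 := by
          have e1 : HasDerivAt (fun θ : ℝ => z + θ • e.vec) e.vec 0 := by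
            simpa using ((hasDerivAt_id (0 : ℝ)).smul_const e.vec).const_add z
          have e2 := hasDerivAt_comp_pd (f := f) (e := e) (c := fun θ : ℝ => z + θ • e.vec) (θ := 0)
            (by simpa using differentiableAt_of_contDiffOn hO hf.1 hz) e1
          simpa using e2
        refine h2.unique ((hasDerivAt_const (0 : ℝ) (0 : ℂ)).congr_of_eventuallyEq ?_)
        filter_upwards [hmem] with θ hθ
        exact h0 _ hθ (by simp [hz0, hn])
      · rw [hwt]; linarith
      · linarith [e.deg_nonpos]

end Homogeneous

section ScalarSymbols

variable {d : ℕ} {m : ℝ} {a : Amb d × Amb d → ℂ}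

theorem iteratedFDeriv_snoc {E : Type*} [NormedAddCommGroup E] [NormedSpace ℝ E] {f : E → ℂ}
    (hf : ContDiff ℝ ∞ f) (n : ℕ) (z b : E) (v : Fin n → E) :
    iteratedFDeriv ℝ (n + 1) f z (Fin.snoc v b : Fin (n + 1) → E)
      = iteratedFDeriv ℝ n (fun y => fderiv ℝ f y b) z v := by
  rw [iteratedFDeriv_succ_apply_right]
  simp only [Fin.init_snoc, Fin.snoc_last]
  have h1 : (fun y => fderiv ℝ f y b) = (ContinuousLinearMap.apply ℝ ℂ b) ∘ fderiv ℝ f := rfl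
  rw [h1, ContinuousLinearMap.iteratedFDeriv_comp_left (ContinuousLinearMap.apply ℝ ℂ b)
    (n := ∞) ((hf.fderiv_right le_rfl).contDiffAt) (by norm_cast; exact le_top)]
  rfl

theorem iteratedFDeriv_cons {E : Type*} [NormedAddCommGroup E] [NormedSpace ℝ E] {f : E → ℂ}
    (hf : ContDiff ℝ ∞ f) (n : ℕ) (z b : E) (v : Fin n → E) :
    iteratedFDeriv ℝ (n + 1) f z (Fin.cons b v : Fin (n + 1) → E)
      = iteratedFDeriv ℝ n (fun y => fderiv ℝ f y b) z v := by
  induction n generalizing f with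
  | zero =>
    have : (Fin.cons b v : Fin 1 → E) = Fin.snoc v b := by
      ext i
      fin_cases i
      rfl
    rw [this, iteratedFDeriv_snoc hf]
  | succ n ih =>
    have hsm : ∀ c, ContDiff ℝ ∞ fun y => fderiv ℝ f y c := fun c =>
      (hf.fderiv_right le_rfl).clm_apply contDiff_const
    have hcomm : ∀ b c : E, (fun y => fderiv ℝ (fun y => fderiv ℝ f y c) y b)
        = fun y => fderiv ℝ (fun y => fderiv ℝ f y b) y c := by
      have hd : ∀ y, DifferentiableAt ℝ (fderiv ℝ f) y := fun y =>
        (hf.fderiv_right (m := ∞) le_rfl).differentiable (by simp) y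
      intro b c
      funext y
      rw [fderiv_clm_apply (hd y) (by fun_prop), fderiv_clm_apply (hd y) (by fun_prop)]
      have hs : IsSymmSndFDerivAt ℝ f y := hf.contDiffAt.isSymmSndFDerivAt (by simp; norm_cast)
      simpa using hs.eq b c
    obtain ⟨u, c, rfl⟩ : ∃ (u : Fin n → E) (c : E), v = Fin.snoc u c :=
      ⟨Fin.init v, v (Fin.last n), (Fin.snoc_init_self v).symm⟩
    have hcs : (Fin.cons b (Fin.snoc u c : Fin (n + 1) → E) : Fin (n + 2) → E)
        = Fin.snoc (Fin.cons b u : Fin (n + 1) → E) c := Fin.cons_snoc_eq_snoc_cons b u c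
    rw [hcs, iteratedFDeriv_snoc hf, ih (hsm _),
      hcomm, iteratedFDeriv_snoc (hsm b)]

theorem IsSymbol.pd_fibre (ha : IsSymbol m a) (w : Amb d) :
    IsSymbol (m - 1) (fun z => fderiv ℝ a z ((0, w) : Amb d × Amb d)) := by
  refine ⟨(ha.1.fderiv_right le_rfl).clm_apply contDiff_const, fun j k K hK => ?_⟩
  obtain ⟨C, hC⟩ := ha.2 j (k + 1) K hK
  refine ⟨C * ‖w‖, fun x hx ξ v u => ?_⟩
  have h1 := hC x hx ξ v (Fin.snoc u w : Fin (k + 1) → Amb d)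
  have h2 : mixedDeriv a (x, ξ) v (Fin.snoc u w : Fin (k + 1) → Amb d)
      = mixedDeriv (fun z => fderiv ℝ a z ((0, w) : Amb d × Amb d)) (x, ξ) v u := by
    have h3 : (fun i => ((0, (Fin.snoc u w : Fin (k + 1) → Amb d) i) : Amb d × Amb d))
        = Fin.snoc (fun i => ((0, u i) : Amb d × Amb d)) ((0, w) : Amb d × Amb d) := by
      funext i
      refine Fin.lastCases ?_ (fun i => ?_) i <;> simp
    rw [mixedDeriv, h3, Fin.append_snoc]
    exact iteratedFDeriv_snoc ha.1 (j + k) _ _ _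
  rw [h2, Fin.prod_univ_castSucc] at h1
  simp only [Fin.snoc_castSucc, Fin.snoc_last, Nat.cast_add, Nat.cast_one] at h1
  rw [show m - 1 - (k : ℝ) = m - (k + 1) by ring]
  linarith

theorem IsSymbol.pd_base (ha : IsSymbol m a) (w : Amb d) :
    IsSymbol m (fun z => fderiv ℝ a z ((w, 0) : Amb d × Amb d)) := by
  refine ⟨(ha.1.fderiv_right le_rfl).clm_apply contDiff_const, fun j k K hK => ?_⟩
  obtain ⟨C, hC⟩ := ha.2 (j + 1) k K hK
  refine ⟨C * ‖w‖, fun x hx ξ v u => ?_⟩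
  have h1 := hC x hx ξ (Fin.cons w v : Fin (j + 1) → Amb d) u
  have hcast : ∀ (n : ℕ) (h : n = j + k + 1) (y : Fin (j + k + 1) → Amb d × Amb d),
      iteratedFDeriv ℝ n a (x, ξ) (y ∘ Fin.cast h) = iteratedFDeriv ℝ (j + k + 1) a (x, ξ) y := by
    rintro n rfl y
    rfl
  have h2 : mixedDeriv a (x, ξ) (Fin.cons w v : Fin (j + 1) → Amb d) u
      = mixedDeriv (fun z => fderiv ℝ a z ((w, 0) : Amb d × Amb d)) (x, ξ) v u := by
    have h3 : (fun i => (((Fin.cons w v : Fin (j + 1) → Amb d) i, 0) : Amb d × Amb d))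
        = Fin.cons ((w, 0) : Amb d × Amb d) (fun i => ((v i, 0) : Amb d × Amb d)) := by
      funext i
      refine Fin.cases ?_ (fun i => ?_) i <;> simp
    rw [mixedDeriv, h3, Fin.append_cons, hcast _ (by omega)]
    exact iteratedFDeriv_cons ha.1 (j + k) _ _ _
  rw [h2, Fin.prod_univ_succ] at h1
  simp only [Fin.cons_zero, Fin.cons_succ] at h1
  linarith

theorem IsSymbol.isAmp {X : Set (Amb d)} {S O : Set (Amb d × Amb d)} (hS : ConicSupport X S)
    (ha : IsSymbol m a) : IsAmp S O m 0 m a := by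
  refine ⟨ha.1.contDiffOn, fun n => ?_⟩
  have hb : ∀ {m a}, IsSymbol m a → AmpBound S m 0 m a := by
    intro m a ha K hK
    obtain ⟨L, hL, -, c, -, hSL⟩ := hS K hK
    obtain ⟨C, hC⟩ := ha.2 0 0 L hL
    refine ⟨|C| * 2 ^ |m|, fun z hz hzK => ?_⟩
    have h1 := hC z.1 (hSL z hz hzK).1 z.2 (fun i => i.elim0) (fun i => i.elim0)
    simp only [mixedDeriv, Finset.univ_eq_empty, Finset.prod_empty, mul_one, Nat.cast_zero,
      sub_zero] at h1
    rw [iteratedFDeriv_zero_apply] at h1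
    calc ‖a z‖ ≤ C * (1 + ‖z.2‖) ^ m := h1
      _ ≤ |C| * (2 ^ |m| * weight m 0 m z) :=
          mul_le_mul (le_abs_self C) (one_add_norm_rpow_le_weight m z) (by positivity)
            (abs_nonneg _)
      _ = _ := by ring
  induction n generalizing m a with
  | zero => exact hb ha
  | succ n ih =>
    refine ⟨hb ha, fun e => ?_⟩
    cases e with
    | tan i => exact (ih (ha.pd_base _)).mono (by simp [Dir.wt]) le_rfl le_rfl
    | nor => exact (ih (ha.pd_base _)).mono (by simp [Dir.wt]) le_rfl le_rfl
    | cotan i => exact (ih (ha.pd_fibre _)).mono (by simp only [Dir.wt]; linarith) le_rfl (by linarith)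
    | conor => exact (ih (ha.pd_fibre _)).mono (by simp only [Dir.wt]; linarith) le_rfl (by linarith)

end ScalarSymbols

/-! ### The phase near the boundary -/

section PartialDerivatives

variable {E E' F : Type*} [NormedAddCommGroup E] [NormedSpace ℝ E] [NormedAddCommGroup E']
  [NormedSpace ℝ E'] [NormedAddCommGroup F] [NormedSpace ℝ F]

theorem fderiv_partial_left {f : E × E' → F} {x : E} {y : E'} (hf : DifferentiableAt ℝ f (x, y))
    (v : E) : fderiv ℝ (fun x => f (x, y)) x v = fderiv ℝ f (x, y) (v, 0) := by
  have h : HasFDerivAt (fun x => f (x, y))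
      ((fderiv ℝ f (x, y)).comp (ContinuousLinearMap.inl ℝ E E')) x :=
    HasFDerivAt.comp (f := fun x : E => (x, y)) x hf.hasFDerivAt (hasFDerivAt_prodMk_left x y)
  rw [h.fderiv]
  rfl

theorem fderiv_partial_right {f : E × E' → F} {x : E} {y : E'} (hf : DifferentiableAt ℝ f (x, y))
    (v : E') : fderiv ℝ (fun y => f (x, y)) y v = fderiv ℝ f (x, y) (0, v) := by
  have h : HasFDerivAt (fun y => f (x, y))
      ((fderiv ℝ f (x, y)).comp (ContinuousLinearMap.inr ℝ E E')) y :=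
    HasFDerivAt.comp (f := fun y : E' => (x, y)) y hf.hasFDerivAt (hasFDerivAt_prodMk_right x y)
  rw [h.fderiv]
  rfl

theorem hasDerivAt_line {f : E → F} {x : E} (hf : DifferentiableAt ℝ f x) (v : E) :
    HasDerivAt (fun θ : ℝ => f (x + θ • v)) (fderiv ℝ f x v) 0 := by
  have h1 : HasDerivAt (fun θ : ℝ => x + θ • v) v 0 := by
    simpa using ((hasDerivAt_id (0 : ℝ)).smul_const v).const_add x
  have h2 : HasFDerivAt f (fderiv ℝ f x) (x + (0 : ℝ) • v) := by simpa using hf.hasFDerivAt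
  exact h2.comp_hasDerivAt (0 : ℝ) h1

theorem fderiv_eq_zero_of_const_on_line {f : E → F} {x v : E} (hf : DifferentiableAt ℝ f x) {c : F}
    (h : ∀ᶠ θ : ℝ in 𝓝 0, f (x + θ • v) = c) : fderiv ℝ f x v = 0 :=
  (hasDerivAt_line hf v).unique ((hasDerivAt_const (0 : ℝ) c).congr_of_eventuallyEq h)

theorem eventually_add_smul_mem {O : Set E} (hO : IsOpen O) {x : E} (hx : x ∈ O) (v : E) :
    ∀ᶠ θ : ℝ in 𝓝 0, x + θ • v ∈ O := by
  have : ContinuousAt (fun θ : ℝ => x + θ • v) 0 := by fun_prop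
  exact this.eventually_mem (by simpa using hO.mem_nhds hx)

end PartialDerivatives

section Phase

variable {d : ℕ}

/-- The reduced phase `ψ(x, ξ) - ψ_∂(x', ξ')`. -/
def redPhase (ψ : Amb d × Amb d → ℝ) (z : Amb d × Amb d) : ℝ := ψ z - psiBdry ψ z.1.1 z.2.1

/-- What the construction of the operators needs to know about a phase `φ` on the set `S`: it is an
amplitude of order zero, `∂_{ξ_n} φ` is comparable with `x_n`, and `∂_{x_n} φ` is comparable with
`ξ_n` up to `⟨ξ'⟩`. -/
structure IsNormalPhase (X : Set (Amb d)) (S : Set (Amb d × Amb d)) (φ : Amb d × Amb d → ℝ) :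
    Prop where
  isAmp : IsAmp S (punctured X) 0 1 1 (fun z => ((φ z : ℝ) : ℂ))
  smooth : ContDiffOn ℝ ∞ φ (punctured X)
  conor_isAmp : IsAmp S (punctured X) (-1) 1 0 (pd .conor fun z => ((φ z : ℝ) : ℂ))
  nor_isAmp : IsAmp S (punctured X) 1 0 1 (pd .nor fun z => ((φ z : ℝ) : ℂ))
  conor_bound : ∀ K : Set (Bdry d), IsCompact K → ∃ c : ℝ, 0 < c ∧ ∀ z ∈ S, z.1.1 ∈ K →
    c * (jb z.2.1 * |z.1.2|) ^ 2 ≤ 1 + (jb z.2.1 * fderiv ℝ φ z Dir.conor.vec) ^ 2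
  nor_bound : ∀ K : Set (Bdry d), IsCompact K → ∃ c : ℝ, 0 < c ∧ ∀ z ∈ S, z.1.1 ∈ K →
    c * (|z.2.2| / jb z.2.1) ^ 2 ≤ 1 + ((jb z.2.1)⁻¹ * fderiv ℝ φ z Dir.nor.vec) ^ 2

theorem isOpen_collar {Ωb : Set (Bdry d)} (hΩ : IsOpen Ωb) : IsOpen (collar Ωb) :=
  hΩ.prod isOpen_Ioo

theorem collar_star {Ωb : Set (Bdry d)} {x : Amb d} (hx : x ∈ collar Ωb) {θ : ℝ}
    (hθ : θ ∈ Icc (0 : ℝ) 1) : ((x.1, θ * x.2) : Amb d) ∈ collar Ωb := by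
  obtain ⟨h1, h2, h3⟩ := hx
  obtain ⟨h4, h5⟩ := hθ
  refine ⟨h1, ?_, ?_⟩ <;> simp only <;> nlinarith

theorem pd_ofReal {f : Amb d × Amb d → ℝ} {z : Amb d × Amb d} (hf : DifferentiableAt ℝ f z)
    (e : Dir d) : pd e (fun z => ((f z : ℝ) : ℂ)) z = ((fderiv ℝ f z e.vec : ℝ) : ℂ) := by
  have h : HasFDerivAt (fun z => ((f z : ℝ) : ℂ)) (Complex.ofRealCLM.comp (fderiv ℝ f z)) z :=
    Complex.ofRealCLM.hasFDerivAt.comp z hf.hasFDerivAt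
  rw [pd, h.fderiv]
  rfl

section

variable {U : Set (Amb d × Amb d)} {χ : Amb d × Amb d → Amb d × Amb d} {Ωb : Set (Bdry d)}
  {ψ : Amb d × Amb d → ℝ}

theorem IsPhaseOf.differentiableAt (hψ : IsPhaseOf U χ Ωb ψ) (hΩ : IsOpen Ωb)
    {x ξ : Amb d} (hx : x ∈ collar Ωb) (hξ : ξ ≠ 0) :
    DifferentiableAt ℝ ψ (x, ξ) :=
  differentiableAt_of_contDiffOn (isOpen_punctured (isOpen_collar hΩ)) hψ.smooth ⟨hx, hξ⟩

theorem IsPhaseOf.fderiv_fibre (hψ : IsPhaseOf U χ Ωb ψ) (hΩ : IsOpen Ωb)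
    {x ξ : Amb d} (hx : x ∈ collar Ωb) (hξ : ξ ≠ 0) (v : Amb d) :
    fderiv ℝ ψ (x, ξ) (0, v) = fderiv ℝ (fun θ => ψ (x, θ)) ξ v :=
  (fderiv_partial_right (hψ.differentiableAt hΩ hx hξ) v).symm

theorem IsPhaseOf.fderiv_base (hψ : IsPhaseOf U χ Ωb ψ) (hΩ : IsOpen Ωb)
    {x ξ : Amb d} (hx : x ∈ collar Ωb) (hξ : ξ ≠ 0) (v : Amb d) :
    fderiv ℝ ψ (x, ξ) (v, 0) = fderiv ℝ (fun z => ψ (z, ξ)) x v :=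
  (fderiv_partial_left (hψ.differentiableAt hΩ hx hξ) v).symm

theorem IsPhaseOf.isHom (hψ : IsPhaseOf U χ Ωb ψ) :
    IsHom (collar Ωb) 1 (fun z => ((ψ z : ℝ) : ℂ)) := by
  refine ⟨Complex.ofRealCLM.contDiff.comp_contDiffOn hψ.smooth, fun x hx ξ hξ c hc => ?_⟩
  simp only [hψ.homogeneous x hx ξ hξ c hc, Real.rpow_one]
  push_cast
  rfl

theorem IsPhaseOf.conormal_eq_zero (hψ : IsPhaseOf U χ Ωb ψ) (hΩ : IsOpen Ωb)
    (hχ : IsBoundarySymplecto U χ) {x : Bdry d} (hx : x ∈ Ωb) {s : ℝ} (hs : s ≠ 0) :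
    ψ ((x, 0), (0, s)) = 0 := by
  have h1 : ∀ s : ℝ, s ≠ 0 → ψ ((x, 0), ((0 : Bdry d), s)) = psiBdry ψ x 0 := fun s hs =>
    psiBdry_eq hΩ hχ hψ hx (by simp [hs])
  have h2 : ψ ((x, 0), (2 : ℝ) • (((0 : Bdry d), (1 : ℝ)) : Amb d))
      = 2 * ψ ((x, 0), ((0 : Bdry d), 1)) :=
    hψ.homogeneous _ ⟨hx, by simp⟩ _ (by simp) 2 two_pos
  have h3 : (2 : ℝ) • (((0 : Bdry d), (1 : ℝ)) : Amb d) = (0, 2) := by simp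
  rw [h3, h1 2 two_ne_zero, h1 1 one_ne_zero] at h2
  rw [h1 s hs]
  linarith

/-- At a conormal covector the phase moves in the normal direction: its differential in `x` is the
covector component of `χ`, which does not vanish, while its tangential part does. -/
theorem IsPhaseOf.fderiv_nor_ne_zero (hψ : IsPhaseOf U χ Ωb ψ) (hΩ : IsOpen Ωb)
    (hχ : IsBoundarySymplecto U χ) {x : Bdry d} (hx : x ∈ Ωb) {s : ℝ} (hs : s ≠ 0) :
    fderiv ℝ ψ ((x, 0), (0, s)) Dir.nor.vec ≠ 0 := by
  have hc : ((x, 0) : Amb d) ∈ collar Ωb := ⟨hx, by simp⟩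
  have hξ : ((0, s) : Amb d) ≠ 0 := by simp [hs]
  obtain ⟨y, ζ, -, hζ, hU, hy⟩ := hψ.generates (x, 0) hc (0, s) hξ
  have hζ0 : ζ ≠ 0 := by
    have := hχ.target_ne _ hU
    rwa [hy] at this
  have hζ1 : ζ.1 = 0 := by
    have h5 : pair ζ (ζ.1, 0) = 0 := by
      rw [← hζ, ← hψ.fderiv_base hΩ hc hξ]
      refine fderiv_eq_zero_of_const_on_line (hψ.differentiableAt hΩ hc hξ) (c := 0) ?_
      filter_upwards [eventually_add_smul_mem hΩ hx ζ.1] with h hh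
      simpa using hψ.conormal_eq_zero hΩ hχ hh hs
    simpa [pair] using h5
  have h1 : fderiv ℝ ψ ((x, 0), (0, s)) Dir.nor.vec = ζ.2 := by
    rw [Dir.vec, hψ.fderiv_base hΩ hc hξ, hζ]
    simp [pair]
  rw [h1]
  exact fun h => hζ0 (Prod.ext hζ1 h)

/-- The mixed normal derivative of the phase does not vanish at the boundary: `y = ∇_ξ ψ(x, ξ)` is a
local diffeomorphism in `x`, since `χ(y, ξ) = (x, ·)`, and `y_n = 0` along the boundary. -/
theorem IsPhaseOf.fderiv_nor_conor_ne_zero (hψ : IsPhaseOf U χ Ωb ψ) (hΩ : IsOpen Ωb)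
    (hχ : IsBoundarySymplecto U χ) {x : Bdry d} (hx : x ∈ Ωb) {ξ : Amb d} (hξ : ξ ≠ 0) :
    fderiv ℝ (fun z => fderiv ℝ ψ z Dir.conor.vec) ((x, 0), ξ) Dir.nor.vec ≠ 0 := by
  intro hzero
  have hc : ((x, 0) : Amb d) ∈ collar Ωb := ⟨hx, by simp⟩
  have hX := isOpen_collar hΩ
  have hO := isOpen_punctured hX
  -- `y = Y x`, written in terms of the partial derivatives of the phase
  let Y : Amb d → Amb d := fun x =>
    (∑ i, fderiv ℝ ψ (x, ξ) (Dir.cotan i).vec • EuclideanSpace.single i (1 : ℝ),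
      fderiv ℝ ψ (x, ξ) Dir.conor.vec)
  have hsm : ∀ v, ContDiffOn ℝ ∞ (fun z => fderiv ℝ ψ z v) (punctured (collar Ωb)) := fun v =>
    (hψ.smooth.fderiv_of_isOpen hO le_rfl).clm_apply contDiffOn_const
  have hsl : ∀ v, DifferentiableAt ℝ (fun z : Amb d => fderiv ℝ ψ (z, ξ) v) (x, 0) := fun v =>
    DifferentiableAt.comp (g := fun z => fderiv ℝ ψ z v) (f := fun z : Amb d => (z, ξ)) (x, 0)
      (differentiableAt_of_contDiffOn hO (hsm v) (z := ((x, 0), ξ)) ⟨hc, hξ⟩)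
      (by fun_prop : DifferentiableAt ℝ (fun z : Amb d => (z, ξ)) (x, 0))
  have hYd : DifferentiableAt ℝ Y (x, 0) := by
    refine DifferentiableAt.prodMk ?_ (hsl _)
    exact DifferentiableAt.fun_sum fun i _ => (hsl _).smul_const _
  have hYy : ∀ x ∈ collar Ωb, ∀ y : Amb d,
      (∀ v, fderiv ℝ (fun θ => ψ (x, θ)) ξ v = pair y v) → Y x = y := by
    intro x hx y hy
    have h1 : ∀ v, fderiv ℝ ψ (x, ξ) (0, v) = pair y v := fun v => by
      rw [hψ.fderiv_fibre hΩ hx hξ, hy]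
    refine Prod.ext ?_ ?_
    · ext j
      simp [Y, Dir.vec, h1, pair, EuclideanSpace.inner_single_right, Pi.single_apply]
    · simp [Y, Dir.vec, h1, pair]
  have hχY : ∀ x ∈ collar Ωb, (Y x, ξ) ∈ U ∧ (χ (Y x, ξ)).1 = x := by
    intro x hx
    obtain ⟨y, ζ, h1, -, h2, h3⟩ := hψ.generates x hx ξ hξ
    rw [hYy x hx y h1, h3]
    exact ⟨h2, rfl⟩
  -- hence the differential of `Y` is injective
  have hinj : Function.Injective (fderiv ℝ Y (x, 0)) := by
    have hχd : DifferentiableAt ℝ χ (Y (x, 0), ξ) :=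
      differentiableAt_of_contDiffOn hχ.isOpen hχ.smooth (hχY _ hc).1
    have h1 : HasFDerivAt (fun z : Amb d => (Y z, ξ))
        ((fderiv ℝ Y (x, 0)).prod (0 : Amb d →L[ℝ] Amb d)) (x, 0) :=
      hYd.hasFDerivAt.prodMk (hasFDerivAt_const ξ _)
    have h2 : HasFDerivAt (fun z : Amb d => (χ (Y z, ξ)).1) _ (x, 0) :=
      (hχd.hasFDerivAt.comp (x, 0) h1).fst
    have h3 : HasFDerivAt (fun z : Amb d => (χ (Y z, ξ)).1) (ContinuousLinearMap.id ℝ (Amb d))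
        (x, 0) := by
      refine (hasFDerivAt_id _).congr_of_eventuallyEq ?_
      filter_upwards [hX.mem_nhds hc] with z hz
      exact (hχY z hz).2
    have h4 := h2.unique h3
    refine (injective_iff_map_eq_zero _).2 fun v hv => ?_
    have h5 := DFunLike.congr_fun h4 v
    rw [ContinuousLinearMap.id_apply] at h5
    rw [← h5]
    change (fderiv ℝ χ (Y (x, 0), ξ) (fderiv ℝ Y (x, 0) v, 0)).1 = 0
    rw [hv, Prod.mk_zero_zero, map_zero]
    rfl
  have hsurj : Function.Surjective (fderiv ℝ Y (x, 0)) :=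
    (LinearMap.injective_iff_surjective (f := (fderiv ℝ Y (x, 0)).toLinearMap)).1 hinj
  -- but its normal component vanishes
  have hsnd : ∀ v, (fderiv ℝ Y (x, 0) v).2
      = fderiv ℝ (fun z : Amb d => fderiv ℝ ψ (z, ξ) Dir.conor.vec) (x, 0) v := by
    intro v
    have h1 := hYd.hasFDerivAt.snd
    have h2 : fderiv ℝ (fun z : Amb d => fderiv ℝ ψ (z, ξ) Dir.conor.vec) (x, 0) = _ := h1.fderiv
    rw [h2]
    rfl
  have htan : ∀ v : Bdry d, (fderiv ℝ Y (x, 0) (v, 0)).2 = 0 := by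
    intro v
    rw [hsnd]
    refine fderiv_eq_zero_of_const_on_line (hsl _) (c := 0) ?_
    filter_upwards [eventually_add_smul_mem hΩ hx v] with h hh
    have h5 := hψ.fderiv_fibre hΩ (x := (x + h • v, 0)) ⟨hh, by simp⟩ hξ (0, 1)
    rw [IsPhaseOf.fderiv_normal hχ hψ hh hξ] at h5
    simpa [Dir.vec] using h5
  have hnor : (fderiv ℝ Y (x, 0) (0, 1)).2 = 0 := by
    rw [hsnd]
    refine Eq.trans ?_ hzero
    exact fderiv_partial_left (f := fun z => fderiv ℝ ψ z Dir.conor.vec)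
      (differentiableAt_of_contDiffOn hO (hsm Dir.conor.vec) ⟨hc, hξ⟩) (0, 1)
  obtain ⟨v, hv⟩ := hsurj (0, 1)
  have h1 : v = (v.1, 0) + v.2 • ((0, 1) : Amb d) := by ext1 <;> simp
  have h2 : (fderiv ℝ Y (x, 0) v).2 = 0 := by
    rw [h1, map_add, map_smul]
    simp [htan, hnor]
  rw [hv] at h2
  simp at h2

theorem contDiffOn_psiBdry (hψ : IsPhaseOf U χ Ωb ψ) :
    ContDiffOn ℝ ∞ (fun z : Amb d × Amb d => psiBdry ψ z.1.1 z.2.1) (punctured (collar Ωb)) := by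
  refine hψ.smooth.comp (f := fun z : Amb d × Amb d => ((z.1.1, 0), (z.2.1, 1))) ?_ ?_
  · exact ContDiff.contDiffOn (by fun_prop)
  · intro z hz
    exact ⟨⟨hz.1.1, by simp⟩, fun h => one_ne_zero (congrArg Prod.snd h)⟩

theorem contDiffOn_redPhase (hψ : IsPhaseOf U χ Ωb ψ) :
    ContDiffOn ℝ ∞ (redPhase ψ) (punctured (collar Ωb)) :=
  hψ.smooth.sub (contDiffOn_psiBdry hψ)

/-- The reduced phase and the phase have the same normal derivatives. -/
theorem fderiv_redPhase (hψ : IsPhaseOf U χ Ωb ψ) (hΩ : IsOpen Ωb) {z : Amb d × Amb d}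
    (hz : z ∈ punctured (collar Ωb)) {v : Amb d × Amb d}
    (h1 : v.1.1 = 0) (h2 : v.2.1 = 0) : fderiv ℝ (redPhase ψ) z v = fderiv ℝ ψ z v := by
  have hO := isOpen_punctured (isOpen_collar hΩ)
  have hb := differentiableAt_of_contDiffOn hO (contDiffOn_psiBdry hψ) hz
  have hp := differentiableAt_of_contDiffOn hO hψ.smooth hz
  have h3 : fderiv ℝ (redPhase ψ) z = _ := (hp.hasFDerivAt.sub hb.hasFDerivAt).fderiv
  have h5 : fderiv ℝ (fun z : Amb d × Amb d => psiBdry ψ z.1.1 z.2.1) z v = 0 :=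
    fderiv_eq_zero_of_const_on_line hb (c := psiBdry ψ z.1.1 z.2.1)
      (Eventually.of_forall fun θ => by simp [h1, h2])
  rw [h3, sub_apply, h5, sub_zero]

theorem isHom_redPhase (hψ : IsPhaseOf U χ Ωb ψ) (hΩ : IsOpen Ωb)
    (hχ : IsBoundarySymplecto U χ) :
    IsHom (collar Ωb) 1 (fun z => ((redPhase ψ z : ℝ) : ℂ)) := by
  refine ⟨Complex.ofRealCLM.contDiff.comp_contDiffOn (contDiffOn_redPhase hψ),
    fun x hx ξ hξ c hc => ?_⟩
  have hc0 : ((x.1, 0) : Amb d) ∈ collar Ωb := ⟨hx.1, by simp⟩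
  have h1 : ∀ ξ : Amb d, ξ ≠ 0 → psiBdry ψ x.1 ξ.1 = ψ ((x.1, 0), ξ) := fun ξ hξ =>
    (psiBdry_eq hΩ hχ hψ hx.1 (ξ := ξ.1) (s := ξ.2) hξ).symm
  have h2 := h1 (c • ξ) (smul_ne_zero hc.ne' hξ)
  simp only [redPhase]
  rw [h2, h1 ξ hξ, hψ.homogeneous x hx ξ hξ c hc, hψ.homogeneous _ hc0 ξ hξ c hc, Real.rpow_one]
  push_cast
  ring

theorem redPhase_eq_zero (hψ : IsPhaseOf U χ Ωb ψ) (hΩ : IsOpen Ωb)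
    (hχ : IsBoundarySymplecto U χ) {z : Amb d × Amb d} (hz : z ∈ punctured (collar Ωb))
    (h0 : z.1.2 = 0) :
    redPhase ψ z = 0 := by
  obtain ⟨⟨x, t⟩, ⟨ξ, s⟩⟩ := z
  simp only at h0
  subst h0
  rw [redPhase, psiBdry_eq hΩ hχ hψ hz.1.1 hz.2, sub_self]

end

theorem IsHom.exists_pos_le_norm {X : Set (Amb d)} {r : ℝ} {f : Amb d × Amb d → ℂ}
    (hf : IsHom X r f) {L : Set (Amb d)} (hL : IsCompact L) (hLX : L ⊆ X)
    (h0 : ∀ x ∈ L, ∀ ξ ∈ Metric.sphere (0 : Amb d) 1, f (x, ξ) ≠ 0) :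
    ∃ c : ℝ, 0 < c ∧ ∀ x ∈ L, ∀ ξ : Amb d, ξ ≠ 0 → c * ‖ξ‖ ^ r ≤ ‖f (x, ξ)‖ := by
  have hsub : L ×ˢ Metric.sphere (0 : Amb d) 1 ⊆ punctured X := by
    rintro ⟨x, ξ⟩ ⟨hx, hξ⟩
    exact ⟨hLX hx, ne_zero_of_mem_sphere_one hξ⟩
  obtain ⟨c, hc, h⟩ := (hL.prod isCompact_unit_sphere).exists_forall_le'
    (hf.1.continuousOn.mono hsub).norm (a := 0) fun z hz => norm_pos_iff.2 (h0 z.1 hz.1 z.2 hz.2)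
  refine ⟨c, hc, fun x hx ξ hξ => ?_⟩
  have h1 : c ≤ ‖f (x, ‖ξ‖⁻¹ • ξ)‖ := h _ (Set.mk_mem_prod hx (inv_norm_smul_mem_sphere hξ))
  have h2 : 0 ≤ ‖ξ‖ ^ r := Real.rpow_nonneg (norm_nonneg ξ) r
  rw [hf.eq_norm_rpow_mul (hLX hx) hξ, norm_mul, Complex.norm_real, Real.norm_of_nonneg h2, mul_comm]
  exact mul_le_mul_of_nonneg_left h1 h2

/-- The set on which the constructions work: there the normal derivative of the phase does not
vanish at conormal covectors, and its mixed normal derivative does not vanish on the segment that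
connects the point with the boundary. -/
def goodSet (Ωb : Set (Bdry d)) (ψ : Amb d × Amb d → ℝ) : Set (Amb d) :=
  {x | x ∈ collar Ωb ∧
    (∀ p ∈ Icc (0 : ℝ) 1 ×ˢ Metric.sphere (0 : Amb d) 1,
      pd .nor (pd .conor fun z => ((ψ z : ℝ) : ℂ)) ((x.1, p.1 * x.2), p.2) ≠ 0) ∧
    (∀ s ∈ ({1, -1} : Set ℝ), pd .nor (fun z => ((ψ z : ℝ) : ℂ)) (x, ((0 : Bdry d), s)) ≠ 0)}

section

variable {U : Set (Amb d × Amb d)} {χ : Amb d × Amb d → Amb d × Amb d} {Ωb : Set (Bdry d)}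
  {ψ : Amb d × Amb d → ℝ}

theorem isOpen_goodSet (hψ : IsPhaseOf U χ Ωb ψ) (hΩ : IsOpen Ωb) : IsOpen (goodSet Ωb ψ) := by
  have hX := isOpen_collar hΩ
  have hO := isOpen_punctured hX
  have h1 := hψ.isHom.pd hX .nor
  have h2 := (hψ.isHom.pd hX .conor).pd hX .nor
  have hc : ∀ {f : Amb d × Amb d → ℂ} {r : ℝ}, IsHom (collar Ωb) r f →
      ∀ z ∈ punctured (collar Ωb), ContinuousAt f z := fun hf z hz =>
    hf.1.continuousOn.continuousAt (hO.mem_nhds hz)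
  rw [isOpen_iff_mem_nhds]
  rintro x ⟨hx, ha, hb⟩
  refine inter_mem (hX.mem_nhds hx) (inter_mem ?_ ?_)
  · refine (isCompact_Icc.prod isCompact_unit_sphere).eventually_forall_of_forall_eventually
      fun p hp => ?_
    have hmem : (((x.1, p.1 * x.2), p.2) : Amb d × Amb d) ∈ punctured (collar Ωb) :=
      ⟨collar_star hx hp.1, ne_zero_of_mem_sphere_one hp.2⟩
    have hg : ContinuousAt (fun q : Amb d × ℝ × Amb d =>
        pd .nor (pd .conor fun z => ((ψ z : ℝ) : ℂ)) ((q.1.1, q.2.1 * q.1.2), q.2.2)) (x, p) :=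
      ContinuousAt.comp (f := fun q : Amb d × ℝ × Amb d => ((q.1.1, q.2.1 * q.1.2), q.2.2))
        (hc h2 _ hmem) (by fun_prop)
    exact hg.eventually_ne (ha p hp)
  · refine ((Set.toFinite ({1, -1} : Set ℝ)).isCompact).eventually_forall_of_forall_eventually
      fun s hs => ?_
    have hs0 : s ≠ 0 := by rcases hs with rfl | rfl <;> norm_num
    have hmem : ((x, (0, s)) : Amb d × Amb d) ∈ punctured (collar Ωb) := ⟨hx, by simp [hs0]⟩
    have hg : ContinuousAt (fun q : Amb d × ℝ =>
        pd .nor (fun z => ((ψ z : ℝ) : ℂ)) (q.1, ((0 : Bdry d), q.2))) (x, s) :=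
      ContinuousAt.comp (f := fun q : Amb d × ℝ => (q.1, ((0 : Bdry d), q.2)))
        (hc h1 _ hmem) (by fun_prop)
    exact hg.eventually_ne (hb s hs)

theorem pd_phase_eq (hψ : IsPhaseOf U χ Ωb ψ) (hΩ : IsOpen Ωb) {z : Amb d × Amb d}
    (hz : z ∈ punctured (collar Ωb)) (e : Dir d) :
    pd e (fun z => ((ψ z : ℝ) : ℂ)) z = ((fderiv ℝ ψ z e.vec : ℝ) : ℂ) :=
  pd_ofReal (hψ.differentiableAt hΩ hz.1 hz.2) e

theorem pd_nor_conor_eq (hψ : IsPhaseOf U χ Ωb ψ) (hΩ : IsOpen Ωb) {z : Amb d × Amb d}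
    (hz : z ∈ punctured (collar Ωb)) :
    pd .nor (pd .conor fun z => ((ψ z : ℝ) : ℂ)) z
      = ((fderiv ℝ (fun z => fderiv ℝ ψ z Dir.conor.vec) z Dir.nor.vec : ℝ) : ℂ) := by
  have hO := isOpen_punctured (isOpen_collar hΩ)
  have hs : ContDiffOn ℝ ∞ (fun z => fderiv ℝ ψ z Dir.conor.vec) (punctured (collar Ωb)) :=
    (hψ.smooth.fderiv_of_isOpen hO le_rfl).clm_apply contDiffOn_const
  rw [← pd_ofReal (differentiableAt_of_contDiffOn hO hs hz)]
  refine pd_congr ?_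
  filter_upwards [hO.mem_nhds hz] with w hw
  exact pd_phase_eq hψ hΩ hw _

theorem mem_goodSet_of_bdry (hψ : IsPhaseOf U χ Ωb ψ) (hΩ : IsOpen Ωb)
    (hχ : IsBoundarySymplecto U χ) {x : Bdry d} (hx : x ∈ Ωb) :
    ((x, 0) : Amb d) ∈ goodSet Ωb ψ := by
  have hc : ((x, 0) : Amb d) ∈ collar Ωb := ⟨hx, by simp⟩
  refine ⟨hc, fun p hp => ?_, fun s hs => ?_⟩
  · have hp2 := ne_zero_of_mem_sphere_one hp.2
    have hmem : (((x, 0), p.2) : Amb d × Amb d) ∈ punctured (collar Ωb) := ⟨hc, hp2⟩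
    simp only [mul_zero]
    rw [pd_nor_conor_eq hψ hΩ hmem]
    exact_mod_cast hψ.fderiv_nor_conor_ne_zero hΩ hχ hx hp2
  · have hs0 : s ≠ 0 := by rcases hs with rfl | rfl <;> norm_num
    rw [pd_phase_eq hψ hΩ ⟨hc, by simp [hs0]⟩]
    exact_mod_cast hψ.fderiv_nor_ne_zero hΩ hχ hx hs0

/-- `|∂_{ξ_n} ψ| ≥ c |x_n|`, by the mean value theorem on the segment to the boundary. -/
theorem exists_conor_bound (hψ : IsPhaseOf U χ Ωb ψ) (hΩ : IsOpen Ωb)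
    (hχ : IsBoundarySymplecto U χ) {L : Set (Amb d)} (hL : IsCompact L) (hLN : L ⊆ goodSet Ωb ψ) :
    ∃ c : ℝ, 0 < c ∧ ∀ x ∈ L, ∀ ξ : Amb d, ξ ≠ 0 →
      c * |x.2| ≤ |fderiv ℝ ψ (x, ξ) Dir.conor.vec| := by
  have hX := isOpen_collar hΩ
  have hO := isOpen_punctured hX
  let Φ : Amb d × ℝ → Amb d := fun p => (p.1.1, p.2 * p.1.2)
  have hL' : IsCompact (Φ '' (L ×ˢ Icc (0 : ℝ) 1)) :=
    (hL.prod isCompact_Icc).image (by fun_prop)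
  have hLX' : Φ '' (L ×ˢ Icc (0 : ℝ) 1) ⊆ collar Ωb := by
    rintro _ ⟨p, hp, rfl⟩
    exact collar_star (hLN hp.1).1 hp.2
  obtain ⟨c, hc, h⟩ := ((hψ.isHom.pd hX .conor).pd hX .nor).exists_pos_le_norm hL' hLX' (by
    rintro _ ⟨p, hp, rfl⟩ ξ hξ
    exact (hLN hp.1).2.1 (p.2, ξ) ⟨hp.2, hξ⟩)
  refine ⟨c, hc, fun x hx ξ hξ => ?_⟩
  let u : ℝ → ℝ := fun θ => fderiv ℝ ψ ((x.1, θ * x.2), ξ) Dir.conor.vec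
  let u' : ℝ → ℝ := fun θ => x.2 *
    fderiv ℝ (fun z => fderiv ℝ ψ z Dir.conor.vec) ((x.1, θ * x.2), ξ) Dir.nor.vec
  have hs : ContDiffOn ℝ ∞ (fun z => fderiv ℝ ψ z Dir.conor.vec) (punctured (collar Ωb)) :=
    (hψ.smooth.fderiv_of_isOpen hO le_rfl).clm_apply contDiffOn_const
  have hmem : ∀ θ ∈ Icc (0 : ℝ) 1, (((x.1, θ * x.2), ξ) : Amb d × Amb d) ∈ punctured (collar Ωb) :=
    fun θ hθ => ⟨collar_star (hLN hx).1 hθ, hξ⟩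
  have hder : ∀ θ ∈ Icc (0 : ℝ) 1, HasDerivAt u (u' θ) θ := by
    intro θ hθ
    have e1 : HasDerivAt (fun θ : ℝ => (((x.1, θ * x.2), ξ) : Amb d × Amb d))
        (x.2 • Dir.nor.vec) θ := by
      have e1 : HasDerivAt (fun θ : ℝ => θ * x.2) x.2 θ := by
        simpa using (hasDerivAt_id θ).mul_const x.2
      have e2 := ((hasDerivAt_const θ x.1).prodMk e1).prodMk (hasDerivAt_const θ ξ)
      convert e2 using 1
      simp [Dir.vec]
    have e2 := (differentiableAt_of_contDiffOn hO hs (hmem θ hθ)).hasFDerivAt.comp_hasDerivAt θ e1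
    rw [map_smul, smul_eq_mul] at e2
    exact e2
  obtain ⟨θ, hθ, hθ'⟩ := exists_hasDerivAt_eq_slope u u' one_pos
    (fun θ hθ => (hder θ hθ).continuousAt.continuousWithinAt)
    (fun θ hθ => hder θ (Ioo_subset_Icc_self hθ))
  have h0 : u 0 = 0 := by
    have h1 : u 0 = fderiv ℝ ψ ((x.1, 0), ξ) (0, (0, 1)) := by simp [u, Dir.vec]
    have hx0 : ((x.1, 0) : Amb d) ∈ collar Ωb := ⟨(hLN hx).1.1, by simp⟩
    rw [h1, hψ.fderiv_fibre hΩ hx0 hξ,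
      IsPhaseOf.fderiv_normal hχ hψ (hLN hx).1.1 hξ]
  have h1 : u 1 = u' θ := by rw [hθ', h0]; simp
  have h2 : u 1 = fderiv ℝ ψ (x, ξ) Dir.conor.vec := by simp [u]
  have hθI := Ioo_subset_Icc_self hθ
  have h3 := h (x.1, θ * x.2) ⟨(x, θ), ⟨hx, hθI⟩, rfl⟩ ξ hξ
  rw [pd_nor_conor_eq hψ hΩ (hmem θ hθI), Complex.norm_real, Real.norm_eq_abs,
    show (1 : ℝ) + Dir.conor.deg + Dir.nor.deg = 0 by simp [Dir.deg], Real.rpow_zero, mul_one] at h3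
  rw [← h2, h1, abs_mul, mul_comm]
  gcongr

theorem exists_nor_bound (hψ : IsPhaseOf U χ Ωb ψ) (hΩ : IsOpen Ωb)
    {L : Set (Amb d)} (hL : IsCompact L) (hLN : L ⊆ goodSet Ωb ψ) :
    ∃ c : ℝ, 0 < c ∧ ∀ x ∈ L, ∀ ξ : Amb d, ξ ≠ 0 →
      c * ‖ξ‖ ^ 2 ≤ ‖ξ.1‖ ^ 2 + (fderiv ℝ ψ (x, ξ) Dir.nor.vec) ^ 2 := by
  have hX := isOpen_collar hΩ
  have hg := hψ.isHom.pd hX .nor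
  set g := pd .nor fun z => ((ψ z : ℝ) : ℂ)
  have hsub : L ×ˢ Metric.sphere (0 : Amb d) 1 ⊆ punctured (collar Ωb) := by
    rintro ⟨x, ξ⟩ ⟨hx, hξ⟩
    exact ⟨(hLN hx).1, ne_zero_of_mem_sphere_one hξ⟩
  have hcont : ContinuousOn (fun z : Amb d × Amb d => ‖z.2.1‖ ^ 2 + ‖g z‖ ^ 2)
      (L ×ˢ Metric.sphere (0 : Amb d) 1) :=
    (by fun_prop : Continuous fun z : Amb d × Amb d => ‖z.2.1‖ ^ 2).continuousOn.add
      ((hg.1.continuousOn.mono hsub).norm.pow 2)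
  obtain ⟨c, hc, h⟩ := (hL.prod isCompact_unit_sphere).exists_forall_le' hcont (a := 0) (by
    rintro ⟨x, ⟨ξ, s⟩⟩ ⟨hx, hξ⟩
    by_cases h0 : ξ = 0
    · have hs : s ∈ ({1, -1} : Set ℝ) := by
        have : ‖((ξ, s) : Amb d)‖ = 1 := by simpa using hξ
        rw [h0, Prod.norm_mk, norm_zero, max_eq_right (norm_nonneg _), Real.norm_eq_abs] at this
        exact eq_or_eq_neg_of_abs_eq this
      have h1 := (hLN hx).2.2 s hs
      have h2 : 0 < ‖g (x, (0, s))‖ := norm_pos_iff.2 h1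
      simp only [h0]
      positivity
    · have : 0 < ‖ξ‖ := norm_pos_iff.2 h0
      simp only
      positivity)
  refine ⟨c, hc, fun x hx ξ hξ => ?_⟩
  have h1 := h (x, ‖ξ‖⁻¹ • ξ) (Set.mk_mem_prod hx (inv_norm_smul_mem_sphere hξ))
  have hn := norm_pos_iff.2 hξ
  have h2 : ‖g (x, ξ)‖ = ‖ξ‖ * ‖g (x, ‖ξ‖⁻¹ • ξ)‖ := by
    rw [hg.eq_norm_rpow_mul (hLN hx).1 hξ, norm_mul, Complex.norm_real]
    simp [Dir.deg]
  have h3 : ‖g (x, ξ)‖ = |fderiv ℝ ψ (x, ξ) Dir.nor.vec| := by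
    have hmem : ((x, ξ) : Amb d × Amb d) ∈ punctured (collar Ωb) := ⟨(hLN hx).1, hξ⟩
    rw [show g (x, ξ) = _ from pd_phase_eq hψ hΩ hmem .nor, Complex.norm_real, Real.norm_eq_abs]
  rw [← sq_abs (fderiv ℝ ψ (x, ξ) Dir.nor.vec), ← h3, h2]
  simp only [Prod.smul_fst, norm_smul, norm_inv, norm_norm] at h1
  calc c * ‖ξ‖ ^ 2 ≤ ((‖ξ‖⁻¹ * ‖ξ.1‖) ^ 2 + ‖g (x, ‖ξ‖⁻¹ • ξ)‖ ^ 2) * ‖ξ‖ ^ 2 := by gcongr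
    _ = _ := by field_simp

theorem isNormalPhase_redPhase (hψ : IsPhaseOf U χ Ωb ψ) (hΩ : IsOpen Ωb)
    (hχ : IsBoundarySymplecto U χ) {S : Set (Amb d × Amb d)}
    (hS : ConicSupport (goodSet Ωb ψ) S) : IsNormalPhase (collar Ωb) S (redPhase ψ) := by
  have hX := isOpen_collar hΩ
  have hSX : ConicSupport (collar Ωb) S := hS.mono fun x hx => hx.1
  have hO := isOpen_punctured hX
  have hstar : ∀ x ∈ collar Ωb, ∀ θ ∈ Icc (0 : ℝ) 1, ((x.1, θ * x.2) : Amb d) ∈ collar Ωb :=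
    fun x hx θ hθ => collar_star hx hθ
  have hhom := isHom_redPhase hψ hΩ hχ
  have hpd : ∀ (e : Dir d), ∀ z ∈ punctured (collar Ωb),
      pd e (fun z => ((redPhase ψ z : ℝ) : ℂ)) z = ((fderiv ℝ (redPhase ψ) z e.vec : ℝ) : ℂ) :=
    fun e z hz => pd_ofReal (differentiableAt_of_contDiffOn hO (contDiffOn_redPhase hψ) hz) e
  refine ⟨?_, contDiffOn_redPhase hψ, ?_, ?_, fun K hK => ?_, fun K hK => ?_⟩
  · have := (isHom_redPhase hψ hΩ hχ).isAmp_of_vanish hX hstar hSX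
      fun z hz h0 => by rw [redPhase_eq_zero hψ hΩ hχ hz h0, Complex.ofReal_zero]
    exact this.of_eq (by simp) rfl rfl
  · refine ((hhom.pd hX .conor).isAmp_of_vanish hX hstar hSX ?_).of_eq
      (by simp [Dir.deg]) rfl (by simp [Dir.deg])
    rintro ⟨⟨x, t⟩, ξ⟩ hz h0
    simp only at h0
    subst h0
    rw [hpd _ _ hz, fderiv_redPhase hψ hΩ hz rfl rfl]
    have h1 := hψ.fderiv_fibre hΩ hz.1 hz.2 ((0, 1) : Amb d)
    rw [IsPhaseOf.fderiv_normal hχ hψ hz.1.1 hz.2] at h1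
    exact_mod_cast h1
  · exact ((hhom.pd hX .nor).isAmp hX hSX).of_eq (by simp [Dir.deg]) rfl (by simp [Dir.deg])
  · obtain ⟨L, hL, hLN, ε, -, hSL⟩ := hS K hK
    obtain ⟨c, hc, h⟩ := exists_conor_bound hψ hΩ hχ hL hLN
    refine ⟨c ^ 2, by positivity, fun z hz hzK => ?_⟩
    have hzO := hSX.subset hz
    have h1 := h z.1 (hSL z hz hzK).1 z.2 hzO.2
    rw [fderiv_redPhase hψ hΩ hzO rfl rfl, mul_pow, mul_pow,
      ← sq_abs (fderiv ℝ ψ z Dir.conor.vec)]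
    have h2 : (c * |z.1.2|) ^ 2 ≤ |fderiv ℝ ψ z Dir.conor.vec| ^ 2 := by gcongr
    have h3 := sq_nonneg (jb z.2.1)
    nlinarith
  · obtain ⟨L, hL, hLN, ε, -, hSL⟩ := hS K hK
    obtain ⟨c, hc, h⟩ := exists_nor_bound hψ hΩ hL hLN
    refine ⟨c, hc, fun z hz hzK => ?_⟩
    have hzO := hSX.subset hz
    have h1 := h z.1 (hSL z hz hzK).1 z.2 hzO.2
    have hj := jb_pos z.2.1
    have h2 : ‖z.2.1‖ ^ 2 ≤ jb z.2.1 ^ 2 := by gcongr; exact norm_le_jb _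
    have h3 : |z.2.2| ^ 2 ≤ ‖z.2‖ ^ 2 := by gcongr; exact norm_snd_le z.2
    rw [fderiv_redPhase hψ hΩ hzO rfl rfl]
    have h4 : c * |z.2.2| ^ 2 ≤ jb z.2.1 ^ 2 + (fderiv ℝ ψ z Dir.nor.vec) ^ 2 :=
      calc c * |z.2.2| ^ 2 ≤ c * ‖z.2‖ ^ 2 := by gcongr
        _ ≤ _ := by linarith
    calc c * (|z.2.2| / jb z.2.1) ^ 2 = c * |z.2.2| ^ 2 / jb z.2.1 ^ 2 := by ring
      _ ≤ (jb z.2.1 ^ 2 + (fderiv ℝ ψ z Dir.nor.vec) ^ 2) / jb z.2.1 ^ 2 := by gcongr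
      _ = _ := by field_simp

end

end Phase

/-! ### Oscillating kernels -/

section OscillatingKernels

variable {d : ℕ} {X : Set (Amb d)} {S : Set (Amb d × Amb d)} {φ : Amb d × Amb d → ℝ}
  {μ k j : ℝ}

/-- The kernels `e^{iφ} b` with an amplitude `b` that vanishes outside `S`. -/
def IsOscKernel (X : Set (Amb d)) (S : Set (Amb d × Amb d)) (φ : Amb d × Amb d → ℝ) (μ k j : ℝ)
    (G : Amb d × Amb d → ℂ) : Prop :=
  ∃ b : Amb d × Amb d → ℂ, IsAmp S (punctured X) μ k j b ∧ (∀ z, z ∉ S → b z = 0) ∧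
    G = fun z => Complex.exp (Complex.I * (φ z : ℂ)) * b z

theorem eventually_eq_zero_of_notMem (hS : IsClosed S) {b : Amb d × Amb d → ℂ}
    (hb : ∀ z, z ∉ S → b z = 0) {z : Amb d × Amb d} (hz : z ∉ S) : b =ᶠ[𝓝 z] fun _ => 0 := by
  filter_upwards [hS.isOpen_compl.mem_nhds hz] with w hw
  exact hb w hw

theorem pd_eq_zero_of_notMem (hS : IsClosed S) {b : Amb d × Amb d → ℂ}
    (hb : ∀ z, z ∉ S → b z = 0) {z : Amb d × Amb d} (hz : z ∉ S) (e : Dir d) : pd e b z = 0 := by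
  rw [pd_congr (eventually_eq_zero_of_notMem hS hb hz), pd_const]

theorem contDiffOn_osc (hφ : ContDiffOn ℝ ∞ φ (punctured X)) :
    ContDiffOn ℝ ∞ (fun z => Complex.exp (Complex.I * (φ z : ℂ))) (punctured X) :=
  (contDiffOn_const.mul (Complex.ofRealCLM.contDiff.comp_contDiffOn hφ)).cexp

theorem pd_osc_mul (hX : IsOpen X) (hφ : ContDiffOn ℝ ∞ φ (punctured X))
    {b : Amb d × Amb d → ℂ} (hb : ContDiffOn ℝ ∞ b (punctured X)) {z : Amb d × Amb d}
    (hz : z ∈ punctured X) (e : Dir d) :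
    pd e (fun z => Complex.exp (Complex.I * (φ z : ℂ)) * b z) z
      = Complex.exp (Complex.I * (φ z : ℂ)) *
        (pd e b z + Complex.I * pd e (fun z => ((φ z : ℝ) : ℂ)) z * b z) := by
  have hO := isOpen_punctured hX
  have h0 : DifferentiableAt ℝ (fun z => ((φ z : ℝ) : ℂ)) z :=
    differentiableAt_of_contDiffOn hO (Complex.ofRealCLM.contDiff.comp_contDiffOn hφ) hz
  have h1 : HasFDerivAt (fun z => Complex.exp (Complex.I * (φ z : ℂ)))
      (Complex.exp (Complex.I * (φ z : ℂ)) • Complex.I • fderiv ℝ (fun z => ((φ z : ℝ) : ℂ)) z) z :=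
    (h0.hasFDerivAt.const_mul Complex.I).cexp
  rw [pd_mul h1.differentiableAt (differentiableAt_of_contDiffOn hO hb hz)]
  have h2 : pd e (fun z => Complex.exp (Complex.I * (φ z : ℂ))) z
      = Complex.exp (Complex.I * (φ z : ℂ)) *
        (Complex.I * pd e (fun z => ((φ z : ℝ) : ℂ)) z) := by
    rw [pd, h1.fderiv]
    rfl
  rw [h2]
  ring

theorem IsOscKernel.contDiff (hX : IsOpen X) (hS : IsClosed S) (hSX : S ⊆ punctured X)
    (hφ : ContDiffOn ℝ ∞ φ (punctured X)) {G : Amb d × Amb d → ℂ}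
    (hG : IsOscKernel X S φ μ k j G) : ContDiff ℝ ∞ G := by
  obtain ⟨b, hb, hb0, rfl⟩ := hG
  refine contDiff_iff_contDiffAt.2 fun z => ?_
  by_cases hz : z ∈ S
  · exact ((contDiffOn_osc hφ).mul hb.1).contDiffAt ((isOpen_punctured hX).mem_nhds (hSX hz))
  · refine (contDiffAt_const (c := (0 : ℂ))).congr_of_eventuallyEq ?_
    filter_upwards [eventually_eq_zero_of_notMem hS hb0 hz] with w hw
    rw [hw, mul_zero]

theorem IsOscKernel.bound {G : Amb d × Amb d → ℂ} (hG : IsOscKernel X S φ μ k j G)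
    {K : Set (Bdry d)} (hK : IsCompact K) :
    ∃ C : ℝ, 0 ≤ C ∧ ∀ z : Amb d × Amb d, z.1.1 ∈ K → ‖G z‖ ≤ C * weight μ k j z := by
  obtain ⟨b, hb, hb0, rfl⟩ := hG
  obtain ⟨C, hC⟩ := hb.2 0 K hK
  refine ⟨|C|, abs_nonneg _, fun z hz => ?_⟩
  have hw := weight_pos μ k j z
  have he : ‖Complex.exp (Complex.I * (φ z : ℂ))‖ = 1 := by
    rw [mul_comm]; exact Complex.norm_exp_ofReal_mul_I _
  rw [norm_mul, he, one_mul]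
  by_cases hzS : z ∈ S
  · exact (hC z hzS hz).trans (mul_le_mul_of_nonneg_right (le_abs_self C) hw.le)
  · rw [hb0 z hzS, norm_zero]
    positivity

theorem IsOscKernel.mono {G : Amb d × Amb d → ℂ} {μ' k' j' : ℝ} (hG : IsOscKernel X S φ μ k j G)
    (hμ : μ ≤ μ') (hk : k ≤ k') (hj : j ≤ j') : IsOscKernel X S φ μ' k' j' G := by
  obtain ⟨b, hb, hb0, h⟩ := hG
  exact ⟨b, hb.mono hμ hk hj, hb0, h⟩

theorem IsOscKernel.pd (hX : IsOpen X) (hS : IsClosed S) (hSX : S ⊆ punctured X)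
    (hφ : IsNormalPhase X S φ) {G : Amb d × Amb d → ℂ} (hG : IsOscKernel X S φ μ k j G)
    (e : Dir d) : IsOscKernel X S φ (μ + e.wt) (k + 1) (j + 1) (pd e G) := by
  have hO := isOpen_punctured hX
  obtain ⟨b, hb, hb0, rfl⟩ := hG
  refine ⟨fun z => _root_.pd e b z
    + Complex.I * (_root_.pd e (fun z => ((φ z : ℝ) : ℂ)) z * b z), ?_, ?_, ?_⟩
  · refine IsAmp.add hO hSX ((hb.pd hO e).mono le_rfl (by linarith) (by linarith)) ?_
    exact (((hφ.isAmp.pd hO e).mul hO hSX hb).const_mul hO hSX _).of_eq (by ring) (by ring) (by ring)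
  · intro z hz
    simp only
    rw [hb0 z hz, pd_eq_zero_of_notMem hS hb0 hz]
    simp
  · funext z
    by_cases hz : z ∈ S
    · rw [pd_osc_mul hX hφ.smooth hb.1 (hSX hz)]
      ring
    · have h0 : ∀ z, z ∉ S → Complex.exp (Complex.I * (φ z : ℂ)) * b z = 0 := fun z hz => by
        rw [hb0 z hz, mul_zero]
      rw [pd_eq_zero_of_notMem hS h0 hz]
      simp only
      rw [hb0 z hz, pd_eq_zero_of_notMem hS hb0 hz]
      simp

/-- Integration by parts. With `R = ⟨ξ'⟩^{-wt e} ∂_e φ` one has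
`e^{iφ} = (1 + R²)⁻¹ (1 - i ⟨ξ'⟩^{-wt e} R ∂_e) e^{iφ}`; a factor `θ` of the growth of `R` is absorbed
by this identity. -/
theorem IsOscKernel.decay (hX : IsOpen X) (hS : IsClosed S) (hSX : S ⊆ punctured X)
    (hφ : IsNormalPhase X S φ) (e : Dir d) {ν k₀ j₀ : ℝ} (hk₀ : 0 ≤ k₀) (hj₀ : 0 ≤ j₀)
    {θ : Amb d × Amb d → ℂ} (hθ : IsAmp S (punctured X) ν k₀ j₀ θ)
    (hR : IsAmp S (punctured X) e.wt k₀ j₀ (_root_.pd e fun z => ((φ z : ℝ) : ℂ)))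
    (hell : ∀ K : Set (Bdry d), IsCompact K → ∃ C : ℝ, 0 ≤ C ∧ ∀ z ∈ S, z.1.1 ∈ K →
      (1 + (jb z.2.1 ^ (-e.wt) * fderiv ℝ φ z e.vec) ^ 2)⁻¹
        ≤ C * weight 0 (-(k₀ + k₀)) (-(j₀ + j₀)) z)
    {G : Amb d × Amb d → ℂ} (hG : IsOscKernel X S φ μ k j G) :
    ∃ G₁ G₂, IsOscKernel X S φ (μ + ν - e.wt) k j G₁ ∧ IsOscKernel X S φ (μ + ν) k j G₂ ∧
      ∀ z, θ z * G z = _root_.pd e G₁ z + G₂ z := by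
  have hO := isOpen_punctured hX
  obtain ⟨b, hb, hb0, rfl⟩ := hG
  have hρ := isAmp_jb_rpow hO hSX (-e.wt)
  have hRs : ∀ z ∈ punctured X, _root_.pd e (fun z => ((φ z : ℝ) : ℂ)) z
      = ((fderiv ℝ φ z e.vec : ℝ) : ℂ) := fun z hz =>
    pd_ofReal (differentiableAt_of_contDiffOn hO hφ.smooth hz) e
  set φe := _root_.pd e fun z => ((φ z : ℝ) : ℂ)
  let ρ : Amb d × Amb d → ℂ := fun z => ((jb z.2.1 ^ (-e.wt) : ℝ) : ℂ)
  let R : Amb d × Amb d → ℂ := fun z => ρ z * φe z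
  have hRamp : IsAmp S (punctured X) 0 k₀ j₀ R := (hρ.mul hO hSX hR).of_eq (by ring) (by ring)
    (by ring)
  let D : Amb d × Amb d → ℂ := fun z => 1 + R z * R z
  have hD : IsAmp S (punctured X) 0 (k₀ + k₀) (j₀ + j₀) D :=
    ((IsAmp.const 1).mono le_rfl (by linarith) (by linarith)).add hO hSX
      ((hRamp.mul hO hSX hRamp).of_eq (by ring) rfl rfl)
  have hDs : ∀ z ∈ punctured X,
      D z = ((1 + (jb z.2.1 ^ (-e.wt) * fderiv ℝ φ z e.vec) ^ 2 : ℝ) : ℂ) := by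
    intro z hz
    simp only [D, R, ρ]
    rw [hRs z hz]
    push_cast
    ring
  have hD0 : ∀ z ∈ punctured X, D z ≠ 0 := by
    intro z hz
    rw [hDs z hz]
    have : 0 < 1 + (jb z.2.1 ^ (-e.wt) * fderiv ℝ φ z e.vec) ^ 2 := by positivity
    exact_mod_cast this.ne'
  have hq : IsAmp S (punctured X) 0 (-(k₀ + k₀)) (-(j₀ + j₀)) (fun z => (D z)⁻¹) := by
    refine (hD.inv hO hSX hD0 ?_).of_eq (by ring) rfl rfl
    intro K hK
    obtain ⟨C, -, hC⟩ := hell K hK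
    refine ⟨C, fun z hz hzK => ?_⟩
    have := hC z hz hzK
    simp only
    rw [hDs z (hSX hz), ← Complex.ofReal_inv, Complex.norm_real, Real.norm_of_nonneg (by positivity),
      neg_zero]
    exact this
  let q : Amb d × Amb d → ℂ := fun z => (D z)⁻¹
  let c : Amb d × Amb d → ℂ := fun z => -Complex.I * (ρ z * (θ z * (q z * (R z * b z))))
  have hc : IsAmp S (punctured X) (μ + ν - e.wt) k j c :=
    ((hρ.mul hO hSX (hθ.mul hO hSX (hq.mul hO hSX (hRamp.mul hO hSX hb)))).const_mul hO hSX
      (-Complex.I)).of_eq (by ring) (by ring) (by ring)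
  have hc0 : ∀ z, z ∉ S → c z = 0 := fun z hz => by simp [c, hb0 z hz]
  have h2 : IsAmp S (punctured X) (μ + ν) k j (fun z => θ z * (q z * b z) + -1 * _root_.pd e c z) := by
    refine IsAmp.add hO hSX ?_ ?_
    · exact (hθ.mul hO hSX (hq.mul hO hSX hb)).mono (by linarith) (by linarith) (by linarith)
    · exact ((hc.pd hO e).const_mul hO hSX (-1)).of_eq (by ring) rfl rfl
  refine ⟨_, _, ⟨c, hc, hc0, rfl⟩, ⟨_, h2, fun z hz => ?_, rfl⟩, fun z => ?_⟩
  · rw [hb0 z hz, pd_eq_zero_of_notMem hS hc0 hz]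
    simp
  · by_cases hz : z ∈ S
    · rw [pd_osc_mul hX hφ.smooth hc.1 (hSX hz)]
      have hI : Complex.I * -Complex.I = 1 := by simp
      have h3 : Complex.I * φe z * c z = θ z * b z * (q z * (R z * R z)) := by
        simp only [c, R]
        linear_combination (φe z * (ρ z * (θ z * (q z * (ρ z * φe z * b z))))) * hI
      have h4 : q z * (1 + R z * R z) = 1 := inv_mul_cancel₀ (hD0 z (hSX hz))
      change _ = Complex.exp (Complex.I * (φ z : ℂ)) * (_ + Complex.I * φe z * c z) + _
      rw [h3]
      linear_combination -(Complex.exp (Complex.I * (φ z : ℂ)) * θ z * b z) * h4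
    · have h0 : ∀ z, z ∉ S → Complex.exp (Complex.I * (φ z : ℂ)) * c z = 0 := fun z hz => by
        rw [hc0 z hz, mul_zero]
      rw [pd_eq_zero_of_notMem hS h0 hz, pd_eq_zero_of_notMem hS hc0 hz]
      simp only
      rw [hb0 z hz]
      simp

theorem inv_one_add_sq_le {c u v : ℝ} (hc : 0 < c) (hu : 0 ≤ u) (h : c * u ^ 2 ≤ 1 + v ^ 2) :
    (1 + v ^ 2)⁻¹ ≤ (2 + 2 / c) * (1 + u) ^ (-(1 + 1) : ℝ) := by
  have h1 : 0 < 1 + v ^ 2 := by positivity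
  have h2 : (1 + u) ^ (-(1 + 1) : ℝ) = ((1 + u) ^ 2)⁻¹ := by
    rw [Real.rpow_neg (by positivity)]
    norm_num
  rw [h2, ← div_eq_mul_inv, inv_le_comm₀ h1 (by positivity), inv_div, div_le_iff₀ (by positivity)]
  have h3 : u ^ 2 ≤ (1 + v ^ 2) / c := by rw [le_div_iff₀ hc]; linarith
  calc (1 + u) ^ 2 ≤ 2 + 2 * u ^ 2 := by nlinarith [sq_nonneg (1 - u)]
    _ ≤ 2 * (1 + v ^ 2) + 2 * ((1 + v ^ 2) / c) := by nlinarith [sq_nonneg v]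
    _ = (1 + v ^ 2) * (2 + 2 / c) := by ring

/-- Multiplication by `x_n` is an integration by parts in `ξ_n`. -/
theorem IsOscKernel.decay_nor (hX : IsOpen X) (hS : IsClosed S) (hSX : S ⊆ punctured X)
    (hφ : IsNormalPhase X S φ) {G : Amb d × Amb d → ℂ} (hG : IsOscKernel X S φ μ k j G) :
    ∃ G₁ G₂, IsOscKernel X S φ μ k j G₁ ∧ IsOscKernel X S φ (μ - 1) k j G₂ ∧
      ∀ z, (z.1.2 : ℂ) * G z = _root_.pd .conor G₁ z + G₂ z := by
  obtain ⟨G₁, G₂, h1, h2, h3⟩ := hG.decay hX hS hSX hφ .conor zero_le_one le_rfl isAmp_nor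
    hφ.conor_isAmp (by
      intro K hK
      obtain ⟨c, hc, h⟩ := hφ.conor_bound K hK
      refine ⟨2 + 2 / c, by positivity, fun z hz hzK => ?_⟩
      have hj := jb_pos z.2.1
      refine (inv_one_add_sq_le hc (by positivity)
        (u := jb z.2.1 * |z.1.2|)
        (v := jb z.2.1 ^ (-Dir.conor.wt : ℝ) * fderiv ℝ φ z Dir.conor.vec) ?_).trans_eq ?_
      · have := h z hz hzK
        simpa [Dir.wt] using this
      · simp [weight])
  exact ⟨G₁, G₂, h1.mono (by simp [Dir.wt]) le_rfl le_rfl, h2.mono (by linarith) le_rfl le_rfl, h3⟩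

/-- Multiplication by `ξ_n` is an integration by parts in `x_n`. -/
theorem IsOscKernel.decay_conor (hX : IsOpen X) (hS : IsClosed S) (hSX : S ⊆ punctured X)
    (hφ : IsNormalPhase X S φ) {G : Amb d × Amb d → ℂ} (hG : IsOscKernel X S φ μ k j G) :
    ∃ G₁ G₂, IsOscKernel X S φ μ k j G₁ ∧ IsOscKernel X S φ (μ + 1) k j G₂ ∧
      ∀ z, (z.2.2 : ℂ) * G z = _root_.pd .nor G₁ z + G₂ z := by
  obtain ⟨G₁, G₂, h1, h2, h3⟩ := hG.decay hX hS hSX hφ .nor le_rfl zero_le_one isAmp_conor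
    hφ.nor_isAmp (by
      intro K hK
      obtain ⟨c, hc, h⟩ := hφ.nor_bound K hK
      refine ⟨2 + 2 / c, by positivity, fun z hz hzK => ?_⟩
      have hj := jb_pos z.2.1
      refine (inv_one_add_sq_le hc (by positivity)
        (u := |z.2.2| / jb z.2.1)
        (v := jb z.2.1 ^ (-Dir.nor.wt : ℝ) * fderiv ℝ φ z Dir.nor.vec) ?_).trans_eq ?_
      · have := h z hz hzK
        simpa [Dir.wt, Real.rpow_neg_one] using this
      · simp [weight])
  exact ⟨G₁, G₂, h1.mono (by simp [Dir.wt]) le_rfl le_rfl, h2, h3⟩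

end OscillatingKernels

/-! ### The two sides of a kernel -/

section Sides

variable {d : ℕ} {X : Set (Amb d)} {S : Set (Amb d × Amb d)} {φ : Amb d × Amb d → ℝ}

/-- The assumptions under which oscillating kernels with phase `φ` and amplitudes supported in `S`
are studied. -/
structure IsOscSetting (X : Set (Amb d)) (S : Set (Amb d × Amb d)) (φ : Amb d × Amb d → ℝ) :
    Prop where
  isOpen : IsOpen X
  isClosed : IsClosed S
  subset : S ⊆ punctured X
  phase : IsNormalPhase X S φ

/-- The direction of the outer variable. For fixed tangential variables a function on `ℝ^n × ℝ^n` is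
the kernel of two integral operators: `true` stands for the operator that integrates over `ξ_n` and
has `x_n` as outer variable, `false` for its transpose. -/
def outDir (d : ℕ) : Bool → Dir d
  | true => .nor
  | false => .conor

/-- The direction of the integration variable. -/
def innDir (d : ℕ) : Bool → Dir d
  | true => .conor
  | false => .nor

/-- The point of `ℝ^n × ℝ^n` with tangential part `z`, outer variable `t`, and integration
variable `s`. -/
def pt : Bool → Bdry d × Bdry d → ℝ → ℝ → Amb d × Amb d
  | true, z, t, s => ((z.1, t), (z.2, s))
  | false, z, t, s => ((z.1, s), (z.2, t))

/-- The outer variable as a function on `ℝ^n × ℝ^n`. -/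
def outCoord : Bool → Amb d × Amb d → ℝ
  | true, z => z.1.2
  | false, z => z.2.2

/-- Oscillating kernels of order `μ` that grow at most like the `k`-th power of the outer variable,
and with an unspecified power of the integration variable. -/
def IsSidedKernel (X : Set (Amb d)) (S : Set (Amb d × Amb d)) (φ : Amb d × Amb d → ℝ) (σ : Bool)
    (μ : ℝ) (k : ℕ) (G : Amb d × Amb d → ℂ) : Prop :=
  ∃ j : ℕ, match σ with
    | true => IsOscKernel X S φ μ k j G
    | false => IsOscKernel X S φ μ j k G

theorem innDir_wt (σ : Bool) : (innDir d σ).wt = -(outDir d σ).wt := by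
  cases σ <;> simp [innDir, outDir, Dir.wt]

theorem outCoord_pt (σ : Bool) (z : Bdry d × Bdry d) (t s : ℝ) : outCoord σ (pt σ z t s) = t := by
  cases σ <;> rfl

theorem hasDerivAt_pt_out (σ : Bool) (z : Bdry d × Bdry d) (t s : ℝ) :
    HasDerivAt (fun t => pt σ z t s) (outDir d σ).vec t := by
  cases σ
  · exact (hasDerivAt_const t ((z.1, s) : Amb d)).prodMk
      ((hasDerivAt_const t z.2).prodMk (hasDerivAt_id t))
  · exact ((hasDerivAt_const t z.1).prodMk (hasDerivAt_id t)).prodMk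
      (hasDerivAt_const t ((z.2, s) : Amb d))

theorem hasDerivAt_pt_inn (σ : Bool) (z : Bdry d × Bdry d) (t s : ℝ) :
    HasDerivAt (fun s => pt σ z t s) (innDir d σ).vec s := by
  cases σ
  · exact hasDerivAt_pt_out true z s t
  · exact hasDerivAt_pt_out false z s t

theorem continuous_pt (σ : Bool) (z : Bdry d × Bdry d) :
    Continuous fun p : ℝ × ℝ => pt σ z p.1 p.2 := by
  cases σ <;> simp only [pt] <;> fun_prop

theorem IsSidedKernel.contDiff (h : IsOscSetting X S φ) {σ : Bool} {μ : ℝ} {k : ℕ}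
    {G : Amb d × Amb d → ℂ} (hG : IsSidedKernel X S φ σ μ k G) : ContDiff ℝ ∞ G := by
  obtain ⟨j, hG⟩ := hG
  cases σ <;> exact hG.contDiff h.isOpen h.isClosed h.subset h.phase.smooth

theorem IsSidedKernel.pd (h : IsOscSetting X S φ) {σ : Bool} {μ : ℝ} {k : ℕ}
    {G : Amb d × Amb d → ℂ} (hG : IsSidedKernel X S φ σ μ k G) (e : Dir d) :
    IsSidedKernel X S φ σ (μ + e.wt) (k + 1) (pd e G) := by
  obtain ⟨j, hG⟩ := hG
  refine ⟨j + 1, ?_⟩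
  cases σ <;>
  · have := hG.pd h.isOpen h.isClosed h.subset h.phase e
    push_cast
    exact this

theorem IsSidedKernel.decay (h : IsOscSetting X S φ) {σ : Bool} {μ : ℝ} {k : ℕ}
    {G : Amb d × Amb d → ℂ} (hG : IsSidedKernel X S φ σ μ k G) :
    ∃ G₁ G₂, IsSidedKernel X S φ σ μ k G₁ ∧ IsSidedKernel X S φ σ (μ - (outDir d σ).wt) k G₂ ∧
      ∀ z, (outCoord σ z : ℂ) * G z = _root_.pd (innDir d σ) G₁ z + G₂ z := by
  obtain ⟨j, hG⟩ := hG
  cases σ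
  · obtain ⟨G₁, G₂, h1, h2, h3⟩ := hG.decay_conor h.isOpen h.isClosed h.subset h.phase
    exact ⟨G₁, G₂, ⟨j, h1⟩, ⟨j, h2.mono (by simp [outDir, Dir.wt]) le_rfl le_rfl⟩, h3⟩
  · obtain ⟨G₁, G₂, h1, h2, h3⟩ := hG.decay_nor h.isOpen h.isClosed h.subset h.phase
    exact ⟨G₁, G₂, ⟨j, h1⟩, ⟨j, h2.mono (by simp [outDir, Dir.wt]) le_rfl le_rfl⟩, h3⟩

theorem IsSidedKernel.bound {σ : Bool} {μ : ℝ} {k : ℕ} {G : Amb d × Amb d → ℂ}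
    (hG : IsSidedKernel X S φ σ μ k G) {K : Set (Bdry d)} (hK : IsCompact K) :
    ∃ (C : ℝ) (J : ℕ), 0 ≤ C ∧ ∀ z : Bdry d × Bdry d, z.1 ∈ K → ∀ t s,
      ‖G (pt σ z t s)‖ ≤ C * jb z.2 ^ μ * (1 + jb z.2 ^ (outDir d σ).wt * |t|) ^ k
        * (1 + |s| / jb z.2 ^ (outDir d σ).wt) ^ J := by
  obtain ⟨j, hG⟩ := hG
  cases σ
  · obtain ⟨C, hC, hb⟩ := IsOscKernel.bound hG hK
    refine ⟨C, j, hC, fun z hz t s => (hb (pt false z t s) hz).trans_eq ?_⟩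
    have := jb_pos z.2
    simp only [weight, pt, outDir, Dir.wt, Real.rpow_natCast, Real.rpow_neg_one]
    field_simp
  · obtain ⟨C, hC, hb⟩ := IsOscKernel.bound hG hK
    refine ⟨C, j, hC, fun z hz t s => (hb (pt true z t s) hz).trans_eq ?_⟩
    simp only [weight, pt, outDir, Dir.wt, Real.rpow_natCast, Real.rpow_one]
    ring

/-- For tangential variables in a compact set the powers of `⟨ξ'⟩` are harmless. -/
theorem IsSidedKernel.bound_compact {σ : Bool} {μ : ℝ} {k : ℕ} {G : Amb d × Amb d → ℂ}
    (hG : IsSidedKernel X S φ σ μ k G) {K : Set (Bdry d × Bdry d)} (hK : IsCompact K) :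
    ∃ (C : ℝ) (J : ℕ), 0 ≤ C ∧ ∀ z ∈ K, ∀ t s,
      ‖G (pt σ z t s)‖ ≤ C * (1 + |t|) ^ k * (1 + |s|) ^ J := by
  obtain ⟨C, J, hC, hb⟩ := hG.bound (hK.image continuous_fst)
  have hjb : ∀ r : ℝ, Continuous fun z : Bdry d × Bdry d => jb z.2 ^ r := fun r =>
    (contDiff_jb.continuous.comp continuous_snd).rpow_const fun z => Or.inl (jb_pos z.2).ne'
  have hbd : ∀ r : ℝ, ∃ M : ℝ, 1 ≤ M ∧ ∀ z ∈ K, jb z.2 ^ r ≤ M := by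
    intro r
    obtain ⟨M, hM⟩ := (hK.image (hjb r)).bddAbove
    exact ⟨max 1 M, le_max_left _ _, fun z hz => (hM (mem_image_of_mem _ hz)).trans (le_max_right _ _)⟩
  obtain ⟨M₀, h0, hM₀⟩ := hbd μ
  obtain ⟨M₁, h1, hM₁⟩ := hbd (outDir d σ).wt
  obtain ⟨M₂, h2, hM₂⟩ := hbd (-(outDir d σ).wt)
  refine ⟨C * M₀ * M₁ ^ k * M₂ ^ J, J, by positivity, fun z hz t s => ?_⟩
  have hj := jb_pos z.2
  refine (hb z (mem_image_of_mem _ hz) t s).trans ?_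
  have e1 : 1 + jb z.2 ^ (outDir d σ).wt * |t| ≤ M₁ * (1 + |t|) := by
    have := mul_le_mul_of_nonneg_right (hM₁ z hz) (abs_nonneg t)
    linarith
  have e2 : 1 + |s| / jb z.2 ^ (outDir d σ).wt ≤ M₂ * (1 + |s|) := by
    rw [div_eq_mul_inv, ← Real.rpow_neg hj.le, mul_comm |s|]
    have := mul_le_mul_of_nonneg_right (hM₂ z hz) (abs_nonneg s)
    linarith
  calc _ ≤ C * M₀ * (M₁ * (1 + |t|)) ^ k * (M₂ * (1 + |s|)) ^ J := by
        gcongr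
        exact hM₀ z hz
    _ = _ := by
        rw [mul_pow, mul_pow]
        ring

end Sides

/-! ### Parameter-dependent families of kernels -/

section KernelMaps

variable {d : ℕ} {X : Set (Amb d)} {S : Set (Amb d × Amb d)} {φ : Amb d × Amb d → ℝ}
  {σ : Bool} {Z : Type*}

/-- Ways of forming a family of kernels in one pair of variables from a function on `ℝ^n × ℝ^n` of
order `μ` that are compatible with derivatives and with multiplication by the outer variable. -/
structure IsKernelMap (σ : Bool) (Λ : ℝ → (Amb d × Amb d → ℂ) → Z → ℝ → ℝ → ℂ) : Prop where
  out : ∀ {G}, ContDiff ℝ ∞ G → ∀ μ z t s, HasDerivAt (fun t => Λ μ G z t s)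
    (Λ (μ + (outDir d σ).wt) (pd (outDir d σ) G) z t s) t
  inn : ∀ {G}, ContDiff ℝ ∞ G → ∀ μ z t s, HasDerivAt (fun s => Λ μ G z t s)
    (Λ (μ - (outDir d σ).wt) (pd (innDir d σ) G) z t s) s
  mul : ∀ {G G₁ G₂}, ContDiff ℝ ∞ G → ContDiff ℝ ∞ G₁ → ContDiff ℝ ∞ G₂ →
    (∀ z, (outCoord σ z : ℂ) * G z = pd (innDir d σ) G₁ z + G₂ z) → ∀ μ z (t s : ℝ),
    (t : ℂ) * Λ μ G z t s = Λ (μ - (outDir d σ).wt) (pd (innDir d σ) G₁) z t s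
      + Λ (μ - (outDir d σ).wt) G₂ z t s

variable {Λ Λ' : ℝ → (Amb d × Amb d → ℂ) → Z → ℝ → ℝ → ℂ}

theorem IsKernelMap.add (h : IsKernelMap σ Λ) (h' : IsKernelMap σ Λ') :
    IsKernelMap σ fun μ G z t s => Λ μ G z t s + Λ' μ G z t s where
  out hG μ z t s := (h.out hG μ z t s).add (h'.out hG μ z t s)
  inn hG μ z t s := (h.inn hG μ z t s).add (h'.inn hG μ z t s)
  mul hG hG₁ hG₂ he μ z t s := by
    rw [mul_add, h.mul hG hG₁ hG₂ he, h'.mul hG hG₁ hG₂ he]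
    ring

theorem IsKernelMap.const_mul (h : IsKernelMap σ Λ) (c : Z → ℂ) :
    IsKernelMap σ fun μ G z t s => c z * Λ μ G z t s where
  out hG μ z t s := (h.out hG μ z t s).const_mul (c z)
  inn hG μ z t s := (h.inn hG μ z t s).const_mul (c z)
  mul hG hG₁ hG₂ he μ z t s := by
    rw [mul_left_comm, h.mul hG hG₁ hG₂ he, mul_add]

theorem pd_outCoord_mul {e : Dir d} (he : e.vec.1.2 = 0 ∧ e.vec.2.2 = 0) (σ : Bool)
    {G : Amb d × Amb d → ℂ} (hG : ContDiff ℝ ∞ G) (z : Amb d × Amb d) :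
    pd e (fun z => (outCoord σ z : ℂ) * G z) z = (outCoord σ z : ℂ) * pd e G z := by
  have hGd : DifferentiableAt ℝ G z := hG.differentiable (by simp) z
  have key : ∀ l : Amb d × Amb d →L[ℝ] ℝ, l e.vec = 0 →
      pd e (fun z => (l z : ℂ) * G z) z = (l z : ℂ) * pd e G z := by
    intro l hl
    have hd : HasFDerivAt (fun z => ((l z : ℝ) : ℂ)) (Complex.ofRealCLM.comp l) z :=
      (Complex.ofRealCLM.comp l).hasFDerivAt
    have h0 : pd e (fun z => ((l z : ℝ) : ℂ)) z = 0 := by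
      rw [pd, hd.fderiv]
      simp [hl]
    rw [pd_mul hd.differentiableAt hGd, h0, zero_mul, add_zero]
  cases σ
  · exact key ((ContinuousLinearMap.snd ℝ _ _).comp (ContinuousLinearMap.snd ℝ _ _)) he.2
  · exact key ((ContinuousLinearMap.snd ℝ _ _).comp (ContinuousLinearMap.fst ℝ _ _)) he.1

/-- Tangential derivatives commute with all operations in the normal variables. -/
theorem IsKernelMap.pd (h : IsKernelMap σ Λ) {e : Dir d} (he : e.vec.1.2 = 0 ∧ e.vec.2.2 = 0) :
    IsKernelMap σ fun μ G z t s => Λ μ (pd e G) z t s where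
  out {G} hG μ z t s := by
    have hc : _root_.pd e (_root_.pd (outDir d σ) G) = _root_.pd (outDir d σ) (_root_.pd e G) :=
      funext fun z => pd_comm hG.contDiffAt
    simp only [hc]
    exact h.out (contDiff_pd hG e) μ z t s
  inn {G} hG μ z t s := by
    have hc : _root_.pd e (_root_.pd (innDir d σ) G) = _root_.pd (innDir d σ) (_root_.pd e G) :=
      funext fun z => pd_comm hG.contDiffAt
    simp only [hc]
    exact h.inn (contDiff_pd hG e) μ z t s
  mul {G G₁ G₂} hG hG₁ hG₂ hid μ z t s := by
    have hc : _root_.pd e (_root_.pd (innDir d σ) G₁) = _root_.pd (innDir d σ) (_root_.pd e G₁) :=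
      funext fun z => pd_comm hG₁.contDiffAt
    simp only [hc]
    refine h.mul (contDiff_pd hG e) (contDiff_pd hG₁ e) (contDiff_pd hG₂ e) (fun z => ?_) μ z t s
    have h1 : (fun z => (outCoord σ z : ℂ) * G z)
        = fun z => _root_.pd (innDir d σ) G₁ z + G₂ z := funext hid
    rw [← pd_outCoord_mul he σ hG, h1, pd_add
      ((contDiff_pd hG₁ _).differentiable (by simp) z) (hG₂.differentiable (by simp) z), hc]

/-- Evaluation at the tangential variables `ζ z`, with the normal variables rescaled by `r z`. -/
theorem isKernelMap_eval (σ : Bool) (ζ : Z → Bdry d × Bdry d) {r : Z → ℝ} (hr : ∀ z, 0 < r z) :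
    IsKernelMap σ fun μ G z t s => ((r z ^ (-μ) : ℝ) : ℂ) *
      G (pt σ (ζ z) (t / r z ^ (outDir d σ).wt) (s * r z ^ (outDir d σ).wt)) where
  out {G} hG μ z t s := by
    have h1 := (hasDerivAt_comp_pd (hG.differentiable (by simp) _)
      (hasDerivAt_pt_out σ (ζ z) (t / r z ^ (outDir d σ).wt) (s * r z ^ (outDir d σ).wt)))
    have h2 := (h1.scomp t ((hasDerivAt_id t).div_const (r z ^ (outDir d σ).wt))).const_mul
      ((r z ^ (-μ) : ℝ) : ℂ)
    refine h2.congr_deriv ?_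
    rw [Complex.real_smul, ← mul_assoc, ← Complex.ofReal_mul, neg_add, Real.rpow_add (hr z),
      Real.rpow_neg (hr z).le (outDir d σ).wt, one_div]
  inn {G} hG μ z t s := by
    have h1 := (hasDerivAt_comp_pd (hG.differentiable (by simp) _)
      (hasDerivAt_pt_inn σ (ζ z) (t / r z ^ (outDir d σ).wt) (s * r z ^ (outDir d σ).wt)))
    have h2 := (h1.scomp s ((hasDerivAt_id s).mul_const (r z ^ (outDir d σ).wt))).const_mul
      ((r z ^ (-μ) : ℝ) : ℂ)
    refine h2.congr_deriv ?_
    rw [Complex.real_smul, ← mul_assoc, ← Complex.ofReal_mul, neg_sub, sub_eq_neg_add,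
      Real.rpow_add (hr z), one_mul]
  mul {G G₁ G₂} hG hG₁ hG₂ he μ z t s := by
    have hρ : 0 < r z ^ (outDir d σ).wt := Real.rpow_pos_of_pos (hr z) _
    rw [← mul_add, ← he, outCoord_pt, neg_sub, sub_eq_neg_add, Real.rpow_add (hr z)]
    push_cast
    have : ((r z ^ (outDir d σ).wt : ℝ) : ℂ) ≠ 0 := by exact_mod_cast hρ.ne'
    field_simp

theorem isKernelMap_pt (σ : Bool) (ζ : Z → Bdry d × Bdry d) :
    IsKernelMap σ fun (_ : ℝ) (G : Amb d × Amb d → ℂ) z t s => G (pt σ (ζ z) t s) := by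
  simpa using isKernelMap_eval σ ζ (r := fun _ => 1) fun _ => one_pos

theorem IsKernelMap.kernelClass (h : IsOscSetting X S φ) (hΛ : IsKernelMap σ Λ) (r : ℕ)
    (hb : ∀ {μ k G}, IsSidedKernel X S φ σ μ k G → ∃ (C : ℝ) (J : ℕ), 0 ≤ C ∧
      ∀ z t s, ‖Λ μ G z t s‖ ≤ C * (1 + |t|) ^ (k + r) * (1 + |s|) ^ J) :
    KernelClass fun k g => ∃ μ k₀ G, IsSidedKernel X S φ σ μ k₀ G ∧ k = k₀ + r ∧ g = Λ μ G where
  cont := by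
    rintro k g ⟨μ, k₀, G, hG, -, rfl⟩ z t
    exact continuous_iff_continuousAt.2 fun s => (hΛ.inn (hG.contDiff h) μ z t s).continuousAt
  bound := by
    rintro k g ⟨μ, k₀, G, hG, rfl, rfl⟩
    exact hb hG
  deriv := by
    rintro k g ⟨μ, k₀, G, hG, rfl, rfl⟩
    exact ⟨_, ⟨_, _, _, hG.pd h (outDir d σ), by ring, rfl⟩, hΛ.out (hG.contDiff h) μ⟩
  decay := by
    rintro k g ⟨μ, k₀, G, hG, rfl, rfl⟩
    obtain ⟨G₁, G₂, h1, h2, h3⟩ := hG.decay h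
    have h1' := h1.pd h (innDir d σ)
    rw [innDir_wt, ← sub_eq_add_neg] at h1'
    exact ⟨_, _, _, ⟨_, _, _, h1, rfl, rfl⟩, ⟨_, _, _, h1', by ring, rfl⟩,
      ⟨_, _, _, h2, rfl, rfl⟩, hΛ.inn (h1.contDiff h) μ,
      hΛ.mul (hG.contDiff h) (h1.contDiff h) (h2.contDiff h) h3 μ⟩

theorem IsKernelMap.exists_operator (h : IsOscSetting X S φ) (hΛ : IsKernelMap σ Λ) (r : ℕ)
    (hb : ∀ {μ k G}, IsSidedKernel X S φ σ μ k G → ∃ (C : ℝ) (J : ℕ), 0 ≤ C ∧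
      ∀ z t s, ‖Λ μ G z t s‖ ≤ C * (1 + |t|) ^ (k + r) * (1 + |s|) ^ J)
    {μ : ℝ} {k : ℕ} {G : Amb d × Amb d → ℂ} (hG : IsSidedKernel X S φ σ μ k G) :
    ∃ T : Z → 𝓢(ℝ, ℂ) →L[ℂ] 𝓢(ℝ, ℂ), (∀ z w t, T z w t = ∫ s, Λ μ G z t s * w s) ∧
      EquiBoundedOn univ T (fun _ => 1) :=
  (hΛ.kernelClass h r hb).exists_operator ⟨μ, k, G, hG, rfl, rfl⟩

end KernelMaps

/-! ### The operators of an oscillating kernel -/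

section KernelOperators

variable {d : ℕ} {X : Set (Amb d)} {S : Set (Amb d × Amb d)} {φ : Amb d × Amb d → ℝ}
  {σ : Bool} {μ : ℝ} {k : ℕ} {G : Amb d × Amb d → ℂ}

theorem EquiBoundedOn.of_eq_smul {ι E F : Type*} [AddCommGroup E] [Module ℂ E]
    [TopologicalSpace E] [AddCommGroup F] [Module ℂ F] [TopologicalSpace F]
    [IsTopologicalAddGroup F] [ContinuousSMul ℂ F] {s : Set ι} {T : s → E →L[ℂ] F}
    (hT : EquiBoundedOn univ T fun _ => 1) {M : ι → E →L[ℂ] F} {r : ι → ℝ} (hr : ∀ i ∈ s, 0 ≤ r i)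
    (hM : ∀ i (hi : i ∈ s), M i = ((r i : ℝ) : ℂ) • T ⟨i, hi⟩) : EquiBoundedOn s M r := by
  intro q hq
  obtain ⟨p, hp, hb⟩ := hT q hq
  refine ⟨p, hp, fun i hi u => ?_⟩
  have h1 := hb ⟨i, hi⟩ (mem_univ _) u
  rw [one_mul] at h1
  rw [hM i hi, smul_apply, map_smul_eq_mul, Complex.norm_real,
    Real.norm_of_nonneg (hr i hi)]
  exact mul_le_mul_of_nonneg_left h1 (hr i hi)

open scoped Classical in
/-- The operator on `𝓢(ℝ)` with kernel `G` at the tangential variables `z`, and `0` if there is no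
such operator. -/
def kernelOp (σ : Bool) (G : Amb d × Amb d → ℂ) (z : Bdry d × Bdry d) : 𝓢(ℝ, ℂ) →L[ℂ] 𝓢(ℝ, ℂ) :=
  if h : ∃ T : 𝓢(ℝ, ℂ) →L[ℂ] 𝓢(ℝ, ℂ), ∀ w t, T w t = ∫ s, G (pt σ z t s) * w s then h.choose else 0

theorem IsSidedKernel.bound_at (hG : IsSidedKernel X S φ σ μ k G) (z : Bdry d × Bdry d) :
    ∃ (C : ℝ) (J : ℕ), 0 ≤ C ∧ ∀ t s, ‖G (pt σ z t s)‖ ≤ C * (1 + |t|) ^ k * (1 + |s|) ^ J := by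
  obtain ⟨C, J, hC, hb⟩ := hG.bound_compact (isCompact_singleton (x := z))
  exact ⟨C, J, hC, hb z rfl⟩

theorem kernelOp_apply (h : IsOscSetting X S φ) (hG : IsSidedKernel X S φ σ μ k G)
    (z : Bdry d × Bdry d) (w : 𝓢(ℝ, ℂ)) (t : ℝ) :
    kernelOp σ G z w t = ∫ s, G (pt σ z t s) * w s := by
  have hex : ∃ T : 𝓢(ℝ, ℂ) →L[ℂ] 𝓢(ℝ, ℂ), ∀ w t, T w t = ∫ s, G (pt σ z t s) * w s := by
    obtain ⟨T, hT, -⟩ := (isKernelMap_pt σ fun _ : Unit => z).exists_operator h 0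
      (fun hG => by
        obtain ⟨C, J, hC, hb⟩ := hG.bound_at z
        exact ⟨C, J, hC, fun _ => hb⟩) hG
    exact ⟨T (), hT ()⟩
  rw [kernelOp, dif_pos hex]
  exact hex.choose_spec w t

theorem IsSidedKernel.integrable (h : IsOscSetting X S φ) (hG : IsSidedKernel X S φ σ μ k G)
    (z : Bdry d × Bdry d) (w : 𝓢(ℝ, ℂ)) (t : ℝ) :
    Integrable fun s => G (pt σ z t s) * w s :=
  ((isKernelMap_pt σ fun _ : Unit => z).kernelClass h 0 (fun hG => by
    obtain ⟨C, J, hC, hb⟩ := hG.bound_at z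
    exact ⟨C, J, hC, fun _ => hb⟩)).integrable ⟨μ, k, G, hG, rfl, rfl⟩ () t w

/-- In coordinates adapted to the scale `⟨ξ'⟩` the operators of a kernel of order `μ` are bounded by
`⟨ξ'⟩^μ`. -/
theorem IsSidedKernel.equiBoundedOn_conj (h : IsOscSetting X S φ)
    (hG : IsSidedKernel X S φ σ μ k G) {K : Set (Bdry d)} (hK : IsCompact K)
    (c : Bdry d → ℝ) (hc : ∀ ξ, 0 < c ξ) (hcσ : ∀ ξ, c ξ = (jb ξ ^ (outDir d σ).wt)⁻¹) :
    EquiBoundedOn {z : Bdry d × Bdry d | z.1 ∈ K}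
      (fun z => (kappa (c z.2) (hc z.2)).comp ((kernelOp σ G z).comp (kappa (c z.2) (hc z.2))))
      (fun z => jb z.2 ^ μ) := by
  obtain ⟨T, hT, hTb⟩ := (isKernelMap_eval σ (fun z : {z : Bdry d × Bdry d // z.1 ∈ K} => z.1)
    (r := fun z => jb z.1.2) fun z => jb_pos _).exists_operator h 0 (fun {μ k G} hG => by
      obtain ⟨C, J, hC, hb⟩ := hG.bound hK
      refine ⟨C, J, hC, fun z t s => ?_⟩
      have hj := jb_pos z.1.2
      have hρ : 0 < jb z.1.2 ^ (outDir d σ).wt := Real.rpow_pos_of_pos hj _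
      have hμ : 0 < jb z.1.2 ^ μ := Real.rpow_pos_of_pos hj _
      rw [norm_mul, Complex.norm_real, Real.norm_of_nonneg (by positivity), Real.rpow_neg hj.le,
        inv_mul_le_iff₀ hμ]
      refine (hb z.1 z.2 _ _).trans_eq ?_
      rw [abs_div, abs_mul, abs_of_pos hρ, mul_div_cancel₀ _ hρ.ne', mul_div_cancel_right₀ _ hρ.ne',
        add_zero]
      ring) hG
  have key : ∀ z : {z : Bdry d × Bdry d // z.1 ∈ K},
      (kappa (c z.1.2) (hc z.1.2)).comp ((kernelOp σ G z.1).comp (kappa (c z.1.2) (hc z.1.2)))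
        = ((jb z.1.2 ^ μ : ℝ) : ℂ) • T z := by
    intro z
    have hj := jb_pos z.1.2
    have hρ : 0 < jb z.1.2 ^ (outDir d σ).wt := Real.rpow_pos_of_pos hj _
    ext w t
    have e1 : kappa (c z.1.2) (hc z.1.2) (kernelOp σ G z.1 (kappa (c z.1.2) (hc z.1.2) w)) t
        = (c z.1.2 : ℂ) * ∫ s, G (pt σ z.1 (t * c z.1.2) s) * w (s * c z.1.2) := by
      rw [kappa_apply, kernelOp_apply h hG, ← integral_const_mul, ← integral_const_mul]
      refine integral_congr_ae (Eventually.of_forall fun s => ?_)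
      simp only [kappa_apply]
      have : ((Real.sqrt (c z.1.2) : ℝ) : ℂ) * ((Real.sqrt (c z.1.2) : ℝ) : ℂ) = (c z.1.2 : ℂ) := by
        rw [← Complex.ofReal_mul, Real.mul_self_sqrt (hc _).le]
      linear_combination (G (pt σ z.1 (t * c z.1.2) s) * w (s * c z.1.2)) * this
    have e2 : ((jb z.1.2 ^ μ : ℝ) : ℂ) * T z w t
        = ∫ s, (fun s => G (pt σ z.1 (t * c z.1.2) s) * w (s * c z.1.2))
            (s * jb z.1.2 ^ (outDir d σ).wt) := by
      rw [hT, ← integral_const_mul]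
      refine integral_congr_ae (Eventually.of_forall fun s => ?_)
      have h1 : ((jb z.1.2 ^ μ : ℝ) : ℂ) * ((jb z.1.2 ^ (-μ) : ℝ) : ℂ) = 1 := by
        rw [← Complex.ofReal_mul, ← Real.rpow_add hj]
        simp
      simp only [hcσ]
      rw [mul_inv_cancel_right₀ hρ.ne', ← div_eq_mul_inv]
      linear_combination (G (pt σ z.1 (t / jb z.1.2 ^ (outDir d σ).wt)
        (s * jb z.1.2 ^ (outDir d σ).wt)) * w s) * h1
    change kappa (c z.1.2) (hc z.1.2) (kernelOp σ G z.1 (kappa (c z.1.2) (hc z.1.2) w)) t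
      = ((jb z.1.2 ^ μ : ℝ) : ℂ) * T z w t
    rw [e1, e2, Measure.integral_comp_mul_right
      (fun s => G (pt σ z.1 (t * c z.1.2) s) * w (s * c z.1.2)), ← hcσ, abs_of_pos (hc _),
      Complex.real_smul]
  exact hTb.of_eq_smul (fun z _ => (Real.rpow_pos_of_pos (jb_pos _) _).le) fun z hz => key ⟨z, hz⟩

theorem fderiv_tangential_le (p : Amb d × Amb d) (v : Bdry d × Bdry d) :
    ‖fderiv ℝ G p ((v.1, 0), (v.2, 0))‖
      ≤ (∑ i, ‖pd (.tan i) G p‖ + ∑ i, ‖pd (.cotan i) G p‖) * ‖v‖ := by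
  have hv : ((v.1, 0), (v.2, 0))
      = ∑ i, v.1 i • (Dir.tan i).vec + ∑ i, v.2 i • (Dir.cotan i : Dir d).vec := by
    have hs : ∀ u : Bdry d, u = ∑ i, u i • EuclideanSpace.single i (1 : ℝ) := by
      intro u
      have := (EuclideanSpace.basisFun (Fin d) ℝ).sum_repr u
      simpa using this.symm
    refine Prod.ext (Prod.ext ?_ ?_) (Prod.ext ?_ ?_)
    · simpa [Dir.vec, Prod.fst_sum, Prod.snd_sum] using hs v.1
    · simp [Dir.vec, Prod.fst_sum, Prod.snd_sum]
    · simpa [Dir.vec, Prod.fst_sum, Prod.snd_sum] using hs v.2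
    · simp [Dir.vec, Prod.snd_sum]
  rw [hv, map_add, map_sum, map_sum, add_mul, Finset.sum_mul, Finset.sum_mul]
  refine (norm_add_le _ _).trans (add_le_add ?_ ?_)
  · refine (norm_sum_le _ _).trans (Finset.sum_le_sum fun i _ => ?_)
    rw [map_smul, norm_smul, mul_comm]
    exact mul_le_mul_of_nonneg_left ((PiLp.norm_apply_le v.1 i).trans (norm_fst_le v)) (norm_nonneg _)
  · refine (norm_sum_le _ _).trans (Finset.sum_le_sum fun i _ => ?_)
    rw [map_smul, norm_smul, mul_comm]
    exact mul_le_mul_of_nonneg_left ((PiLp.norm_apply_le v.2 i).trans (norm_snd_le v)) (norm_nonneg _)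

theorem hasFDerivAt_pt (σ : Bool) (z : Bdry d × Bdry d) (t s : ℝ) :
    HasFDerivAt (fun z => pt σ z t s)
      (((ContinuousLinearMap.fst ℝ (Bdry d) (Bdry d)).prod 0).prod
        ((ContinuousLinearMap.snd ℝ (Bdry d) (Bdry d)).prod 0)) z := by
  cases σ
  · exact ((hasFDerivAt_fst).prodMk (hasFDerivAt_const s z)).prodMk
      ((hasFDerivAt_snd).prodMk (hasFDerivAt_const t z))
  · exact ((hasFDerivAt_fst).prodMk (hasFDerivAt_const t z)).prodMk
      ((hasFDerivAt_snd).prodMk (hasFDerivAt_const s z))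

theorem IsSidedKernel.lipschitz (h : IsOscSetting X S φ) (hG : IsSidedKernel X S φ σ μ k G)
    {K : Set (Bdry d × Bdry d)} (hK : IsCompact K) (hKc : Convex ℝ K) :
    ∃ (C : ℝ) (J : ℕ), 0 ≤ C ∧ ∀ z ∈ K, ∀ z₀ ∈ K, ∀ t s,
      ‖G (pt σ z t s) - G (pt σ z₀ t s)‖ ≤ C * (1 + |t|) ^ (k + 1) * (1 + |s|) ^ J * ‖z - z₀‖ := by
  choose C J hC hb using fun i => (hG.pd h (.tan i)).bound_compact hK
  choose C' J' hC' hb' using fun i => (hG.pd h (.cotan i)).bound_compact hK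
  have hJ : ∀ i, J i ≤ ∑ i, J i + ∑ i, J' i := fun i =>
    (Finset.single_le_sum (fun _ _ => Nat.zero_le _) (Finset.mem_univ i)).trans le_self_add
  have hJ' : ∀ i, J' i ≤ ∑ i, J i + ∑ i, J' i := fun i =>
    (Finset.single_le_sum (fun _ _ => Nat.zero_le _) (Finset.mem_univ i)).trans le_add_self
  refine ⟨∑ i, C i + ∑ i, C' i, ∑ i, J i + ∑ i, J' i,
    add_nonneg (Finset.sum_nonneg fun i _ => hC i) (Finset.sum_nonneg fun i _ => hC' i),
    fun z hz z₀ hz₀ t s => ?_⟩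
  have hGd := (hG.contDiff h).differentiable (by simp)
  refine hKc.norm_image_sub_le_of_norm_hasFDerivWithin_le (f := fun z => G (pt σ z t s))
    (fun z _ => ((hGd (pt σ z t s)).hasFDerivAt.comp z (hasFDerivAt_pt σ z t s)).hasFDerivWithinAt)
    (fun z hz => ?_) hz₀ hz
  refine ContinuousLinearMap.opNorm_le_bound _ ?_ fun v => ?_
  · exact mul_nonneg (mul_nonneg (add_nonneg (Finset.sum_nonneg fun i _ => hC i)
      (Finset.sum_nonneg fun i _ => hC' i)) (by positivity)) (by positivity)
  · refine (fderiv_tangential_le (G := G) (pt σ z t s) v).trans ?_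
    refine mul_le_mul_of_nonneg_right ?_ (norm_nonneg v)
    rw [mul_assoc, add_mul, Finset.sum_mul, Finset.sum_mul]
    have h1 : 1 ≤ 1 + |s| := by linarith [abs_nonneg s]
    refine add_le_add (Finset.sum_le_sum fun i _ => ?_) (Finset.sum_le_sum fun i _ => ?_)
    · refine (hb i z hz t s).trans ?_
      rw [mul_assoc]
      have := hC i
      gcongr
      exact hJ i
    · refine (hb' i z hz t s).trans ?_
      rw [mul_assoc]
      have := hC' i
      gcongr
      exact hJ' i

/-- The operators depend locally Lipschitz continuously on the tangential variables. -/
theorem IsSidedKernel.equiBoundedOn_sub (h : IsOscSetting X S φ)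
    (hG : IsSidedKernel X S φ σ μ k G) (z₀ : Bdry d × Bdry d) :
    EquiBoundedOn {z : Bdry d × Bdry d | z ≠ z₀ ∧ ‖z - z₀‖ ≤ 1}
      (fun z => kernelOp σ G z - kernelOp σ G z₀) (fun z => ‖z - z₀‖) := by
  let Z := {z : Bdry d × Bdry d // z ≠ z₀ ∧ ‖z - z₀‖ ≤ 1}
  let c : Z → ℂ := fun z => ((‖z.1 - z₀‖⁻¹ : ℝ) : ℂ)
  obtain ⟨T, hT, hTb⟩ := (((isKernelMap_pt σ fun z : Z => z.1).const_mul c).add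
    ((isKernelMap_pt σ fun _ : Z => z₀).const_mul fun z => -c z)).exists_operator h 1
    (fun {μ k G} hG => by
      obtain ⟨C, J, hC, hb⟩ := hG.lipschitz h (isCompact_closedBall z₀ 1) (convex_closedBall z₀ 1)
      refine ⟨C, J, hC, fun z t s => ?_⟩
      have hz : 0 < ‖z.1 - z₀‖ := norm_pos_iff.2 (sub_ne_zero.2 z.2.1)
      rw [neg_mul, ← sub_eq_add_neg, ← mul_sub, norm_mul, Complex.norm_real,
        Real.norm_of_nonneg (by positivity), inv_mul_le_iff₀ hz, mul_comm ‖z.1 - z₀‖]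
      exact hb z.1 (by simpa [dist_eq_norm] using z.2.2) z₀ (by simp) t s) hG
  have key : ∀ z : Z, kernelOp σ G z.1 - kernelOp σ G z₀ = ((‖z.1 - z₀‖ : ℝ) : ℂ) • T z := by
    intro z
    have hz : ((‖z.1 - z₀‖ : ℝ) : ℂ) * c z = 1 := by
      rw [← Complex.ofReal_mul, mul_inv_cancel₀ (norm_pos_iff.2 (sub_ne_zero.2 z.2.1)).ne']
      simp
    ext w t
    change kernelOp σ G z.1 w t - kernelOp σ G z₀ w t = ((‖z.1 - z₀‖ : ℝ) : ℂ) * T z w t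
    rw [hT, kernelOp_apply h hG, kernelOp_apply h hG, ← integral_const_mul,
      ← integral_sub (hG.integrable h _ w t) (hG.integrable h _ w t)]
    refine integral_congr_ae (Eventually.of_forall fun s => ?_)
    simp only
    linear_combination -(G (pt σ z.1 t s) * w s - G (pt σ z₀ t s) * w s) * hz
  exact hTb.of_eq_smul (fun z _ => norm_nonneg _) fun z hz => key ⟨z, hz⟩

theorem pt_add_smul {e : Dir d} (he : e.vec.1.2 = 0 ∧ e.vec.2.2 = 0) (σ : Bool)
    (z₀ : Bdry d × Bdry d) (t s r : ℝ) :
    pt σ (z₀ + r • (e.vec.1.1, e.vec.2.1)) t s = pt σ z₀ t s + r • e.vec := by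
  cases σ <;> refine Prod.ext (Prod.ext ?_ ?_) (Prod.ext ?_ ?_) <;> simp [pt, he.1, he.2]

theorem IsSidedKernel.taylor (h : IsOscSetting X S φ) (hG : IsSidedKernel X S φ σ μ k G)
    {e : Dir d} (he : e.vec.1.2 = 0 ∧ e.vec.2.2 = 0) (he1 : ‖(e.vec.1.1, e.vec.2.1)‖ ≤ 1)
    (z₀ : Bdry d × Bdry d) :
    ∃ (C : ℝ) (J : ℕ), 0 ≤ C ∧ ∀ r : ℝ, |r| ≤ 1 → ∀ t s,
      ‖G (pt σ (z₀ + r • (e.vec.1.1, e.vec.2.1)) t s) - G (pt σ z₀ t s)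
        - r * _root_.pd e G (pt σ z₀ t s)‖ ≤ C * (1 + |t|) ^ (k + 2) * (1 + |s|) ^ J * (|r| * |r|) := by
  obtain ⟨C, J, hC, hb⟩ := (hG.pd h e).lipschitz h (isCompact_closedBall z₀ 1)
    (convex_closedBall z₀ 1)
  refine ⟨C, J, hC, fun r hr t s => ?_⟩
  have hGd := (hG.contDiff h).differentiable (by simp)
  have hd : ∀ ρ : ℝ, HasDerivAt
      (fun ρ : ℝ => G (pt σ (z₀ + ρ • (e.vec.1.1, e.vec.2.1)) t s) - ρ * _root_.pd e G (pt σ z₀ t s))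
      (_root_.pd e G (pt σ (z₀ + ρ • (e.vec.1.1, e.vec.2.1)) t s) - _root_.pd e G (pt σ z₀ t s))
      ρ := by
    intro ρ
    simp only [pt_add_smul he]
    have h1 : HasDerivAt (fun ρ : ℝ => pt σ z₀ t s + ρ • e.vec) e.vec ρ := by
      simpa using ((hasDerivAt_id ρ).smul_const e.vec).const_add (pt σ z₀ t s)
    have h2 := hasDerivAt_comp_pd (hGd _) h1
    have h3 := (Complex.ofRealCLM.hasDerivAt (x := ρ)).mul_const (_root_.pd e G (pt σ z₀ t s))
    exact (h2.sub h3).congr_deriv (by simp)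
  have key := (convex_closedBall (0 : ℝ) |r|).norm_image_sub_le_of_norm_hasDerivWithin_le
    (f := fun ρ : ℝ => G (pt σ (z₀ + ρ • (e.vec.1.1, e.vec.2.1)) t s)
      - ρ * _root_.pd e G (pt σ z₀ t s))
    (C := C * (1 + |t|) ^ (k + 2) * (1 + |s|) ^ J * |r|)
    (fun ρ _ => (hd ρ).hasDerivWithinAt) (fun ρ hρ => ?_) (x := 0) (y := r) (by simp) (by simp)
  · rw [sub_zero, Real.norm_eq_abs] at key
    refine le_of_eq_of_le (congrArg norm ?_) (key.trans_eq (by ring))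
    simp
    ring
  · have hρ' : |ρ| ≤ |r| := by simpa using hρ
    have hn : ‖ρ • (e.vec.1.1, e.vec.2.1)‖ ≤ |r| := by
      rw [norm_smul, Real.norm_eq_abs]
      exact (mul_le_of_le_one_right (abs_nonneg ρ) he1).trans hρ'
    refine (hb _ ?_ z₀ (by simp) t s).trans ?_
    · rw [mem_closedBall_iff_norm, add_sub_cancel_left]
      exact hn.trans hr
    · rw [add_sub_cancel_left]
      gcongr

/-- The operators are differentiable in the tangential variables, and their derivatives are the
operators of the differentiated kernels. -/
theorem IsSidedKernel.equiBoundedOn_taylor (h : IsOscSetting X S φ)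
    (hG : IsSidedKernel X S φ σ μ k G) {e : Dir d} (he : e.vec.1.2 = 0 ∧ e.vec.2.2 = 0)
    (he1 : ‖(e.vec.1.1, e.vec.2.1)‖ ≤ 1) (z₀ : Bdry d × Bdry d) :
    EquiBoundedOn {r : ℝ | r ≠ 0 ∧ |r| ≤ 1}
      (fun r => (r : ℂ)⁻¹ • (kernelOp σ G (z₀ + r • (e.vec.1.1, e.vec.2.1)) - kernelOp σ G z₀)
        - kernelOp σ (_root_.pd e G) z₀) (fun r => |r|) := by
  let Z := {r : ℝ // r ≠ 0 ∧ |r| ≤ 1}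
  let c : Z → ℂ := fun r => ((|r.1|⁻¹ : ℝ) : ℂ)
  let b : Z → ℂ := fun r => c r * (r.1 : ℂ)⁻¹
  obtain ⟨T, hT, hTb⟩ := ((((isKernelMap_pt σ
    fun r : Z => z₀ + r.1 • (e.vec.1.1, e.vec.2.1)).const_mul b).add ((isKernelMap_pt σ fun _ : Z => z₀).const_mul fun r => -b r)).add
    (((isKernelMap_pt σ fun _ : Z => z₀).pd he).const_mul fun r => -c r)).exists_operator h 2
    (fun {μ k G} hG => by
      obtain ⟨C, J, hC, hb⟩ := hG.taylor h he he1 z₀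
      refine ⟨C, J, hC, fun r t s => ?_⟩
      have hr : 0 < |r.1| := abs_pos.2 r.2.1
      have hr' : (r.1 : ℂ) ≠ 0 := by exact_mod_cast r.2.1
      have hbr : ‖b r‖ = (|r.1| * |r.1|)⁻¹ := by
        rw [norm_mul, norm_inv, Complex.norm_real, Complex.norm_real,
          Real.norm_of_nonneg (by positivity), Real.norm_eq_abs, mul_inv]
      have heq : ∀ x y v : ℂ, b r * x + -b r * y + -c r * v = b r * (x - y - r.1 * v) := by
        intro x y v
        simp only [b]
        field_simp
        ring
      rw [heq, norm_mul, hbr, inv_mul_le_iff₀ (by positivity), mul_comm (|r.1| * |r.1|)]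
      exact hb r.1 r.2.2 t s) hG
  have key : ∀ r : Z, (r.1 : ℂ)⁻¹ • (kernelOp σ G (z₀ + r.1 • (e.vec.1.1, e.vec.2.1))
      - kernelOp σ G z₀) - kernelOp σ (_root_.pd e G) z₀ = ((|r.1| : ℝ) : ℂ) • T r := by
    intro r
    have hr : ((|r.1| : ℝ) : ℂ) * c r = 1 := by
      rw [← Complex.ofReal_mul, mul_inv_cancel₀ (abs_pos.2 r.2.1).ne']
      simp
    ext w t
    change (r.1 : ℂ)⁻¹ * (kernelOp σ G (z₀ + r.1 • (e.vec.1.1, e.vec.2.1)) w t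
      - kernelOp σ G z₀ w t) - kernelOp σ (_root_.pd e G) z₀ w t = ((|r.1| : ℝ) : ℂ) * T r w t
    have hi : Integrable fun s => (r.1 : ℂ)⁻¹ *
        (G (pt σ (z₀ + r.1 • (e.vec.1.1, e.vec.2.1)) t s) * w s
        - G (pt σ z₀ t s) * w s) :=
      ((hG.integrable h _ w t).sub (hG.integrable h _ w t)).const_mul _
    rw [hT, kernelOp_apply h hG, kernelOp_apply h hG, kernelOp_apply h (hG.pd h e),
      ← integral_const_mul, ← integral_sub (hG.integrable h _ w t) (hG.integrable h _ w t),
      ← integral_const_mul, ← integral_sub hi ((hG.pd h e).integrable h _ w t)]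
    refine integral_congr_ae (Eventually.of_forall fun s => ?_)
    simp only [b]
    linear_combination -(((r.1 : ℂ)⁻¹ * (G (pt σ (z₀ + r.1 • (e.vec.1.1, e.vec.2.1)) t s) * w s
      - G (pt σ z₀ t s) * w s)) - _root_.pd e G (pt σ z₀ t s) * w s) * hr
  exact hTb.of_eq_smul (fun r _ => abs_nonneg r) fun r hr => key ⟨r, hr⟩

end KernelOperators

/-! ### Mixed tangential derivatives -/

section MixedDerivatives

variable {d : ℕ} {X : Set (Amb d)} {S : Set (Amb d × Amb d)} {φ : Amb d × Amb d → ℝ}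

/-- A coordinate derivative as an operation on smooth functions. -/
def pdSmooth (e : Dir d) (G : {G : Amb d × Amb d → ℂ // ContDiff ℝ ∞ G}) :
    {G : Amb d × Amb d → ℂ // ContDiff ℝ ∞ G} :=
  ⟨pd e G.1, contDiff_pd G.2 e⟩

instance : LeftCommutative (pdSmooth (d := d)) where
  left_comm _ _ G := Subtype.ext (funext fun _ => pd_comm G.2.contDiffAt)

/-- The multiset of directions of `∂_{x'}^β ∂_{ξ'}^α`. -/
def tangentialDirs (β α : Fin d → ℕ) : Multiset (Dir d) :=
  ∑ i, β i • {Dir.tan i} + ∑ i, α i • {Dir.cotan i}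

theorem sum_add_single_nsmul (β : Fin d → ℕ) (i : Fin d) (f : Fin d → Multiset (Dir d)) :
    ∑ j, (β + Pi.single i 1 : Fin d → ℕ) j • f j = f i + ∑ j, β j • f j := by
  simp only [Pi.add_apply, add_smul, Finset.sum_add_distrib, Pi.single_apply, ite_smul, one_smul,
    zero_smul, Finset.sum_ite_eq', Finset.mem_univ, if_true]
  exact add_comm _ _

theorem tangentialDirs_add_left (β α : Fin d → ℕ) (i : Fin d) :
    tangentialDirs (β + Pi.single i 1) α = Dir.tan i ::ₘ tangentialDirs β α := by
  rw [tangentialDirs, sum_add_single_nsmul, add_assoc, Multiset.singleton_add, tangentialDirs]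

theorem tangentialDirs_add_right (β α : Fin d → ℕ) (i : Fin d) :
    tangentialDirs β (α + Pi.single i 1) = Dir.cotan i ::ₘ tangentialDirs β α := by
  rw [tangentialDirs, sum_add_single_nsmul, add_left_comm, Multiset.singleton_add, tangentialDirs]

theorem sum_wt_tangentialDirs (β α : Fin d → ℕ) :
    ((tangentialDirs β α).map Dir.wt).sum = -((∑ i, α i : ℕ) : ℝ) := by
  have hm : ∀ (γ : Fin d → ℕ) (f : Fin d → Dir d), ((∑ i, γ i • ({f i} : Multiset (Dir d))).map
      Dir.wt).sum = ∑ i, (γ i : ℝ) * (f i).wt := by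
    intro γ f
    let L : Multiset (Dir d) →+ ℝ :=
      (Multiset.sumAddMonoidHom (M := ℝ)).comp (Multiset.mapAddMonoidHom Dir.wt)
    have hL : ∀ s : Multiset (Dir d), (s.map Dir.wt).sum = L s := fun s => rfl
    rw [hL, map_sum]
    refine Finset.sum_congr rfl fun i _ => ?_
    rw [map_nsmul, nsmul_eq_mul, ← hL]
    simp
  rw [tangentialDirs, Multiset.map_add, Multiset.sum_add, hm, hm]
  simp [Dir.wt]

/-- The derivative `∂_{x'}^β ∂_{ξ'}^α G`. -/
def tangentialPd (G : {G : Amb d × Amb d → ℂ // ContDiff ℝ ∞ G}) (β α : Fin d → ℕ) :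
    Amb d × Amb d → ℂ :=
  ((tangentialDirs β α).foldr pdSmooth G).1

variable (G : {G : Amb d × Amb d → ℂ // ContDiff ℝ ∞ G})

theorem tangentialPd_zero : tangentialPd G 0 0 = G.1 := by
  simp [tangentialPd, tangentialDirs]

theorem tangentialPd_add_left (β α : Fin d → ℕ) (i : Fin d) :
    tangentialPd G (β + Pi.single i 1) α = pd (.tan i) (tangentialPd G β α) := by
  rw [tangentialPd, tangentialDirs_add_left, Multiset.foldr_cons]
  rfl

theorem tangentialPd_add_right (β α : Fin d → ℕ) (i : Fin d) :
    tangentialPd G β (α + Pi.single i 1) = pd (.cotan i) (tangentialPd G β α) := by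
  rw [tangentialPd, tangentialDirs_add_right, Multiset.foldr_cons]
  rfl

theorem isSidedKernel_tangentialPd (h : IsOscSetting X S φ) {σ : Bool} {μ : ℝ} {k : ℕ}
    (hG : IsSidedKernel X S φ σ μ k G.1) (β α : Fin d → ℕ) :
    ∃ k', IsSidedKernel X S φ σ (μ - ((∑ i, α i : ℕ) : ℝ)) k' (tangentialPd G β α) := by
  have key : ∀ s : Multiset (Dir d), ∃ k',
      IsSidedKernel X S φ σ (μ + (s.map Dir.wt).sum) k' (s.foldr pdSmooth G).1 := by
    intro s
    induction s using Multiset.induction with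
    | empty => exact ⟨k, by simpa using hG⟩
    | cons e s ih =>
      obtain ⟨k', hk'⟩ := ih
      refine ⟨k' + 1, ?_⟩
      rw [Multiset.foldr_cons, Multiset.map_cons, Multiset.sum_cons, add_comm e.wt, ← add_assoc]
      exact hk'.pd h e
  obtain ⟨k', hk'⟩ := key (tangentialDirs β α)
  rw [sum_wt_tangentialDirs, ← sub_eq_add_neg] at hk'
  exact ⟨k', hk'⟩

end MixedDerivatives

/-! ### The Fourier transform, dilations and transposes -/

section Fourier

open scoped FourierTransform

/-- The operator `u ↦ (2π)⁻¹ û` on `𝓢(ℝ)`. -/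
def fourierOp : 𝓢(ℝ, ℂ) →L[ℂ] 𝓢(ℝ, ℂ) :=
  (2 * Real.pi : ℂ)⁻¹ • (SchwartzMap.compCLMOfContinuousLinearEquiv ℂ
    (ContinuousLinearEquiv.unitsEquivAut ℝ (Units.mk0 (2 * Real.pi)⁻¹
      (inv_ne_zero Real.two_pi_pos.ne')))).comp (FourierTransform.fourierCLM ℂ 𝓢(ℝ, ℂ))

theorem fourierOp_apply (u : 𝓢(ℝ, ℂ)) (s : ℝ) : fourierOp u s = (2 * Real.pi : ℂ)⁻¹ * hat u s := by
  change (2 * Real.pi : ℂ)⁻¹ * 𝓕 (u : ℝ → ℂ) (s * (2 * Real.pi)⁻¹) = _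
  congr 1
  rw [Real.fourier_real_eq_integral_exp_smul, hat]
  refine integral_congr_ae (Eventually.of_forall fun y => ?_)
  simp only [smul_eq_mul]
  congr 2
  have : (Real.pi : ℂ) ≠ 0 := by exact_mod_cast Real.pi_ne_zero
  push_cast
  field_simp

theorem kappa_congr {r r' : ℝ} (h : r = r') (hr : 0 < r) (hr' : 0 < r') :
    kappa r hr = kappa r' hr' := by
  subst h
  rfl

/-- The Fourier transform intertwines a dilation with the inverse dilation. -/
theorem fourierOp_comp_kappa (r : ℝ) (hr : 0 < r) :
    fourierOp.comp (kappa r hr) = (kappa r⁻¹ (inv_pos.2 hr)).comp fourierOp := by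
  ext u s
  change fourierOp (kappa r hr u) s = kappa r⁻¹ (inv_pos.2 hr) (fourierOp u) s
  rw [kappa_apply, fourierOp_apply, fourierOp_apply, mul_left_comm]
  congr 1
  have hr0 : (r : ℂ) ≠ 0 := by exact_mod_cast hr.ne'
  have h1 : hat (kappa r hr u) s = ((Real.sqrt r : ℝ) : ℂ) * ∫ y : ℝ,
      (fun y : ℝ => Complex.exp (-(Complex.I * y * ((s * r⁻¹ : ℝ) : ℂ))) * u y) (y * r) := by
    rw [hat, ← integral_const_mul]
    refine integral_congr_ae (Eventually.of_forall fun y => ?_)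
    simp only [kappa_apply]
    rw [mul_left_comm]
    congr 3
    push_cast
    field_simp
  rw [h1, Measure.integral_comp_mul_right
    (fun y : ℝ => Complex.exp (-(Complex.I * y * ((s * r⁻¹ : ℝ) : ℂ))) * u y),
    abs_of_pos (inv_pos.2 hr), Complex.real_smul, ← mul_assoc,
    ← Complex.ofReal_mul, ← hat]
  congr 2
  rw [Real.sqrt_inv, ← div_eq_mul_inv, Real.sqrt_div_self']
  simp

theorem integral_kernel_swap {K : ℝ → ℝ → ℂ} (hK : Continuous fun p : ℝ × ℝ => K p.1 p.2) {C : ℝ}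
    {k J : ℕ} (hb : ∀ t s, ‖K t s‖ ≤ C * (1 + |t|) ^ k * (1 + |s|) ^ J) (u w : 𝓢(ℝ, ℂ)) :
    ∫ t, w t * ∫ s, K t s * u s = ∫ s, (∫ t, K t s * w t) * u s := by
  obtain ⟨p, -, hp⟩ := exists_seminorm_integral_weight k
  obtain ⟨q, -, hq⟩ := exists_seminorm_integral_weight J
  have hint : Integrable (fun z : ℝ × ℝ => K z.1 z.2 * w z.1 * u z.2) (volume.prod volume) := by
    refine ((((hp w).1.const_mul C).mul_prod (hq u).1)).mono' ?_ (Eventually.of_forall fun z => ?_)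
    · exact ((hK.mul (w.continuous.comp continuous_fst)).mul
        (u.continuous.comp continuous_snd)).aestronglyMeasurable
    · rw [norm_mul, norm_mul]
      calc ‖K z.1 z.2‖ * ‖w z.1‖ * ‖u z.2‖
          ≤ C * (1 + |z.1|) ^ k * (1 + |z.2|) ^ J * ‖w z.1‖ * ‖u z.2‖ := by
            gcongr
            exact hb _ _
        _ = _ := by ring
  calc ∫ t, w t * ∫ s, K t s * u s = ∫ t, ∫ s, K t s * w t * u s := by
        refine integral_congr_ae (Eventually.of_forall fun t => ?_)
        simp only
        rw [← integral_const_mul]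
        refine integral_congr_ae (Eventually.of_forall fun s => ?_)
        simp only
        ring
    _ = ∫ s, ∫ t, K t s * w t * u s := integral_integral_swap hint
    _ = _ := by
        refine integral_congr_ae (Eventually.of_forall fun s => ?_)
        exact integral_mul_const _ _

theorem integral_fourierOp_mul (u w : 𝓢(ℝ, ℂ)) :
    ∫ s, w s * fourierOp u s = ∫ s, fourierOp w s * u s := by
  have := integral_kernel_swap
    (K := fun s y : ℝ => (2 * Real.pi : ℂ)⁻¹ * Complex.exp (-(Complex.I * y * s)))
    (C := (2 * Real.pi)⁻¹) (k := 0) (J := 0) (by fun_prop) (fun s y => by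
      have : -(Complex.I * y * s) = ((-(y * s) : ℝ) : ℂ) * Complex.I := by push_cast; ring
      rw [norm_mul, this, Complex.norm_exp_ofReal_mul_I, norm_inv, norm_mul, Complex.norm_real,
        Real.norm_of_nonneg Real.pi_pos.le]
      simp) u w
  have h1 : ∀ s, fourierOp u s
      = ∫ y : ℝ, (2 * Real.pi : ℂ)⁻¹ * Complex.exp (-(Complex.I * y * s)) * u y := fun s => by
    rw [fourierOp_apply, hat, ← integral_const_mul]
    simp only [mul_assoc]
  have h2 : ∀ y : ℝ, fourierOp w y
      = ∫ s : ℝ, (2 * Real.pi : ℂ)⁻¹ * Complex.exp (-(Complex.I * y * s)) * w s := fun y => by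
    rw [fourierOp_apply, hat, ← integral_const_mul]
    refine integral_congr_ae (Eventually.of_forall fun s => ?_)
    simp only [mul_assoc, mul_comm (s : ℂ)]
  simpa only [h1, h2] using this

end Fourier

/-! ### Operator-valued symbols of oscillating kernels -/

section OperatorSymbol

variable {d : ℕ} {X : Set (Amb d)} {S : Set (Amb d × Amb d)} {φ : Amb d × Amb d → ℝ}
  {μ : ℝ} {k : ℕ} {G : {G : Amb d × Amb d → ℂ // ContDiff ℝ ∞ G}}

theorem Dir.tan_tangential (i : Fin d) :
    ((Dir.tan i).vec.1.2 = 0 ∧ (Dir.tan i).vec.2.2 = 0)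
      ∧ ‖((Dir.tan i).vec.1.1, (Dir.tan i).vec.2.1)‖ ≤ 1 := by
  simp [Dir.vec, Prod.norm_def]

theorem Dir.cotan_tangential (i : Fin d) :
    ((Dir.cotan i : Dir d).vec.1.2 = 0 ∧ (Dir.cotan i : Dir d).vec.2.2 = 0)
      ∧ ‖((Dir.cotan i : Dir d).vec.1.1, (Dir.cotan i : Dir d).vec.2.1)‖ ≤ 1 := by
  simp [Dir.vec, Prod.norm_def]

/-- The operators with kernel `G`, applied to the Fourier transform, form an operator-valued
symbol. -/
theorem isOperatorSymbol_kernelOp (h : IsOscSetting X S φ)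
    (hG : IsSidedKernel X S φ true μ k G.1) :
    IsOperatorSymbol μ kappa kappa fun x ξ => (kernelOp true G.1 (x, ξ)).comp fourierOp := by
  have := isOperatorSymbol_of_equiBounded (m := μ) (κE := kappa) (κF := kappa)
    hasSeminormBasis_schwartz
    (fun β α x ξ => (kernelOp true (tangentialPd G β α) (x, ξ)).comp fourierOp) ?_ ?_ ?_ ?_
  · simpa only [tangentialPd_zero] using this
  · intro β α z₀
    obtain ⟨k', hk⟩ := isSidedKernel_tangentialPd G h hG β α
    exact (hk.equiBoundedOn_sub h z₀).comp_right fourierOp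
  · intro β α i x ξ
    obtain ⟨k', hk⟩ := isSidedKernel_tangentialPd G h hG β α
    refine ((hk.equiBoundedOn_taylor h (Dir.tan_tangential i).1 (Dir.tan_tangential i).2
      (x, ξ)).comp_right fourierOp).congr fun r _ => ?_
    rw [tangentialPd_add_left]
    simp [Dir.vec, ContinuousLinearMap.sub_comp, ContinuousLinearMap.smul_comp]
  · intro β α i x ξ
    obtain ⟨k', hk⟩ := isSidedKernel_tangentialPd G h hG β α
    refine ((hk.equiBoundedOn_taylor h (Dir.cotan_tangential i).1 (Dir.cotan_tangential i).2
      (x, ξ)).comp_right fourierOp).congr fun r _ => ?_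
    rw [tangentialPd_add_right]
    simp [Dir.vec, ContinuousLinearMap.sub_comp, ContinuousLinearMap.smul_comp]
  · intro β α K hK
    obtain ⟨k', hk⟩ := isSidedKernel_tangentialPd G h hG β α
    refine ((hk.equiBoundedOn_conj h hK (fun ξ => (jb ξ)⁻¹) (fun ξ => inv_pos.2 (jb_pos ξ))
      fun ξ => by simp [outDir, Dir.wt]).comp_right fourierOp).congr fun z _ => ?_
    simp only [ContinuousLinearMap.comp_assoc, fourierOp_comp_kappa]

/-- The transposes of the operators with transposed kernel `G`, followed by the Fourier transform,
form an operator-valued symbol on `𝓢'(ℝ)`. -/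
theorem isOperatorSymbol_precomp_kernelOp (h : IsOscSetting X S φ)
    (hG : IsSidedKernel X S φ false μ k G.1) :
    IsOperatorSymbol μ kappaDual kappaDual fun x ξ =>
      ContinuousLinearMap.precomp ℂ (fourierOp.comp (kernelOp false G.1 (x, ξ))) := by
  have := isOperatorSymbol_of_equiBounded (m := μ) (κE := kappaDual) (κF := kappaDual)
    hasSeminormBasis_tempDual
    (fun β α x ξ => (ContinuousLinearMap.precomp ℂ
      (fourierOp.comp (kernelOp false (tangentialPd G β α) (x, ξ))) : TempDual →L[ℂ] TempDual))
    ?_ ?_ ?_ ?_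
  · simpa only [tangentialPd_zero] using this
  · intro β α z₀
    obtain ⟨k', hk⟩ := isSidedKernel_tangentialPd G h hG β α
    refine (((hk.equiBoundedOn_sub h z₀).comp_left fourierOp).precomp
      fun z hz => norm_pos_iff.2 (sub_ne_zero.2 hz.1)).congr fun z _ => ?_
    ext T u
    simp
  · intro β α i x ξ
    obtain ⟨k', hk⟩ := isSidedKernel_tangentialPd G h hG β α
    refine (((hk.equiBoundedOn_taylor h (Dir.tan_tangential i).1 (Dir.tan_tangential i).2
      (x, ξ)).comp_left fourierOp).precomp fun r hr => abs_pos.2 hr.1).congr fun r _ => ?_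
    rw [tangentialPd_add_left]
    ext T u
    simp [Dir.vec]
  · intro β α i x ξ
    obtain ⟨k', hk⟩ := isSidedKernel_tangentialPd G h hG β α
    refine (((hk.equiBoundedOn_taylor h (Dir.cotan_tangential i).1 (Dir.cotan_tangential i).2
      (x, ξ)).comp_left fourierOp).precomp fun r hr => abs_pos.2 hr.1).congr fun r _ => ?_
    rw [tangentialPd_add_right]
    ext T u
    simp [Dir.vec]
  · intro β α K hK
    obtain ⟨k', hk⟩ := isSidedKernel_tangentialPd G h hG β α
    refine (((hk.equiBoundedOn_conj h hK jb jb_pos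
      fun ξ => by simp [outDir, Dir.wt, Real.rpow_neg_one]).comp_left fourierOp).precomp
      fun z _ => Real.rpow_pos_of_pos (jb_pos _) _).congr fun z _ => ?_
    ext T u
    have h1 := kappa_congr (inv_inv (jb z.2)) (inv_pos.2 (inv_pos.2 (jb_pos z.2))) (jb_pos z.2)
    have h2 : ∀ v, fourierOp (kappa (jb z.2) (jb_pos z.2) v)
        = kappa (jb z.2)⁻¹ (inv_pos.2 (jb_pos z.2)) (fourierOp v) := fun v =>
      DFunLike.congr_fun (fourierOp_comp_kappa (jb z.2) (jb_pos z.2)) v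
    change T (kappa (jb z.2)⁻¹ (inv_pos.2 (jb_pos z.2)) (fourierOp (kernelOp false
      (tangentialPd G β α) z (kappa (jb z.2)⁻¹⁻¹ (inv_pos.2 (inv_pos.2 (jb_pos z.2))) u))))
      = T (fourierOp (kappa (jb z.2) (jb_pos z.2) (kernelOp false
        (tangentialPd G β α) z (kappa (jb z.2) (jb_pos z.2) u))))
    rw [h2, h1]

/-- The two families of operators agree on `𝓢(ℝ)`. -/
theorem precomp_kernelOp_toTempDual (h : IsOscSetting X S φ) {k' : ℕ} {G : Amb d × Amb d → ℂ}
    (hG : IsSidedKernel X S φ true μ k G) (hG' : IsSidedKernel X S φ false μ k' G)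
    (z : Bdry d × Bdry d) (u : 𝓢(ℝ, ℂ)) :
    ContinuousLinearMap.precomp ℂ (fourierOp.comp (kernelOp false G z)) (toTempDual u)
      = toTempDual (kernelOp true G z (fourierOp u)) := by
  ext w
  change toTempDual u (fourierOp (kernelOp false G z w)) = _
  obtain ⟨C, J, -, hb⟩ := hG.bound_at z
  rw [toTempDual_apply, toTempDual_apply, ← integral_fourierOp_mul]
  simp only [kernelOp_apply h hG, kernelOp_apply h hG']
  exact (integral_kernel_swap (K := fun t s => G (pt true z t s))
    ((hG.contDiff h).continuous.comp (continuous_pt true z)) hb (fourierOp u) w).symm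

end OperatorSymbol

/-! ### Supports -/

section Supports

variable {d : ℕ}

theorem conicSupport_tsupport {Ωb : Set (Bdry d)} {N : Set (Amb d)} (hN : N ⊆ collar Ωb)
    {a : Amb d × Amb d → ℂ} (h0 : ∀ x : Amb d, ((x, 0) : Amb d × Amb d) ∉ tsupport a)
    (hsupp : closure {x : Amb d | ∃ ξ : Amb d, a (x, ξ) ≠ 0} ⊆ N) :
    ConicSupport N (tsupport a) := by
  intro K hK
  set X₀ := closure {x : Amb d | ∃ ξ : Amb d, a (x, ξ) ≠ 0}
  have hmem : ∀ z ∈ tsupport a, z.1 ∈ X₀ := by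
    intro z hz
    refine closure_mono ?_ (image_closure_subset_closure_image continuous_fst (mem_image_of_mem _ hz))
    rintro _ ⟨w, hw, rfl⟩
    exact ⟨w.2, hw⟩
  let L : Set (Amb d) := K ×ˢ Icc (-1 : ℝ) 1 ∩ X₀
  have hL : IsCompact L := (hK.prod isCompact_Icc).inter_right isClosed_closure
  have hmemL : ∀ z ∈ tsupport a, z.1.1 ∈ K → z.1 ∈ L := fun z hz hzK =>
    ⟨⟨hzK, Ioo_subset_Icc_self (hN (hsupp (hmem z hz))).2⟩, hmem z hz⟩
  obtain ⟨c, hc, hcb⟩ := ((hL.prod (isCompact_closedBall (0 : Amb d) 1)).inter_right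
    (isClosed_tsupport a)).exists_forall_le' (f := fun z => ‖z.2‖) (a := 0)
    (by fun_prop) (fun z hz => by
      refine norm_pos_iff.2 fun h => h0 z.1 ?_
      rw [← h]
      exact hz.2)
  refine ⟨L, hL, fun x hx => hsupp hx.2, min c 1, lt_min hc one_pos, fun z hz hzK =>
    ⟨hmemL z hz hzK, ?_⟩⟩
  rcases le_total ‖z.2‖ 1 with hz1 | hz1
  · exact (min_le_left _ _).trans (hcb z ⟨⟨hmemL z hz hzK, by simpa using hz1⟩, hz⟩)
  · exact (min_le_right _ _).trans hz1

end Supports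

/-! ### The operators in the normal direction -/

theorem isOscKernel_phase {d : ℕ} {X : Set (Amb d)} {a : Amb d × Amb d → ℂ} {m : ℝ}
    (hS : ConicSupport X (tsupport a)) (ha : IsSymbol m a) (φ : Amb d × Amb d → ℝ) :
    IsOscKernel X (tsupport a) φ m 0 m fun z => Complex.exp (Complex.I * (φ z : ℂ)) * a z :=
  ⟨a, ha.isAmp hS, fun _ hz => image_eq_zero_of_notMem_tsupport hz, rfl⟩

end

theorem theorem2 (d : ℕ) (Ωb : Set (Bdry d)) (hΩ : IsOpen Ωb) (hΩc : IsConnected Ωb)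
    (U : Set (Amb d × Amb d)) (χ : Amb d × Amb d → Amb d × Amb d)
    (hχ : IsBoundarySymplecto U χ) (hadm : IsAdmissible U χ)
    (ψ : Amb d × Amb d → ℝ) (hψ : IsPhaseOf U χ Ωb ψ) :
    ∃ N : Set (Amb d), IsOpen N ∧ (∀ x ∈ Ωb, ((x, 0) : Amb d) ∈ N) ∧ N ⊆ collar Ωb ∧
      ∀ (m : ℝ) (a : Amb d × Amb d → ℂ), IsSymbol m a → HasTransmission m a →
        (∀ x : Amb d, ((x, 0) : Amb d × Amb d) ∉ tsupport a) →
        closure {x : Amb d | ∃ ξ : Amb d, a (x, ξ) ≠ 0} ⊆ N →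
        ∃ (A : Bdry d → Bdry d → 𝓢(ℝ, ℂ) →L[ℂ] 𝓢(ℝ, ℂ))
          (B : Bdry d → Bdry d → TempDual →L[ℂ] TempDual),
          (∀ (x ξ : Bdry d) (u : 𝓢(ℝ, ℂ)) (t : ℝ), A x ξ u t = normalOp ψ a x ξ u t) ∧
          IsOperatorSymbol m kappa kappa A ∧
          (∀ (x ξ : Bdry d) (u : 𝓢(ℝ, ℂ)), B x ξ (toTempDual u) = toTempDual (A x ξ u)) ∧
          IsOperatorSymbol m kappaDual kappaDual B := by
  refine ⟨goodSet Ωb ψ, isOpen_goodSet hψ hΩ, fun x hx => mem_goodSet_of_bdry hψ hΩ hχ hx,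
    fun x hx => hx.1, fun m a ha _ h0 hsupp => ?_⟩
  have hN : goodSet Ωb ψ ⊆ collar Ωb := fun x hx => hx.1
  have hS : ConicSupport (goodSet Ωb ψ) (tsupport a) := conicSupport_tsupport hN h0 hsupp
  have hSX : ConicSupport (collar Ωb) (tsupport a) := hS.mono hN
  have h : IsOscSetting (collar Ωb) (tsupport a) (redPhase ψ) :=
    ⟨isOpen_collar hΩ, isClosed_tsupport a, hSX.subset, isNormalPhase_redPhase hψ hΩ hχ hS⟩
  have hG := isOscKernel_phase hSX ha (redPhase ψ)
  set G : Amb d × Amb d → ℂ := fun z => Complex.exp (Complex.I * (redPhase ψ z : ℂ)) * a z with hGdef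
  -- sided kernels have integral exponents of growth, so the power `m` of `|ξ_n|` is rounded up
  have hG₁ : IsSidedKernel (collar Ωb) (tsupport a) (redPhase ψ) true m 0 G :=
    ⟨⌈m⌉₊, hG.mono le_rfl (by simp) (Nat.le_ceil m)⟩
  have hG₂ : IsSidedKernel (collar Ωb) (tsupport a) (redPhase ψ) false m ⌈m⌉₊ G :=
    ⟨0, hG.mono le_rfl (by simp) (Nat.le_ceil m)⟩
  refine ⟨fun x ξ => (kernelOp true G (x, ξ)).comp fourierOp,
    fun x ξ => ContinuousLinearMap.precomp ℂ (fourierOp.comp (kernelOp false G (x, ξ))),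
    fun x ξ u t => ?_, isOperatorSymbol_kernelOp (G := ⟨G, hG₁.contDiff h⟩) h hG₁,
    fun x ξ u => precomp_kernelOp_toTempDual h hG₁ hG₂ (x, ξ) u,
    isOperatorSymbol_precomp_kernelOp (G := ⟨G, hG₁.contDiff h⟩) h hG₂⟩
  change kernelOp true G (x, ξ) (fourierOp u) t = _
  rw [kernelOp_apply h hG₁, normalOp, ← integral_const_mul]
  refine integral_congr_ae (Eventually.of_forall fun s => ?_)
  simp only [hGdef, pt, redPhase, fourierOp_apply]
  ring
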